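/- Let $q\in\mathbb C\setminus\{0\}$ be generic ($q^k\neq 1$ for all $k\ge 1$), put $k_q=(q^k-q^{-k})/(q-q^{-1})$, and let $V=\mathbb C^N$. Let $R:V^{\otimes 2}\to V^{\otimes 2}$ be a skew-invertible Hecke symmetry, that is, $R_{12}R_{23}R_{12}=R_{23}R_{12}R_{23}$ on $V^{\otimes 3}$, $(qI-R)(q^{-1}I+R)=0$, and there is $\Psi:V^{\otimes 2}\to V^{\otimes 2}$ with $\mathrm{Tr}_{(2)}(R_{12}\Psi_{23})=P_{13}=\mathrm{Tr}_{(2)}(\Psi_{12}R_{23})$, where $P$ is the flip; put $C=\mathrm{Tr}_{(2)}\Psi$. Suppose that $R$ is even of bi-rank $(m|0)$: the $R$-skew-symmetric algebra $T(V)/\langle\mathrm{Im}(q^{-1}I+R)\rangle$ is finite-dimensional and its Hilbert–Poincaré series is a polynomial of degree $m$. Let $\mathcal L(R)$ be the reflection equation algebra, i.e. the unital associative $\mathbb C$-algebra generated by the entries of $L=\|l_i^j\|_{1\le i,j\le N}$ with the relations $R(L\otimes I)R(L\otimes I)=(L\otimes I)R(L\otimes I)R$. Let $R_k$ be the operator $R$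 acting in the tensor factors $k,k+1$, and put $L_{\overline 1}=L\otimes I\otimes\dots\otimes I$, $L_{\overline{k+1}}=R_kL_{\overline k}R_k^{-1}$. For $z$ in the Hecke algebra $\mathcal H_n(q)$ with the generators $\tau_1,\dots,\tau_{n-1}$, put $$ch(z)=\mathrm{Tr}_{(1\dots n)}\bigl(C_1\cdots C_n\,\rho_R(z)\,L_{\overline 1}L_{\overline 2}\cdots L_{\overline n}\bigr),\qquad \rho_R(\tau_k)=R_k .$$ The characteristic subalgebra is the linear span of all $ch(z)$, $z\in\mathcal H_n(q)$, $n\ge 1$. Define $a_n=ch(A^{(n)})$, where $A^{(n)}\in\mathcal H_n(q)$ is the $q$-antisymmetrizer (the primitive idempotent belonging to the partition $(1^n)$, on which every $\tau_i$ acts as $-q^{-1}$), and $a_0=1$; define $p_n=ch(\tau_{n-1}\cdots\tau_1)$ and $t_n=ch(\tau_{n-1}^{-1}\cdots\tau_1^{-1})$. Then for all $n\ge 1$ $$n_q\,a_n+\sum_{k=1}^n(-1)^kq^{\,n-k}a_{n-k}\,p_k=0,\qquad n_q\,a_n+\sum_{k=1}^n(-1)^kq^{\,k-n}a_{n-k}\,t_k=0,$$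 $$p_n=t_n+(q-q^{-1})\sum_{k=1}^{n-1}p_{n-k}\,t_k,$$ and $a_n=0$ for $n>m$. Moreover, for every $n$ the sets $\{a_k\}_{1\le k\le n}$, $\{p_k\}_{1\le k\le n}$ and $\{t_k\}_{1\le k\le n}$ generate the same (not necessarily unital) subalgebra of $\mathcal L(R)$, and each of the sets $\{a_k\}_{1\le k\le m}$, $\{p_k\}_{1\le k\le m}$, $\{t_k\}_{1\le k\le m}$ generates the characteristic subalgebra. -/

import Mathlib

open scoped Kronecker

noncomputable section

namespace RE

/-! ### Placing matrices at tensor factors -/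

section Place

variable {S : Type*} [Semiring S] {N r n s : ℕ}

/-- `A` acting in the tensor factors `f 0, …, f (r-1)` of the `n`-fold tensor power of `S ^ N`
(and as the identity in the other factors). Multi-indices are functions `Fin n → Fin N`. -/
def place (f : Fin r → Fin n) (A : Matrix (Fin r → Fin N) (Fin r → Fin N) S) :
    Matrix (Fin n → Fin N) (Fin n → Fin N) S := by
  classical
  exact Matrix.of fun x y => if ∀ j, j ∉ Set.range f → x j = y j then A (x ∘ f) (y ∘ f) else 0

theorem place_apply_pos (f : Fin r → Fin n) (A : Matrix (Fin r → Fin N) (Fin r → Fin N) S)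
    {x y : Fin n → Fin N} (h : ∀ j, j ∉ Set.range f → x j = y j) :
    place f A x y = A (x ∘ f) (y ∘ f) := by
  classical
  simp only [place, Matrix.of_apply]
  rw [if_pos h]

theorem place_apply_neg (f : Fin r → Fin n) (A : Matrix (Fin r → Fin N) (Fin r → Fin N) S)
    {x y : Fin n → Fin N} (h : ¬ ∀ j, j ∉ Set.range f → x j = y j) :
    place f A x y = 0 := by
  classical
  simp only [place, Matrix.of_apply]
  rw [if_neg h]

theorem place_add (f : Fin r → Fin n) (A B : Matrix (Fin r → Fin N) (Fin r → Fin N) S) :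
    place f (A + B) = place f A + place f B := by
  ext x y
  by_cases h : ∀ j, j ∉ Set.range f → x j = y j
  · simp [place_apply_pos f _ h]
  · simp [place_apply_neg f _ h]

theorem place_smul (f : Fin r → Fin n) (c : S) (A : Matrix (Fin r → Fin N) (Fin r → Fin N) S) :
    place f (c • A) = c • place f A := by
  ext x y
  by_cases h : ∀ j, j ∉ Set.range f → x j = y j
  · simp [place_apply_pos f _ h]
  · simp [place_apply_neg f _ h]

theorem place_one (f : Fin r → Fin n) :
    place f (1 : Matrix (Fin r → Fin N) (Fin r → Fin N) S) = 1 := by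
  ext x y
  by_cases h : ∀ j, j ∉ Set.range f → x j = y j
  · rw [place_apply_pos f _ h, Matrix.one_apply, Matrix.one_apply]
    refine if_congr ⟨fun e => ?_, fun e => by rw [e]⟩ rfl rfl
    funext j
    by_cases hj : j ∈ Set.range f
    · obtain ⟨i, rfl⟩ := hj
      exact congrFun e i
    · exact h j hj
  · rw [place_apply_neg f _ h, Matrix.one_apply_ne]
    rintro rfl
    exact h fun _ _ => rfl

theorem place_mul (f : Fin r → Fin n) (hf : Function.Injective f)
    (A B : Matrix (Fin r → Fin N) (Fin r → Fin N) S) :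
    place f (A * B) = place f A * place f B := by
  classical
  ext x y
  rw [Matrix.mul_apply]
  by_cases h : ∀ j, j ∉ Set.range f → x j = y j
  · rw [place_apply_pos f _ h, Matrix.mul_apply]
    let g : (Fin r → Fin N) → (Fin n → Fin N) := fun u => Function.extend f u x
    have hg : ∀ u, g u ∘ f = u := fun u => by
      funext i; exact hf.extend_apply u x i
    have hg' : ∀ u, ∀ j, j ∉ Set.range f → g u j = x j := fun u j hj =>
      Function.extend_apply' u x j (fun ⟨i, hi⟩ => hj ⟨i, hi⟩)
    refine Finset.sum_of_injOn g (fun u _ v _ e => by rw [← hg u, e, hg v])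
      (fun _ _ => Finset.mem_coe.2 (Finset.mem_univ _)) ?_ ?_
    · intro z _ hz
      rw [place_apply_neg f A, zero_mul]
      intro hxz
      refine hz ⟨z ∘ f, Finset.mem_coe.2 (Finset.mem_univ _), ?_⟩
      funext j
      by_cases hj : j ∈ Set.range f
      · obtain ⟨i, rfl⟩ := hj
        exact congrFun (hg (z ∘ f)) i
      · rw [hg' _ j hj, hxz j hj]
    · intro u _
      rw [place_apply_pos f A (fun j hj => (hg' u j hj).symm),
        place_apply_pos f B (fun j hj => (hg' u j hj).trans (h j hj)), hg]
  · rw [place_apply_neg f _ h]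
    symm
    refine Finset.sum_eq_zero fun z _ => ?_
    by_cases h1 : ∀ j, j ∉ Set.range f → x j = z j
    · rw [place_apply_neg f B, mul_zero]
      intro h2
      exact h fun j hj => (h1 j hj).trans (h2 j hj)
    · rw [place_apply_neg f A h1, zero_mul]

theorem place_place (f : Fin r → Fin n) (hf : Function.Injective f) (g : Fin s → Fin r)
    (A : Matrix (Fin s → Fin N) (Fin s → Fin N) S) :
    place f (place g A) = place (f ∘ g) A := by
  ext x y
  by_cases h : ∀ j, j ∉ Set.range (f ∘ g) → x j = y j
  · have h1 : ∀ j, j ∉ Set.range f → x j = y j := fun j hj =>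
      h j fun ⟨i, hi⟩ => hj ⟨g i, hi⟩
    have h2 : ∀ j, j ∉ Set.range g → (x ∘ f) j = (y ∘ f) j := fun j hj =>
      h (f j) fun ⟨i, hi⟩ => hj ⟨i, hf hi⟩
    rw [place_apply_pos _ _ h, place_apply_pos _ _ h1, place_apply_pos _ _ h2]
    rfl
  · rw [place_apply_neg _ _ h]
    by_cases h1 : ∀ j, j ∉ Set.range f → x j = y j
    · rw [place_apply_pos _ _ h1, place_apply_neg]
      intro h2
      refine h fun j hj => ?_
      by_cases hjf : j ∈ Set.range f
      · obtain ⟨i, rfl⟩ := hjf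
        exact h2 i fun ⟨k, hk⟩ => hj ⟨k, by rw [Function.comp_apply, hk]⟩
      · exact h1 j hjf
    · rw [place_apply_neg _ _ h1]

theorem place_comm {S : Type*} [CommSemiring S] (f : Fin r → Fin n) (g : Fin s → Fin n)
    (hfg : ∀ i j, f i ≠ g j)
    (A : Matrix (Fin r → Fin N) (Fin r → Fin N) S)
    (B : Matrix (Fin s → Fin N) (Fin s → Fin N) S) :
    place f A * place g B = place g B * place f A := by
  classical
  have key : ∀ {r s : ℕ} (f : Fin r → Fin n) (g : Fin s → Fin n) (_ : ∀ i j, f i ≠ g j)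
      (A : Matrix (Fin r → Fin N) (Fin r → Fin N) S)
      (B : Matrix (Fin s → Fin N) (Fin s → Fin N) S) (x y : Fin n → Fin N),
      (place f A * place g B) x y =
        if ∀ j, j ∉ Set.range f → j ∉ Set.range g → x j = y j then
          A (x ∘ f) (y ∘ f) * B (x ∘ g) (y ∘ g) else 0 := by
    intro r s f g hfg A B x y
    rw [Matrix.mul_apply]
    let z : Fin n → Fin N := fun j => if j ∈ Set.range f then y j else x j
    have zf : z ∘ f = y ∘ f := by
      funext i; simp [z]
    have zg : z ∘ g = x ∘ g := by
      funext i
      have : g i ∉ Set.range f := fun ⟨k, hk⟩ => hfg k i hk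
      simp only [z, Function.comp_apply, if_neg this]
    have hxz : ∀ j, j ∉ Set.range f → x j = z j := fun j hj => by simp only [z, if_neg hj]
    rw [Finset.sum_eq_single z]
    · rw [place_apply_pos f A hxz, zf]
      by_cases h : ∀ j, j ∉ Set.range f → j ∉ Set.range g → x j = y j
      · rw [if_pos h, place_apply_pos g B, zg]
        intro j hj
        by_cases hjf : j ∈ Set.range f
        · simp only [z, if_pos hjf]
        · rw [← hxz j hjf]; exact h j hjf hj
      · rw [if_neg h, place_apply_neg g B, mul_zero]
        intro h2
        exact h fun j hjf hjg => (hxz j hjf).trans (h2 j hjg)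
    · intro w _ hw
      by_cases h1 : ∀ j, j ∉ Set.range f → x j = w j
      · rw [place_apply_neg g B, mul_zero]
        intro h2
        refine hw (funext fun j => ?_)
        by_cases hjf : j ∈ Set.range f
        · simp only [z, if_pos hjf]
          exact h2 j fun ⟨k, hk⟩ => by
            obtain ⟨i, hi⟩ := hjf
            exact hfg i k (hi.trans hk.symm)
        · rw [← h1 j hjf, hxz j hjf]
      · rw [place_apply_neg f A h1, zero_mul]
    · intro h; exact absurd (Finset.mem_univ _) h
  ext x y
  rw [key f g hfg, key g f fun i j => (hfg j i).symm]
  refine if_congr ⟨fun h j a b => h j b a, fun h j a b => h j b a⟩ (mul_comm _ _) rfl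

end Place

section Sites

variable {S : Type*} [Semiring S] {N : ℕ}

/-- A matrix acting on the tensor square of `S ^ N`, reindexed by functions `Fin 2 → Fin N`. -/
def pairMat (R : Matrix (Fin N × Fin N) (Fin N × Fin N) S) :
    Matrix (Fin 2 → Fin N) (Fin 2 → Fin N) S :=
  Matrix.of fun u v => R (u 0, u 1) (v 0, v 1)

/-- `I ⊗ … ⊗ I ⊗ R ⊗ I ⊗ … ⊗ I` on `n` tensor factors, with `R` in the factors number `k` and
`k + 1`, factors being counted from `0`. (It is set to the identity if `k + 1 ≥ n`.) -/
def site2 (n : ℕ) (R : Matrix (Fin N × Fin N) (Fin N × Fin N) S) (k : ℕ) :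
    Matrix (Fin n → Fin N) (Fin n → Fin N) S :=
  if h : k + 1 < n then
    place (fun i : Fin 2 => (⟨k + i, by omega⟩ : Fin n)) (pairMat R)
  else 1

/-- `M ⊗ I ⊗ … ⊗ I` on `n` tensor factors. (It is set to the identity if `n = 0`.) -/
def site1 (n : ℕ) (M : Matrix (Fin N) (Fin N) S) : Matrix (Fin n → Fin N) (Fin n → Fin N) S :=
  if h : 0 < n then
    place (fun _ : Fin 1 => (⟨0, h⟩ : Fin n)) (Matrix.of fun u v => M (u 0) (v 0))
  else 1

end Sites

/-! ### Hecke symmetries -/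

/-- `q` is a nonzero complex number which is not a root of unity. -/
def IsGeneric (q : ℂ) : Prop := q ≠ 0 ∧ ∀ k : ℕ, 1 ≤ k → q ^ k ≠ 1

/-- The `q`-number `k_q = (q ^ k - q ^ (-k)) / (q - q ^ (-1))`. -/
def qNum (q : ℂ) (k : ℕ) : ℂ := (q ^ k - q⁻¹ ^ k) / (q - q⁻¹)

variable {N : ℕ}

/-- Hecke symmetries: the braid relation `R₁₂ R₂₃ R₁₂ = R₂₃ R₁₂ R₂₃` on three tensor factors and
the Hecke condition. -/
structure IsHeckeSymmetry (q : ℂ) (R : Matrix (Fin N × Fin N) (Fin N × Fin N) ℂ) : Prop where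
  ne_zero : q ≠ 0
  ne_one : q ≠ 1
  ne_neg_one : q ≠ -1
  braid : site2 3 R 0 * site2 3 R 1 * site2 3 R 0 = site2 3 R 1 * site2 3 R 0 * site2 3 R 1
  hecke : (q • 1 - R) * (q⁻¹ • 1 + R) = 0

/-- `Tr₍₂₎(X₁₂ Y₂₃)`, where `Tr₍₂₎` is the trace over the middle one of three tensor factors; the
result acts in the factors number 1 and 3. -/
def midTrace (X Y : Matrix (Fin N × Fin N) (Fin N × Fin N) ℂ) :
    Matrix (Fin N × Fin N) (Fin N × Fin N) ℂ :=
  Matrix.of fun u v => ∑ b : Fin N, ∑ c : Fin N, X (u.1, b) (v.1, c) * Y (c, u.2) (b, v.2)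

/-- The matrix of the flip. -/
def flip (N : ℕ) : Matrix (Fin N × Fin N) (Fin N × Fin N) ℂ :=
  Matrix.of fun u v => if u.1 = v.2 ∧ u.2 = v.1 then 1 else 0

/-- `Ψ` is a skew-inverse of `R`; a matrix `R` that has one is called skew-invertible. -/
structure IsSkewInverse (R Ψ : Matrix (Fin N × Fin N) (Fin N × Fin N) ℂ) : Prop where
  left : midTrace R Ψ = flip N
  right : midTrace Ψ R = flip N

/-- `C = Tr₍₂₎ Ψ`. -/
def cMat (Ψ : Matrix (Fin N × Fin N) (Fin N × Fin N) ℂ) : Matrix (Fin N) (Fin N) ℂ :=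
  Matrix.of fun i j => ∑ a : Fin N, Ψ (i, a) (j, a)

/-! ### The skew-symmetric algebra and the bi-rank -/

/-- The relations `Im (q⁻¹ I + R) = 0`, written out on the basis vectors `x_i ⊗ x_j`. -/
inductive SkewRel (q : ℂ) (R : Matrix (Fin N × Fin N) (Fin N × Fin N) ℂ) :
    FreeAlgebra ℂ (Fin N) → FreeAlgebra ℂ (Fin N) → Prop
  | rel (v : Fin N × Fin N) : SkewRel q R
      (∑ u : Fin N × Fin N, ((q⁻¹ • 1 + R : Matrix (Fin N × Fin N) (Fin N × Fin N) ℂ) u v) •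
        (FreeAlgebra.ι ℂ u.1 * FreeAlgebra.ι ℂ u.2)) 0

/-- The `R`-skew-symmetric algebra: the tensor algebra of `V = ℂ ^ N` modulo the ideal generated by
the image of `q⁻¹ I + R` in `V ⊗ V`. -/
def SkewAlgebra (q : ℂ) (R : Matrix (Fin N × Fin N) (Fin N × Fin N) ℂ) : Type :=
  RingQuot (SkewRel q R)

instance (q : ℂ) (R : Matrix (Fin N × Fin N) (Fin N × Fin N) ℂ) : Ring (SkewAlgebra q R) :=
  inferInstanceAs (Ring (RingQuot (SkewRel q R)))

instance (q : ℂ) (R : Matrix (Fin N × Fin N) (Fin N × Fin N) ℂ) : Algebra ℂ (SkewAlgebra q R) :=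
  inferInstanceAs (Algebra ℂ (RingQuot (SkewRel q R)))

/-- The quotient map onto the `R`-skew-symmetric algebra. -/
def SkewAlgebra.mk (q : ℂ) (R : Matrix (Fin N × Fin N) (Fin N × Fin N) ℂ) :
    FreeAlgebra ℂ (Fin N) →ₐ[ℂ] SkewAlgebra q R :=
  RingQuot.mkAlgHom ℂ (SkewRel q R)

/-- The homogeneous component of degree `n` of the `R`-skew-symmetric algebra. -/
def skewComponent (q : ℂ) (R : Matrix (Fin N × Fin N) (Fin N × Fin N) ℂ) (n : ℕ) :
    Submodule ℂ (SkewAlgebra q R) :=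
  Submodule.span ℂ (Set.range fun w : Fin n → Fin N =>
    SkewAlgebra.mk q R (List.ofFn fun i => FreeAlgebra.ι ℂ (w i)).prod)

/-- The Hilbert-Poincaré series of the `R`-skew-symmetric algebra. -/
def skewHilbertSeries (q : ℂ) (R : Matrix (Fin N × Fin N) (Fin N × Fin N) ℂ) : PowerSeries ℕ :=
  PowerSeries.mk fun n => Module.finrank ℂ (skewComponent q R n)

/-- `R` is even of bi-rank `(m|0)`: the `R`-skew-symmetric algebra is finite dimensional, and its
Hilbert-Poincaré series is a polynomial of degree `m`. -/
def IsEvenOfBirank (q : ℂ) (R : Matrix (Fin N × Fin N) (Fin N × Fin N) ℂ) (m : ℕ) : Prop :=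
  Module.Finite ℂ (SkewAlgebra q R) ∧
    ∃ P : Polynomial ℕ, (P : PowerSeries ℕ) = skewHilbertSeries q R ∧ P.natDegree = m

/-! ### Hecke algebras -/

/-- The defining relations of the Hecke algebra; the generator `τ_{i+1}` has the index `i`. -/
inductive HeckeRel (q : ℂ) (n : ℕ) :
    FreeAlgebra ℂ (Fin (n - 1)) → FreeAlgebra ℂ (Fin (n - 1)) → Prop
  | braid (i j : Fin (n - 1)) (h : i.val + 1 = j.val) : HeckeRel q n
      (FreeAlgebra.ι ℂ i * FreeAlgebra.ι ℂ j * FreeAlgebra.ι ℂ i)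
      (FreeAlgebra.ι ℂ j * FreeAlgebra.ι ℂ i * FreeAlgebra.ι ℂ j)
  | comm (i j : Fin (n - 1)) (h : i.val + 2 ≤ j.val) : HeckeRel q n
      (FreeAlgebra.ι ℂ i * FreeAlgebra.ι ℂ j) (FreeAlgebra.ι ℂ j * FreeAlgebra.ι ℂ i)
  | hecke (i : Fin (n - 1)) : HeckeRel q n
      ((q • 1 - FreeAlgebra.ι ℂ i) * (q⁻¹ • 1 + FreeAlgebra.ι ℂ i)) 0

/-- The Hecke algebra `H_n(q)` (which is `ℂ` for `n = 0, 1`). -/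
def HeckeAlgebra (q : ℂ) (n : ℕ) : Type := RingQuot (HeckeRel q n)

instance (q : ℂ) (n : ℕ) : Ring (HeckeAlgebra q n) :=
  inferInstanceAs (Ring (RingQuot (HeckeRel q n)))

instance (q : ℂ) (n : ℕ) : Algebra ℂ (HeckeAlgebra q n) :=
  inferInstanceAs (Algebra ℂ (RingQuot (HeckeRel q n)))

/-- The quotient map onto the Hecke algebra. -/
def HeckeAlgebra.mk (q : ℂ) (n : ℕ) : FreeAlgebra ℂ (Fin (n - 1)) →ₐ[ℂ] HeckeAlgebra q n :=
  RingQuot.mkAlgHom ℂ (HeckeRel q n)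

/-- The generator `τ_{i+1}` of `H_n(q)`. (It is set to `1` if `i + 1 ≥ n`.) -/
def tau (q : ℂ) (n i : ℕ) : HeckeAlgebra q n :=
  if h : i < n - 1 then HeckeAlgebra.mk q n (FreeAlgebra.ι ℂ ⟨i, h⟩) else 1

/-- The inverse `τ - (q - q⁻¹) 1` of the generator `τ = τ_{i+1}` of `H_n(q)`; see `tau_mul_tauInv`
and `tauInv_mul_tau`. -/
def tauInv (q : ℂ) (n i : ℕ) : HeckeAlgebra q n :=
  if i < n - 1 then tau q n i - (q - q⁻¹) • 1 else 1

theorem tau_hecke (q : ℂ) (n : ℕ) {i : ℕ} (h : i < n - 1) :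
    (q • 1 - tau q n i) * (q⁻¹ • 1 + tau q n i) = 0 := by
  have e : HeckeAlgebra.mk q n _ = HeckeAlgebra.mk q n _ :=
    RingQuot.mkAlgHom_rel ℂ (HeckeRel.hecke (q := q) (n := n) ⟨i, h⟩)
  simpa [tau, h] using e

theorem mul_sub_eq_one_of_hecke {A : Type*} [Ring A] [Algebra ℂ A] {q : ℂ} (hq : q ≠ 0) (t : A)
    (e : (q • 1 - t) * (q⁻¹ • 1 + t) = 0) : t * (t - (q - q⁻¹) • 1) = 1 := by
  have e' : (q • 1 - t) * (q⁻¹ • 1 + t) = 1 - t * (t - (q - q⁻¹) • 1) := by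
    simp only [sub_mul, mul_add, mul_sub, smul_mul_assoc, mul_smul_comm, one_mul, mul_one,
      smul_smul, sub_smul, one_smul, smul_sub, inv_mul_cancel₀ hq]
    abel
  rw [e', sub_eq_zero] at e
  exact e.symm

theorem tau_mul_tauInv {q : ℂ} (hq : q ≠ 0) (n i : ℕ) : tau q n i * tauInv q n i = 1 := by
  by_cases h : i < n - 1
  · rw [tauInv, if_pos h]
    exact mul_sub_eq_one_of_hecke hq _ (tau_hecke q n h)
  · simp [tau, tauInv, h]

theorem tauInv_mul_tau {q : ℂ} (hq : q ≠ 0) (n i : ℕ) : tauInv q n i * tau q n i = 1 := by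
  rw [← tau_mul_tauInv hq n i]
  by_cases h : i < n - 1
  · simp [tauInv, h, sub_mul, mul_sub]
  · simp [tau, tauInv, h]

/-- The `q`-antisymmetrizer of `τ_1, …, τ_{k-1}` in `H_n(q)`, for `k ≤ n`. For `k = n` this is the
primitive idempotent of `H_n(q)` that belongs to the partition `(1^n)`, that is, to the
one-dimensional representation in which every `τ_i` is `-q⁻¹`. -/
def antisymmetrizer (q : ℂ) (n : ℕ) : ℕ → HeckeAlgebra q n
  | 0 => 1
  | 1 => 1
  | k + 2 => (qNum q (k + 2))⁻¹ • (antisymmetrizer q n (k + 1) *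
      (q ^ (k + 1) • 1 - qNum q (k + 1) • tau q n k) * antisymmetrizer q n (k + 1))

/-! ### The `R`-matrix representation -/

theorem pairMat_add (A B : Matrix (Fin N × Fin N) (Fin N × Fin N) ℂ) :
    pairMat (A + B) = pairMat A + pairMat B := rfl

theorem pairMat_smul (c : ℂ) (A : Matrix (Fin N × Fin N) (Fin N × Fin N) ℂ) :
    pairMat (c • A) = c • pairMat A := rfl

theorem pairMat_one : pairMat (1 : Matrix (Fin N × Fin N) (Fin N × Fin N) ℂ) = 1 := by
  ext u v
  simp only [pairMat, Matrix.of_apply, Matrix.one_apply]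
  refine if_congr ?_ rfl rfl
  rw [Prod.mk.injEq, funext_iff, Fin.forall_fin_two]

theorem pairMat_mul (A B : Matrix (Fin N × Fin N) (Fin N × Fin N) ℂ) :
    pairMat (A * B) = pairMat A * pairMat B := by
  ext u v
  simp only [pairMat, Matrix.of_apply, Matrix.mul_apply]
  exact (Fintype.sum_equiv (finTwoArrowEquiv (Fin N)) _ _ fun w => rfl).symm

theorem site2_hecke {q : ℂ} {R : Matrix (Fin N × Fin N) (Fin N × Fin N) ℂ}
    (hR : IsHeckeSymmetry q R) (n k : ℕ) (h : k + 1 < n) :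
    (q • 1 - site2 n R k) * (q⁻¹ • 1 + site2 n R k) = 0 := by
  have hf : Function.Injective (fun i : Fin 2 => (⟨k + i, by omega⟩ : Fin n)) := by
    intro i j e
    simp only [Fin.mk.injEq] at e
    exact Fin.ext (by omega)
  have e := congrArg (fun A => place (fun i : Fin 2 => (⟨k + i, by omega⟩ : Fin n)) (pairMat A))
    hR.hecke
  simp only [site2, dif_pos h]
  rw [sub_eq_add_neg, ← neg_one_smul ℂ R] at e
  simp only [pairMat_mul, pairMat_add, pairMat_smul, pairMat_one, place_mul _ hf, place_add,
    place_smul, place_one] at e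
  rw [sub_eq_add_neg, ← neg_one_smul ℂ (place _ _), e]
  ext x y
  have h0 : pairMat (0 : Matrix (Fin N × Fin N) (Fin N × Fin N) ℂ) = 0 := rfl
  rw [h0]
  by_cases hxy : ∀ j, j ∉ Set.range (fun i : Fin 2 => (⟨k + i, by omega⟩ : Fin n)) → x j = y j
  · rw [place_apply_pos _ _ hxy]; rfl
  · rw [place_apply_neg _ _ hxy]; rfl

theorem site2_comm (R : Matrix (Fin N × Fin N) (Fin N × Fin N) ℂ) (n k l : ℕ) (h : k + 2 ≤ l) :
    site2 n R k * site2 n R l = site2 n R l * site2 n R k := by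
  by_cases hl : l + 1 < n
  · simp only [site2, dif_pos hl, dif_pos (show k + 1 < n by omega)]
    refine place_comm _ _ (fun i j e => ?_) _ _
    simp only [Fin.mk.injEq] at e
    omega
  · simp only [site2, dif_neg hl, mul_one, one_mul]

theorem site2_braid {q : ℂ} {R : Matrix (Fin N × Fin N) (Fin N × Fin N) ℂ}
    (hR : IsHeckeSymmetry q R) (n k : ℕ) (h : k + 2 < n) :
    site2 n R k * site2 n R (k + 1) * site2 n R k =
      site2 n R (k + 1) * site2 n R k * site2 n R (k + 1) := by
  have hf : Function.Injective (fun i : Fin 3 => (⟨k + i, by omega⟩ : Fin n)) := by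
    intro i j e
    simp only [Fin.mk.injEq] at e
    exact Fin.ext (by omega)
  have h0 : site2 n R k = place (fun i : Fin 3 => (⟨k + i, by omega⟩ : Fin n))
      (site2 3 R 0) := by
    simp only [site2, dif_pos (show k + 1 < n by omega), dif_pos (show 0 + 1 < 3 by omega)]
    rw [place_place _ hf]
    congr 1
    funext i
    simp
  have h1 : site2 n R (k + 1) = place (fun i : Fin 3 => (⟨k + i, by omega⟩ : Fin n))
      (site2 3 R 1) := by
    simp only [site2, dif_pos (show k + 1 + 1 < n by omega), dif_pos (show 1 + 1 < 3 by omega)]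
    rw [place_place _ hf]
    congr 1
    funext i
    simp [add_assoc]
  rw [h0, h1, ← place_mul _ hf, ← place_mul _ hf, ← place_mul _ hf, ← place_mul _ hf, hR.braid]

/-- The `R`-matrix representation of `H_n(q)` in `V ^ ⊗ n`. -/
def rho {q : ℂ} {R : Matrix (Fin N × Fin N) (Fin N × Fin N) ℂ} (hR : IsHeckeSymmetry q R)
    (n : ℕ) : HeckeAlgebra q n →ₐ[ℂ] Matrix (Fin n → Fin N) (Fin n → Fin N) ℂ :=
  RingQuot.liftAlgHom ℂ ⟨FreeAlgebra.lift ℂ fun i : Fin (n - 1) => site2 n R i, by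
    intro x y hxy
    cases hxy with
    | braid i j h =>
      simp only [map_mul, FreeAlgebra.lift_ι_apply, ← h]
      exact site2_braid hR n i (by omega)
    | comm i j h =>
      simp only [map_mul, FreeAlgebra.lift_ι_apply]
      exact site2_comm R n i j h
    | hecke i =>
      simp only [map_mul, map_sub, map_add, map_smul, map_one, map_zero, FreeAlgebra.lift_ι_apply]
      exact site2_hecke hR n i (by omega)⟩

/-! ### The reflection equation algebra -/

/-- The generating matrix over the free algebra. -/
def freeL (N : ℕ) : Matrix (Fin N) (Fin N) (FreeAlgebra ℂ (Fin N × Fin N)) :=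
  Matrix.of fun i j => FreeAlgebra.ι ℂ (i, j)

/-- The matrix `R` with its entries regarded as elements of the free algebra. -/
def freeR (R : Matrix (Fin N × Fin N) (Fin N × Fin N) ℂ) :
    Matrix (Fin N × Fin N) (Fin N × Fin N) (FreeAlgebra ℂ (Fin N × Fin N)) :=
  R.map (algebraMap ℂ (FreeAlgebra ℂ (Fin N × Fin N)))

/-- The matrix `L ⊗ I` over the free algebra. -/
def freeL1 (N : ℕ) :
    Matrix (Fin N × Fin N) (Fin N × Fin N) (FreeAlgebra ℂ (Fin N × Fin N)) :=
  freeL N ⊗ₖ (1 : Matrix (Fin N) (Fin N) (FreeAlgebra ℂ (Fin N × Fin N)))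

/-- The entries of the relation `R (L ⊗ I) R (L ⊗ I) = (L ⊗ I) R (L ⊗ I) R`. -/
inductive RERel (R : Matrix (Fin N × Fin N) (Fin N × Fin N) ℂ) :
    FreeAlgebra ℂ (Fin N × Fin N) → FreeAlgebra ℂ (Fin N × Fin N) → Prop
  | rel (u v : Fin N × Fin N) : RERel R
      ((freeR R * freeL1 N * freeR R * freeL1 N) u v)
      ((freeL1 N * freeR R * freeL1 N * freeR R) u v)

/-- The reflection equation algebra `L(R)`. -/
def REAlgebra (R : Matrix (Fin N × Fin N) (Fin N × Fin N) ℂ) : Type := RingQuot (RERel R)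

instance (R : Matrix (Fin N × Fin N) (Fin N × Fin N) ℂ) : Ring (REAlgebra R) :=
  inferInstanceAs (Ring (RingQuot (RERel R)))

instance (R : Matrix (Fin N × Fin N) (Fin N × Fin N) ℂ) : Algebra ℂ (REAlgebra R) :=
  inferInstanceAs (Algebra ℂ (RingQuot (RERel R)))

/-- The quotient map onto the reflection equation algebra. -/
def REAlgebra.mk (R : Matrix (Fin N × Fin N) (Fin N × Fin N) ℂ) :
    FreeAlgebra ℂ (Fin N × Fin N) →ₐ[ℂ] REAlgebra R :=
  RingQuot.mkAlgHom ℂ (RERel R)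

/-- The generating matrix `L` of the reflection equation algebra. -/
def genL (R : Matrix (Fin N × Fin N) (Fin N × Fin N) ℂ) : Matrix (Fin N) (Fin N) (REAlgebra R) :=
  (freeL N).map (REAlgebra.mk R)

/-- The copies `L_{\overline{k+1}}` of `L` on `n` tensor factors:
`L_{\overline 1} = L ⊗ I ⊗ … ⊗ I` and `L_{\overline{k+1}} = R_k L_{\overline k} R_k⁻¹`. -/
def copyL (R : Matrix (Fin N × Fin N) (Fin N × Fin N) ℂ) (n : ℕ) :
    ℕ → Matrix (Fin n → Fin N) (Fin n → Fin N) (REAlgebra R)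
  | 0 => site1 n (genL R)
  | k + 1 => (site2 n R k).map (algebraMap ℂ _) * copyL R n k *
      (site2 n R⁻¹ k).map (algebraMap ℂ _)

/-- The product `L_{\overline 1} L_{\overline 2} … L_{\overline n}` on `n` tensor factors. -/
def prodL (R : Matrix (Fin N × Fin N) (Fin N × Fin N) ℂ) (n : ℕ) :
    Matrix (Fin n → Fin N) (Fin n → Fin N) (REAlgebra R) :=
  ((List.range n).map (copyL R n)).prod

/-- The multiple `R`-trace `Tr (C₁ C₂ … C_n M)`; the product `C₁ C₂ … C_n` is the `n`-fold tensor
power of `C`. -/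
def rTrace {U : Type*} [Semiring U] [Algebra ℂ U] (C : Matrix (Fin N) (Fin N) ℂ) (n : ℕ)
    (M : Matrix (Fin n → Fin N) (Fin n → Fin N) U) : U :=
  ((Matrix.of fun x y : Fin n → Fin N => algebraMap ℂ U (∏ i, C (x i) (y i))) * M).trace

section Characteristic

variable {q : ℂ} {R : Matrix (Fin N × Fin N) (Fin N × Fin N) ℂ} (hR : IsHeckeSymmetry q R)
  (Ψ : Matrix (Fin N × Fin N) (Fin N × Fin N) ℂ)

/-- The map `ch : H_n(q) → L(R)`, where `Ψ` is the skew-inverse of `R`. -/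
def ch (n : ℕ) (z : HeckeAlgebra q n) : REAlgebra R :=
  rTrace (cMat Ψ) n ((rho hR n z).map (algebraMap ℂ _) * prodL R n)

/-- The characteristic subalgebra, as a linear subspace of `L(R)`: the span of the images of all
the maps `ch : H_n(q) → L(R)`, `n ≥ 1`. -/
def characteristicSpace : Submodule ℂ (REAlgebra R) :=
  Submodule.span ℂ {y | ∃ n : ℕ, 1 ≤ n ∧ ∃ z : HeckeAlgebra q n, y = ch hR Ψ n z}

/-- The elementary symmetric polynomial `a_n(L)`. -/
def elemSymm (n : ℕ) : REAlgebra R := ch hR Ψ n (antisymmetrizer q n n)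

/-- The power sum of the first kind `p_n(L) = ch (τ_{n-1} … τ_1)`. -/
def powerSum (n : ℕ) : REAlgebra R :=
  ch hR Ψ n ((List.range (n - 1)).reverse.map (tau q n)).prod

/-- The power sum of the second kind `t_n(L) = ch (τ_{n-1}⁻¹ … τ_1⁻¹)`. -/
def powerSum' (n : ℕ) : REAlgebra R :=
  ch hR Ψ n ((List.range (n - 1)).reverse.map (tauInv q n)).prod

end Characteristic

end RE

end

/-! The map `ch` behaves like a trace on the tower of Hecke algebras: it is cyclic, and it is
multiplicative for the concatenation of $\mathcal H_j(q)$ and $\mathcal H_n(q)$ inside $\mathcal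
H_{n+j}(q)$. These two facts are where $R$, $\Psi$ and the reflection equation enter; the identities
and the spanning statement then follow by computing with elements that satisfy the Hecke relations.
The computation takes place among the matrices $R_k$, so nothing about the structure of the abstract
algebra $\mathcal H_n(q)$ is needed.

Cyclicity (`chLin_mul_comm`): the product $L_{\overline 1}\cdots L_{\overline n}$ commutes with
every $R_k$ (`prodL_commute`), and so does $C\otimes\cdots\otimes C$ (`tensorPow_commute_site2`).
Multiplicativity (`chLin_place_mul`): conjugation of $M\otimes I$ by $R_1\cdots R_n$ (`shift`) sends
$R_k$ to $R_{k+1}$ and $L_{\overline k}$ to $L_{\overline{k+1}}$. By `ptr_conj` it also commutes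
with the partial $C$-trace over the last factor. So a shifted matrix traces down to a scalar
multiple of the identity on the untouched first factors, and the total trace splits into a product.

The Newton identities come from $(k+1)_qA^{(k+1)}=A^{(k)}(q^k-k_q\tau_k)A^{(k)}$. Put beside the
tail $\tau_{n-1}\cdots\tau_{k+1}$ under `ch`, the constant term gives $a_kp_{n-k}$, and in the other
term $\tau_k$ joins the tail (`newton_recursion`). Since $q^k-k_q\tau_k=q^{-k}-k_q\tau_k^{-1}$, the
same argument gives the identity for $t_k$. Replacing $\tau_i$ by $\tau_i^{-1}+(q-q^{-1})$ factor by
factor relates $p_n$ and $t_n$ (`desc_telescope`).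

For the spanning statement, an element of $\mathcal H_{k+1}$ is a combination of elements with at
most one $\tau_k$ (`IsHeckeFamily.genAlg_le`), and cyclicity reduces every `ch` value to products of
power sums (`chLin_mem_adjoin`). The Newton identities are triangular with invertible coefficients,
so the $a$, $p$ and $t$ with index at most $n$ generate the same algebra.

For vanishing, the skew-symmetric algebra acts on tensors by $v\mapsto A^{(n+1)}(v\otimes x_i)$, and
words of degree $n$ applied to the vacuum give the columns of $\rho_R(A^{(n)})$ (`skewRep_word`). If
degree $n$ of the algebra is zero, then $\rho_R(A^{(n)})=0$ and $a_n=0$. -/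

noncomputable section

namespace RE

/-! ### Appending a tensor factor -/

section Append

variable {N n : ℕ}

/-- The multi-index `x` with one more entry `a` at the end. -/
def cat (x : Fin n → Fin N) (a : Fin N) : Fin (n + 1) → Fin N :=
  Fin.snoc (α := fun _ => Fin N) x a

@[simp] theorem cat_castSucc (x : Fin n → Fin N) (a : Fin N) (i : Fin n) :
    cat x a i.castSucc = x i := by simp [cat]

@[simp] theorem cat_last (x : Fin n → Fin N) (a : Fin N) : cat x a (Fin.last n) = a := by
  simp [cat]

theorem cat_comp_castSucc (x : Fin n → Fin N) (a : Fin N) : cat x a ∘ Fin.castSucc = x := by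
  funext i; simp

theorem exists_cat (z : Fin (n + 1) → Fin N) : ∃ x a, z = cat x a :=
  ⟨fun i => z i.castSucc, z (Fin.last n), by
    funext i
    refine Fin.lastCases ?_ (fun i => ?_) i <;> simp⟩

theorem cat_inj {x y : Fin n → Fin N} {a b : Fin N} : cat x a = cat y b ↔ x = y ∧ a = b :=
  Fin.snoc_inj

theorem sum_cat {M : Type*} [AddCommMonoid M] (f : (Fin (n + 1) → Fin N) → M) :
    ∑ z, f z = ∑ x : Fin n → Fin N, ∑ a : Fin N, f (cat x a) := by
  rw [Finset.sum_comm, ← Fintype.sum_prod_type' (f := fun a x => f (cat x a))]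
  exact (Fintype.sum_equiv (Fin.snocEquiv fun _ : Fin (n + 1) => Fin N) _ _ fun _ => rfl).symm

theorem prod_cat {M : Type*} [CommMonoid M] (f : Fin N → Fin N → M) (x y : Fin n → Fin N)
    (a b : Fin N) :
    ∏ i, f (cat x a i) (cat y b i) = (∏ i, f (x i) (y i)) * f a b := by
  rw [Fin.prod_univ_castSucc]; simp

theorem matrix_ext_cat {S : Type*} {M M' : Matrix (Fin (n + 1) → Fin N) (Fin (n + 1) → Fin N) S}
    (h : ∀ x a y b, M (cat x a) (cat y b) = M' (cat x a) (cat y b)) : M = M' := by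
  ext u v
  obtain ⟨x, a, rfl⟩ := exists_cat u
  obtain ⟨y, b, rfl⟩ := exists_cat v
  exact h x a y b

variable {S : Type*} [Semiring S]

/-- `M ⊗ I`, with one more tensor factor. -/
def ext (M : Matrix (Fin n → Fin N) (Fin n → Fin N) S) :
    Matrix (Fin (n + 1) → Fin N) (Fin (n + 1) → Fin N) S :=
  place Fin.castSucc M

theorem ext_cat (M : Matrix (Fin n → Fin N) (Fin n → Fin N) S) (x y : Fin n → Fin N)
    (a b : Fin N) : ext M (cat x a) (cat y b) = if a = b then M x y else 0 := by
  have key : (∀ j : Fin (n + 1), j ∉ Set.range Fin.castSucc → cat x a j = cat y b j) ↔ a = b := by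
    constructor
    · intro h
      simpa using h (Fin.last n) (by rintro ⟨i, hi⟩; exact (Fin.castSucc_lt_last i).ne hi)
    · rintro rfl j hj
      revert hj
      refine Fin.lastCases (by simp) (fun i hi => absurd ⟨i, rfl⟩ hi) j
  by_cases h : a = b
  · rw [if_pos h, ext, place_apply_pos _ _ (key.2 h), cat_comp_castSucc, cat_comp_castSucc]
  · rw [if_neg h, ext, place_apply_neg _ _ (fun h' => h (key.1 h'))]

theorem ext_mul (A B : Matrix (Fin n → Fin N) (Fin n → Fin N) S) :
    ext (A * B) = ext A * ext B :=
  place_mul _ (Fin.castSucc_injective n) A B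

theorem ext_one : ext (1 : Matrix (Fin n → Fin N) (Fin n → Fin N) S) = 1 := place_one _

theorem ext_mul_apply (A : Matrix (Fin n → Fin N) (Fin n → Fin N) S)
    (M : Matrix (Fin (n + 1) → Fin N) (Fin (n + 1) → Fin N) S) (x : Fin n → Fin N) (a : Fin N)
    (z : Fin (n + 1) → Fin N) :
    (ext A * M) (cat x a) z = ∑ w, A x w * M (cat w a) z := by
  simp [Matrix.mul_apply, sum_cat, ext_cat, ite_mul]

theorem mul_ext_apply (A : Matrix (Fin n → Fin N) (Fin n → Fin N) S)
    (M : Matrix (Fin (n + 1) → Fin N) (Fin (n + 1) → Fin N) S) (x : Fin n → Fin N) (a : Fin N)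
    (z : Fin (n + 1) → Fin N) :
    (M * ext A) z (cat x a) = ∑ w, M z (cat w a) * A w x := by
  simp [Matrix.mul_apply, sum_cat, ext_cat, mul_ite]

theorem site2_cat (R : Matrix (Fin N × Fin N) (Fin N × Fin N) S) (x y : Fin n → Fin N)
    (i b p r : Fin N) :
    site2 (n + 2) R n (cat (cat x i) b) (cat (cat y p) r) =
      if x = y then R (i, b) (p, r) else 0 := by
  have h0 : ∀ (x : Fin n → Fin N) (i b : Fin N) (h : n < n + 2), cat (cat x i) b ⟨n, h⟩ = i := by
    intro x i b h
    have : (⟨n, h⟩ : Fin (n + 2)) = (Fin.last n).castSucc := rfl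
    rw [this]; simp
  have h1 : ∀ (x : Fin n → Fin N) (i b : Fin N) (h : n + 1 < n + 2),
      cat (cat x i) b ⟨n + 1, h⟩ = b := by
    intro x i b h
    have : (⟨n + 1, h⟩ : Fin (n + 2)) = Fin.last (n + 1) := rfl
    rw [this]; simp
  have key : (∀ j : Fin (n + 2), j ∉ Set.range (fun i : Fin 2 => (⟨n + i, by omega⟩ : Fin (n + 2)))
      → cat (cat x i) b j = cat (cat y p) r j) ↔ x = y := by
    constructor
    · intro h
      funext j
      have := h j.castSucc.castSucc (by
        rintro ⟨k, hk⟩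
        have := congrArg Fin.val hk
        simp at this
        omega)
      simpa using this
    · rintro rfl j hj
      have hj' : j.val < n := by
        by_contra hlt
        refine hj ⟨⟨j.val - n, by omega⟩, ?_⟩
        ext
        simp
        omega
      obtain ⟨k, rfl⟩ : ∃ k : Fin n, j = k.castSucc.castSucc := ⟨⟨j.val, hj'⟩, rfl⟩
      simp
  rw [site2, dif_pos (by omega)]
  by_cases h : x = y
  · rw [if_pos h, place_apply_pos _ _ (key.2 h)]
    simp [pairMat, h0, h1]
  · rw [if_neg h, place_apply_neg _ _ (fun h' => h (key.1 h'))]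

theorem site2_mul_apply (R : Matrix (Fin N × Fin N) (Fin N × Fin N) S)
    (M : Matrix (Fin (n + 2) → Fin N) (Fin (n + 2) → Fin N) S) (x : Fin n → Fin N) (i b : Fin N)
    (z : Fin (n + 2) → Fin N) :
    (site2 (n + 2) R n * M) (cat (cat x i) b) z =
      ∑ p, ∑ r, R (i, b) (p, r) * M (cat (cat x p) r) z := by
  simp only [Matrix.mul_apply, sum_cat, site2_cat, ite_mul, zero_mul]
  rw [Finset.sum_eq_single x]
  · simp
  · intro y _ hy
    simp [Ne.symm hy]
  · intro h; exact absurd (Finset.mem_univ _) h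

theorem mul_site2_apply (R : Matrix (Fin N × Fin N) (Fin N × Fin N) S)
    (M : Matrix (Fin (n + 2) → Fin N) (Fin (n + 2) → Fin N) S) (x : Fin n → Fin N) (i b : Fin N)
    (z : Fin (n + 2) → Fin N) :
    (M * site2 (n + 2) R n) z (cat (cat x i) b) =
      ∑ p, ∑ r, M z (cat (cat x p) r) * R (p, r) (i, b) := by
  simp only [Matrix.mul_apply, sum_cat, site2_cat, mul_ite, mul_zero]
  rw [Finset.sum_eq_single x]
  · simp
  · intro y _ hy
    simp [hy]
  · intro h; exact absurd (Finset.mem_univ _) h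

theorem ext_site2 (R : Matrix (Fin N × Fin N) (Fin N × Fin N) S) {k : ℕ} (h : k + 1 < n) :
    ext (site2 n R k) = site2 (n + 1) R k := by
  rw [ext, site2, site2, dif_pos h, dif_pos (by omega), place_place _ (Fin.castSucc_injective n)]
  rfl

theorem ext_site1 (M : Matrix (Fin N) (Fin N) S) (h : 0 < n) :
    ext (site1 n M) = site1 (n + 1) M := by
  rw [ext, site1, site1, dif_pos h, dif_pos (by omega), place_place _ (Fin.castSucc_injective n)]
  rfl

end Append

/-! ### Change of scalars and commutation -/

section Scalars

variable {S S' : Type*} [Semiring S] [Semiring S'] {N n r s : ℕ}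

theorem place_map (φ : S →+* S') (f : Fin r → Fin n)
    (A : Matrix (Fin r → Fin N) (Fin r → Fin N) S) :
    (place f A).map φ = place f (A.map φ) := by
  ext x y
  by_cases h : ∀ j, j ∉ Set.range f → x j = y j
  · simp [place_apply_pos f _ h]
  · simp [place_apply_neg f _ h]

theorem one_map (φ : S →+* S') {ι : Type*} [DecidableEq ι] :
    (1 : Matrix ι ι S).map φ = 1 := Matrix.map_one φ (map_zero φ) (map_one φ)

theorem site2_map (φ : S →+* S') (R : Matrix (Fin N × Fin N) (Fin N × Fin N) S) (k : ℕ) :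
    (site2 n R k).map φ = site2 n (R.map φ) k := by
  by_cases h : k + 1 < n
  · simp only [site2, dif_pos h, place_map]; rfl
  · simp only [site2, dif_neg h, one_map]

theorem ext_map (φ : S →+* S') (A : Matrix (Fin n → Fin N) (Fin n → Fin N) S) :
    (ext A).map φ = ext (A.map φ) := place_map φ _ A

/-- Matrices acting in disjoint sets of tensor factors commute if their entries do. -/
theorem place_commute (f : Fin r → Fin n) (g : Fin s → Fin n) (hfg : ∀ i j, f i ≠ g j)
    (A : Matrix (Fin r → Fin N) (Fin r → Fin N) S) (B : Matrix (Fin s → Fin N) (Fin s → Fin N) S)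
    (hAB : ∀ a b c d, A a b * B c d = B c d * A a b) :
    Commute (place f A) (place g B) := by
  classical
  have key : ∀ {r s : ℕ} (f : Fin r → Fin n) (g : Fin s → Fin n) (_ : ∀ i j, f i ≠ g j)
      (A : Matrix (Fin r → Fin N) (Fin r → Fin N) S)
      (B : Matrix (Fin s → Fin N) (Fin s → Fin N) S) (x y : Fin n → Fin N),
      (place f A * place g B) x y =
        if ∀ j, j ∉ Set.range f → j ∉ Set.range g → x j = y j then
          A (x ∘ f) (y ∘ f) * B (x ∘ g) (y ∘ g) else 0 := by
    intro r s f g hfg A B x y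
    rw [Matrix.mul_apply]
    let z : Fin n → Fin N := fun j => if j ∈ Set.range f then y j else x j
    have zf : z ∘ f = y ∘ f := by
      funext i; simp [z]
    have zg : z ∘ g = x ∘ g := by
      funext i
      have : g i ∉ Set.range f := fun ⟨k, hk⟩ => hfg k i hk
      simp only [z, Function.comp_apply, if_neg this]
    have hxz : ∀ j, j ∉ Set.range f → x j = z j := fun j hj => by simp only [z, if_neg hj]
    rw [Finset.sum_eq_single z]
    · rw [place_apply_pos f A hxz, zf]
      by_cases h : ∀ j, j ∉ Set.range f → j ∉ Set.range g → x j = y j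
      · rw [if_pos h, place_apply_pos g B, zg]
        intro j hj
        by_cases hjf : j ∈ Set.range f
        · simp only [z, if_pos hjf]
        · rw [← hxz j hjf]; exact h j hjf hj
      · rw [if_neg h, place_apply_neg g B, mul_zero]
        intro h2
        exact h fun j hjf hjg => (hxz j hjf).trans (h2 j hjg)
    · intro w _ hw
      by_cases h1 : ∀ j, j ∉ Set.range f → x j = w j
      · rw [place_apply_neg g B, mul_zero]
        intro h2
        refine hw (funext fun j => ?_)
        by_cases hjf : j ∈ Set.range f
        · simp only [z, if_pos hjf]
          exact h2 j fun ⟨k, hk⟩ => by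
            obtain ⟨i, hi⟩ := hjf
            exact hfg i k (hi.trans hk.symm)
        · rw [← h1 j hjf, hxz j hjf]
      · rw [place_apply_neg f A h1, zero_mul]
    · intro h; exact absurd (Finset.mem_univ _) h
  change place f A * place g B = place g B * place f A
  ext x y
  rw [key f g hfg, key g f fun i j => (hfg j i).symm]
  exact if_congr ⟨fun h j a b => h j b a, fun h j a b => h j b a⟩ (hAB _ _ _ _) rfl

theorem site1_commute_site2 {U : Type*} [Ring U] [Algebra ℂ U] (M : Matrix (Fin N) (Fin N) U)
    (R : Matrix (Fin N × Fin N) (Fin N × Fin N) ℂ) (n k : ℕ) :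
    Commute (site1 n M) (site2 n (R.map (algebraMap ℂ U)) (k + 1)) := by
  by_cases hk : k + 1 + 1 < n
  · simp only [site1, site2, dif_pos hk, dif_pos (show 0 < n by omega)]
    refine place_commute _ _ (fun i j e => ?_) _ _ fun a b c d => ?_
    · simp only [Fin.mk.injEq] at e
      omega
    · exact (Algebra.commutes _ _).symm
  · simp only [site2, dif_neg hk]
    exact Commute.one_right _

end Scalars

/-! ### Partial traces -/

section PartialTrace

variable {N n : ℕ} {U : Type*} [Ring U] [Algebra ℂ U]

theorem sum_rotate {ι κ μ M : Type*} [Fintype ι] [Fintype κ] [Fintype μ] [AddCommMonoid M]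
    (f : ι → κ → μ → M) : ∑ a, ∑ b, ∑ c, f a b c = ∑ c, ∑ a, ∑ b, f a b c := by
  rw [Finset.sum_congr rfl fun a _ => Finset.sum_comm, Finset.sum_comm]

theorem sum_comm_three_two {ι κ μ ν ξ M : Type*} [Fintype ι] [Fintype κ] [Fintype μ] [Fintype ν]
    [Fintype ξ] [AddCommMonoid M] (f : ι → κ → μ → ν → ξ → M) :
    ∑ a, ∑ b, ∑ c, ∑ x, ∑ y, f a b c x y = ∑ x, ∑ y, ∑ a, ∑ b, ∑ c, f a b c x y := by
  rw [Finset.sum_congr rfl fun a _ => Finset.sum_congr rfl fun b _ => (sum_rotate _).symm,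
    Finset.sum_congr rfl fun a _ => (sum_rotate _).symm, ← sum_rotate]

/-- The partial trace `Tr (C M)` over the last tensor factor. -/
def ptr (C : Matrix (Fin N) (Fin N) ℂ) (M : Matrix (Fin (n + 1) → Fin N) (Fin (n + 1) → Fin N) U) :
    Matrix (Fin n → Fin N) (Fin n → Fin N) U :=
  Matrix.of fun x y => ∑ a, ∑ b, C a b • M (cat x b) (cat y a)

theorem ptr_apply (C : Matrix (Fin N) (Fin N) ℂ)
    (M : Matrix (Fin (n + 1) → Fin N) (Fin (n + 1) → Fin N) U) (x y : Fin n → Fin N) :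
    ptr C M x y = ∑ a, ∑ b, C a b • M (cat x b) (cat y a) := rfl

theorem rTrace_eq_sum (C : Matrix (Fin N) (Fin N) ℂ)
    (M : Matrix (Fin n → Fin N) (Fin n → Fin N) U) :
    rTrace C n M = ∑ x, ∑ y, (∏ i, C (x i) (y i)) • M y x := by
  simp only [rTrace, Matrix.trace, Matrix.diag, Matrix.mul_apply, Algebra.smul_def, Matrix.of_apply]

theorem rTrace_succ (C : Matrix (Fin N) (Fin N) ℂ)
    (M : Matrix (Fin (n + 1) → Fin N) (Fin (n + 1) → Fin N) U) :
    rTrace C (n + 1) M = rTrace C n (ptr C M) := by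
  have h := prod_cat (n := n) (fun a b => C a b)
  simp only [rTrace_eq_sum, sum_cat, ptr_apply, h, Finset.smul_sum, smul_smul]
  refine Finset.sum_congr rfl fun x _ => ?_
  rw [Finset.sum_comm]

theorem eq_rTrace_smul_one (C : Matrix (Fin N) (Fin N) ℂ)
    (M : Matrix (Fin 0 → Fin N) (Fin 0 → Fin N) U) : M = rTrace C 0 M • 1 := by
  ext x y
  rw [rTrace_eq_sum, Subsingleton.elim y x]
  simp [Subsingleton.elim _ x]

theorem ptr_ext_mul (C : Matrix (Fin N) (Fin N) ℂ)
    (A : Matrix (Fin n → Fin N) (Fin n → Fin N) U)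
    (M : Matrix (Fin (n + 1) → Fin N) (Fin (n + 1) → Fin N) U) :
    ptr C (ext A * M) = A * ptr C M := by
  ext x y
  rw [Matrix.mul_apply]
  simp only [ptr_apply, ext_mul_apply, Finset.smul_sum, Finset.mul_sum, mul_smul_comm]
  exact sum_rotate _

theorem ptr_mul_ext (C : Matrix (Fin N) (Fin N) ℂ)
    (A : Matrix (Fin n → Fin N) (Fin n → Fin N) U)
    (M : Matrix (Fin (n + 1) → Fin N) (Fin (n + 1) → Fin N) U) :
    ptr C (M * ext A) = ptr C M * A := by
  ext x y
  rw [Matrix.mul_apply]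
  simp only [ptr_apply, mul_ext_apply, Finset.smul_sum, Finset.sum_mul, smul_mul_assoc]
  exact sum_rotate _

/-- The sum over the last factor in `Tr (C₃ A₂₃ Y₂ B₂₃)`. -/
def sandwich (C : Matrix (Fin N) (Fin N) ℂ) (A B : Matrix (Fin N × Fin N) (Fin N × Fin N) ℂ)
    (i j p p' : Fin N) : ℂ :=
  ∑ a, ∑ b, ∑ c, C a b * A (i, b) (p, c) * B (p', c) (j, a)

/-- The entries of `A` and `B` are scalars, so they pass the entries of `Y` and the sum over the
last factor collects into a complex kernel. Partial trace identities for algebra-valued `Y` thereby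
reduce to identities of complex numbers. -/
theorem ptr_sandwich (C : Matrix (Fin N) (Fin N) ℂ)
    (A B : Matrix (Fin N × Fin N) (Fin N × Fin N) ℂ)
    (Y : Matrix (Fin (n + 1) → Fin N) (Fin (n + 1) → Fin N) U) (x y : Fin n → Fin N)
    (i j : Fin N) :
    ptr C (site2 (n + 2) (A.map (algebraMap ℂ U)) n * ext Y *
      site2 (n + 2) (B.map (algebraMap ℂ U)) n) (cat x i) (cat y j) =
      ∑ p, ∑ p', sandwich C A B i j p p' • Y (cat x p) (cat y p') := by
  have e : ∀ a b : Fin N, (site2 (n + 2) (A.map (algebraMap ℂ U)) n * ext Y *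
      site2 (n + 2) (B.map (algebraMap ℂ U)) n) (cat (cat x i) b) (cat (cat y j) a) =
      ∑ p, ∑ p', ∑ c, (A (i, b) (p, c) * B (p', c) (j, a)) • Y (cat x p) (cat y p') := by
    intro a b
    rw [mul_site2_apply]
    simp only [site2_mul_apply, ext_cat, mul_ite, mul_zero, Finset.sum_ite_eq',
      Finset.mem_univ, if_true, Matrix.map_apply, Finset.sum_mul]
    rw [sum_rotate]
    refine Finset.sum_congr rfl fun p _ => Finset.sum_congr rfl fun p' _ =>
      Finset.sum_congr rfl fun c _ => ?_
    rw [← Algebra.commutes, ← mul_assoc, ← map_mul, ← Algebra.smul_def, mul_comm]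
  simp only [ptr_apply, e, Finset.smul_sum, sandwich, Finset.sum_smul, smul_smul, ← mul_assoc]
  rw [Finset.sum_congr rfl fun a _ => (sum_rotate _).symm, ← sum_rotate]

end PartialTrace

/-! ### The matrix `C` -/

section CMatrix

variable {N n : ℕ} {q : ℂ} {R Ψ : Matrix (Fin N × Fin N) (Fin N × Fin N) ℂ}

theorem mul_inv_heckeSymmetry (hR : IsHeckeSymmetry q R) : R * R⁻¹ = 1 := by
  have h := mul_sub_eq_one_of_hecke hR.ne_zero R hR.hecke
  rwa [Matrix.inv_eq_right_inv h]

theorem inv_mul_heckeSymmetry (hR : IsHeckeSymmetry q R) : R⁻¹ * R = 1 :=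
  mul_eq_one_comm.1 (mul_inv_heckeSymmetry hR)

theorem site2_mul {S : Type*} [Semiring S] (A B : Matrix (Fin N × Fin N) (Fin N × Fin N) S)
    {k : ℕ} (h : k + 1 < n) : site2 n (A * B) k = site2 n A k * site2 n B k := by
  have hf : Function.Injective (fun i : Fin 2 => (⟨k + i, by omega⟩ : Fin n)) := by
    intro i j e
    simp only [Fin.mk.injEq] at e
    exact Fin.ext (by omega)
  have hp : pairMat (A * B) = pairMat A * pairMat B := by
    ext u v
    simp only [pairMat, Matrix.of_apply, Matrix.mul_apply]
    exact (Fintype.sum_equiv (finTwoArrowEquiv (Fin N)) _ _ fun w => rfl).symm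
  simp only [site2, dif_pos h]
  rw [hp, place_mul _ hf]

theorem site2_one {S : Type*} [Semiring S] (n k : ℕ) :
    site2 n (1 : Matrix (Fin N × Fin N) (Fin N × Fin N) S) k = 1 := by
  have hp : pairMat (1 : Matrix (Fin N × Fin N) (Fin N × Fin N) S) = 1 := by
    ext u v
    simp only [pairMat, Matrix.of_apply, Matrix.one_apply]
    refine if_congr ?_ rfl rfl
    rw [Prod.mk.injEq, funext_iff, Fin.forall_fin_two]
  by_cases h : k + 1 < n
  · rw [site2, dif_pos h, hp, place_one]
  · rw [site2, dif_neg h]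

theorem site2_mul_inv (hR : IsHeckeSymmetry q R) (n k : ℕ) :
    site2 n R k * site2 n R⁻¹ k = 1 := by
  by_cases h : k + 1 < n
  · rw [← site2_mul _ _ h, mul_inv_heckeSymmetry hR, site2_one]
  · simp [site2, h]

theorem site2_inv_mul (hR : IsHeckeSymmetry q R) (n k : ℕ) :
    site2 n R⁻¹ k * site2 n R k = 1 :=
  mul_eq_one_comm.1 (site2_mul_inv hR n k)

/-- `Tr₍₂₎ (C₂ R₁₂) = I`. -/
theorem ptr_site2 (hΨ : IsSkewInverse R Ψ) (n : ℕ) :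
    ptr (cMat Ψ) (site2 (n + 2) R n) = 1 := by
  refine matrix_ext_cat fun x i y j => ?_
  simp only [ptr_apply, site2_cat, Matrix.one_apply, cat_inj]
  by_cases hxy : x = y
  · have h : ∀ e, midTrace R Ψ (i, e) (j, e) = flip N (i, e) (j, e) := fun e => by rw [hΨ.left]
    have h' := Finset.sum_congr (rfl : (Finset.univ : Finset (Fin N)) = _) fun e _ => h e
    simp only [midTrace, flip, Matrix.of_apply] at h'
    simp only [hxy, true_and, if_true, cMat, Matrix.of_apply, smul_eq_mul, Finset.sum_mul]
    have e1 : (∑ e : Fin N, if i = e ∧ e = j then (1 : ℂ) else 0) = if i = j then 1 else 0 := by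
      by_cases hij : i = j
      · subst hij
        rw [if_pos rfl, Finset.sum_eq_single i]
        · simp
        · intro b _ hb; rw [if_neg]; exact fun h => hb h.2
        · simp
      · rw [if_neg hij]
        exact Finset.sum_eq_zero fun e _ => if_neg fun h => hij (h.1.trans h.2)
    rw [e1] at h'
    rw [← h', sum_rotate]
    refine Finset.sum_congr rfl fun e _ => ?_
    rw [Finset.sum_comm]
    exact Finset.sum_congr rfl fun b _ => Finset.sum_congr rfl fun c _ => mul_comm _ _
  · simp [hxy]

/-- It is enough to know the partial trace for the single matrix $Y=R$: contracting with $\Psi$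
undoes the contraction with $R$ and so isolates each entry of the kernel. -/
theorem sandwich_eq_of_ptr (hΨ : IsSkewInverse R Ψ)
    (A B : Matrix (Fin N × Fin N) (Fin N × Fin N) ℂ)
    (h : ptr (cMat Ψ) (site2 3 A 1 * ext (site2 2 R 0) * site2 3 B 1) = 1) (i j x y : Fin N) :
    sandwich (cMat Ψ) A B i j x y = if i = j then cMat Ψ y x else 0 := by
  have h1 : ∀ b c : Fin N, ∑ p, ∑ p', sandwich (cMat Ψ) A B i j p p' * R (c, p) (b, p') =
      if c = b ∧ i = j then 1 else 0 := by
    intro b c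
    let z : Fin 0 → Fin N := Fin.elim0
    have h2 := congrFun (congrFun h (cat (cat z c) i)) (cat (cat z b) j)
    have h3 := ptr_sandwich (U := ℂ) (cMat Ψ) A B (site2 2 R 0) (cat z c) (cat z b) i j
    have h4 : ∀ M : Matrix (Fin N × Fin N) (Fin N × Fin N) ℂ, M.map (algebraMap ℂ ℂ) = M :=
      fun M => rfl
    rw [h4, h4] at h3
    rw [h3] at h2
    simp only [Matrix.one_apply, cat_inj, true_and] at h2
    rw [← h2]
    refine Finset.sum_congr rfl fun p _ => Finset.sum_congr rfl fun p' _ => ?_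
    have := site2_cat (n := 0) R z z c p b p'
    rw [if_pos rfl] at this
    rw [← this, smul_eq_mul]
  have h5 : ∀ p p', ∑ b, ∑ c, Ψ (y, b) (x, c) * R (c, p) (b, p') =
      if y = p' ∧ p = x then 1 else 0 := fun p p' => by
    have := congrFun (congrFun hΨ.right (y, p)) (x, p')
    simpa [midTrace, flip] using this
  calc sandwich (cMat Ψ) A B i j x y
      = ∑ p, ∑ p', sandwich (cMat Ψ) A B i j p p' *
          ∑ b, ∑ c, Ψ (y, b) (x, c) * R (c, p) (b, p') := by
        simp only [h5]
        rw [Finset.sum_eq_single x, Finset.sum_eq_single y]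
        · simp
        · intro b _ hb; simp [Ne.symm hb]
        · simp
        · intro b _ hb; simp [hb]
        · simp
    _ = ∑ b, ∑ c, Ψ (y, b) (x, c) *
          ∑ p, ∑ p', sandwich (cMat Ψ) A B i j p p' * R (c, p) (b, p') := by
        simp only [Finset.mul_sum]
        rw [Finset.sum_congr rfl fun a _ => (sum_rotate _).symm, ← sum_rotate]
        refine Finset.sum_congr rfl fun _ _ => Finset.sum_congr rfl fun _ _ =>
          Finset.sum_congr rfl fun _ _ => Finset.sum_congr rfl fun _ _ => ?_
        ring
    _ = _ := by
        simp only [h1]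
        by_cases hij : i = j <;> simp [hij, cMat]

theorem braid_conj (hR : IsHeckeSymmetry q R) :
    site2 3 R 1 * site2 3 R 0 * site2 3 R⁻¹ 1 = site2 3 R⁻¹ 0 * site2 3 R 1 * site2 3 R 0 := by
  have h := hR.braid
  calc site2 3 R 1 * site2 3 R 0 * site2 3 R⁻¹ 1
      = (site2 3 R⁻¹ 0 * site2 3 R 0) * (site2 3 R 1 * site2 3 R 0 * site2 3 R⁻¹ 1) := by
        rw [site2_inv_mul hR, one_mul]
    _ = site2 3 R⁻¹ 0 * (site2 3 R 0 * site2 3 R 1 * site2 3 R 0) * site2 3 R⁻¹ 1 := by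
        simp only [mul_assoc]
    _ = site2 3 R⁻¹ 0 * site2 3 R 1 * site2 3 R 0 * (site2 3 R 1 * site2 3 R⁻¹ 1) := by
        rw [h]; simp only [mul_assoc]
    _ = _ := by rw [site2_mul_inv hR, mul_one]

theorem braid_conj_inv (hR : IsHeckeSymmetry q R) :
    site2 3 R⁻¹ 1 * site2 3 R 0 * site2 3 R 1 = site2 3 R 0 * site2 3 R 1 * site2 3 R⁻¹ 0 := by
  have h := hR.braid
  calc site2 3 R⁻¹ 1 * site2 3 R 0 * site2 3 R 1
      = site2 3 R⁻¹ 1 * site2 3 R 0 * site2 3 R 1 * (site2 3 R 0 * site2 3 R⁻¹ 0) := by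
        rw [site2_mul_inv hR, mul_one]
    _ = site2 3 R⁻¹ 1 * (site2 3 R 0 * site2 3 R 1 * site2 3 R 0) * site2 3 R⁻¹ 0 := by
        simp only [mul_assoc]
    _ = (site2 3 R⁻¹ 1 * site2 3 R 1) * (site2 3 R 0 * site2 3 R 1 * site2 3 R⁻¹ 0) := by
        rw [h]; simp only [mul_assoc]
    _ = _ := by rw [site2_inv_mul hR, one_mul]

/-- By the braid relation $R_{23}R_{12}R_{23}^{-1}=R_{12}^{-1}R_{23}R_{12}$. The outer factors leave
$\mathrm{Tr}_{(3)}$, and $\mathrm{Tr}_{(3)}(C_3R_{23})=I$ leaves $R_{12}^{-1}R_{12}=I$. -/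
theorem sandwich_inv (hR : IsHeckeSymmetry q R) (hΨ : IsSkewInverse R Ψ) (i j x y : Fin N) :
    sandwich (cMat Ψ) R R⁻¹ i j x y = if i = j then cMat Ψ y x else 0 := by
  refine sandwich_eq_of_ptr hΨ _ _ ?_ i j x y
  rw [ext_site2 _ (by omega), braid_conj hR, ← ext_site2 R⁻¹ (show 0 + 1 < 2 by omega),
    ← ext_site2 R (show 0 + 1 < 2 by omega), ptr_mul_ext, ptr_ext_mul, ptr_site2 hΨ 1, mul_one,
    site2_inv_mul hR]

theorem inv_sandwich (hR : IsHeckeSymmetry q R) (hΨ : IsSkewInverse R Ψ) (i j x y : Fin N) :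
    sandwich (cMat Ψ) R⁻¹ R i j x y = if i = j then cMat Ψ y x else 0 := by
  refine sandwich_eq_of_ptr hΨ _ _ ?_ i j x y
  rw [ext_site2 _ (by omega), braid_conj_inv hR, ← ext_site2 R⁻¹ (show 0 + 1 < 2 by omega),
    ← ext_site2 R (show 0 + 1 < 2 by omega), ptr_mul_ext, ptr_ext_mul, ptr_site2 hΨ 1, mul_one,
    site2_mul_inv hR]

/-- `Tr₍ₙ₊₁₎ (C R_n (Y ⊗ I) R_n⁻¹) = Tr₍ₙ₎ (C Y) ⊗ I`. -/
theorem ptr_conj {U : Type*} [Ring U] [Algebra ℂ U] (hR : IsHeckeSymmetry q R)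
    (hΨ : IsSkewInverse R Ψ) (Y : Matrix (Fin (n + 1) → Fin N) (Fin (n + 1) → Fin N) U) :
    ptr (cMat Ψ) (site2 (n + 2) (R.map (algebraMap ℂ U)) n * ext Y *
      site2 (n + 2) (R⁻¹.map (algebraMap ℂ U)) n) = ext (ptr (cMat Ψ) Y) := by
  refine matrix_ext_cat fun x i y j => ?_
  rw [ptr_sandwich, ext_cat, ptr_apply, Finset.sum_comm]
  simp only [sandwich_inv hR hΨ]
  by_cases hij : i = j <;> simp [hij]

/-- Contracting the kernel of `sandwich_inv` with $\Psi$ removes its factor $R$. This and the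
companion `cMat_mul_inv` rewrite both products of $R^{-1}$ with $C\otimes C$ as one expression
$C\,\Psi\,C$, which proves that they are equal. -/
theorem inv_mul_cMat (hR : IsHeckeSymmetry q R) (hΨ : IsSkewInverse R Ψ) (y s j t : Fin N) :
    ∑ a, R⁻¹ (y, s) (j, a) * cMat Ψ a t = ∑ x, cMat Ψ y x * Ψ (s, x) (t, j) := by
  have h5 : ∀ b c, ∑ x, ∑ i, Ψ (s, x) (t, i) * R (i, b) (x, c) =
      if s = c ∧ b = t then 1 else 0 := fun b c => by
    have := congrFun (congrFun hΨ.right (s, b)) (t, c)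
    simpa [midTrace, flip] using this
  calc ∑ a, R⁻¹ (y, s) (j, a) * cMat Ψ a t
      = ∑ a, ∑ b, ∑ c, cMat Ψ a b * R⁻¹ (y, c) (j, a) *
          ∑ x, ∑ i, Ψ (s, x) (t, i) * R (i, b) (x, c) := by
        simp only [h5]
        refine Finset.sum_congr rfl fun a _ => ?_
        rw [Finset.sum_eq_single t, Finset.sum_eq_single s]
        · simp [mul_comm]
        · intro b _ hb; simp [Ne.symm hb]
        · simp
        · intro b _ hb; simp [hb]
        · simp
    _ = ∑ x, ∑ i, Ψ (s, x) (t, i) * sandwich (cMat Ψ) R R⁻¹ i j x y := by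
        simp only [Finset.mul_sum, sandwich]
        rw [sum_comm_three_two]
        refine Finset.sum_congr rfl fun _ _ => Finset.sum_congr rfl fun _ _ =>
          Finset.sum_congr rfl fun _ _ => Finset.sum_congr rfl fun _ _ =>
          Finset.sum_congr rfl fun _ _ => ?_
        ring
    _ = _ := by
        simp only [sandwich_inv hR hΨ]
        simp [mul_comm]

theorem cMat_mul_inv (hR : IsHeckeSymmetry q R) (hΨ : IsSkewInverse R Ψ) (i s x t : Fin N) :
    ∑ b, cMat Ψ s b * R⁻¹ (i, b) (x, t) = ∑ y, Ψ (s, i) (t, y) * cMat Ψ y x := by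
  have h5 : ∀ a c, ∑ j, ∑ y, Ψ (s, j) (t, y) * R (y, c) (j, a) =
      if s = a ∧ c = t then 1 else 0 := fun a c => by
    have := congrFun (congrFun hΨ.right (s, c)) (t, a)
    simpa [midTrace, flip] using this
  calc ∑ b, cMat Ψ s b * R⁻¹ (i, b) (x, t)
      = ∑ a, ∑ b, ∑ c, cMat Ψ a b * R⁻¹ (i, b) (x, c) *
          ∑ j, ∑ y, Ψ (s, j) (t, y) * R (y, c) (j, a) := by
        simp only [h5]
        symm
        rw [Finset.sum_eq_single s]
        · refine Finset.sum_congr rfl fun b _ => ?_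
          rw [Finset.sum_eq_single t]
          · simp
          · intro b _ hb; simp [hb]
          · simp
        · intro b _ hb; simp [Ne.symm hb]
        · simp
    _ = ∑ j, ∑ y, Ψ (s, j) (t, y) * sandwich (cMat Ψ) R⁻¹ R i j x y := by
        simp only [Finset.mul_sum, sandwich]
        rw [sum_comm_three_two]
        refine Finset.sum_congr rfl fun _ _ => Finset.sum_congr rfl fun _ _ =>
          Finset.sum_congr rfl fun _ _ => Finset.sum_congr rfl fun _ _ =>
          Finset.sum_congr rfl fun _ _ => ?_
        ring
    _ = _ := by
        simp only [inv_sandwich hR hΨ]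
        rw [Finset.sum_eq_single i]
        · simp
        · intro j _ hj; simp [Ne.symm hj]
        · simp

/-- `C ⊗ C` commutes with `R`. -/
theorem kronecker_cMat_commute (hR : IsHeckeSymmetry q R) (hΨ : IsSkewInverse R Ψ) :
    Commute (cMat Ψ ⊗ₖ cMat Ψ) R := by
  have h : Commute (cMat Ψ ⊗ₖ cMat Ψ) R⁻¹ := by
    change _ * _ = _ * _
    ext ⟨i, s⟩ ⟨x, t⟩
    simp only [Matrix.mul_apply, Matrix.kroneckerMap_apply, Fintype.sum_prod_type]
    calc ∑ j, ∑ b, cMat Ψ i j * cMat Ψ s b * R⁻¹ (j, b) (x, t)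
        = ∑ j, cMat Ψ i j * ∑ b, cMat Ψ s b * R⁻¹ (j, b) (x, t) := by
          simp only [Finset.mul_sum, mul_assoc]
      _ = ∑ y, (∑ j, cMat Ψ i j * Ψ (s, j) (t, y)) * cMat Ψ y x := by
          simp only [cMat_mul_inv hR hΨ, Finset.mul_sum, Finset.sum_mul, mul_assoc]
          exact Finset.sum_comm
      _ = _ := by
          simp only [← inv_mul_cMat hR hΨ, Finset.sum_mul]
          refine Finset.sum_congr rfl fun _ _ => Finset.sum_congr rfl fun _ _ => ?_
          ring
  calc cMat Ψ ⊗ₖ cMat Ψ * R = R * (R⁻¹ * (cMat Ψ ⊗ₖ cMat Ψ)) * R := by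
        rw [← mul_assoc, mul_inv_heckeSymmetry hR, one_mul]
    _ = R * (cMat Ψ ⊗ₖ cMat Ψ) * (R⁻¹ * R) := by rw [← h.eq]; simp only [mul_assoc]
    _ = _ := by rw [inv_mul_heckeSymmetry hR, mul_one]

/-! ### Tensor powers of $C$ and cyclicity of the $R$-trace. -/

/-- The tensor power `C₁ C₂ ⋯ C_n`. -/
def tensorPow (C : Matrix (Fin N) (Fin N) ℂ) (n : ℕ) : Matrix (Fin n → Fin N) (Fin n → Fin N) ℂ :=
  Matrix.of fun x y => ∏ i, C (x i) (y i)

theorem tensorPow_cat (C : Matrix (Fin N) (Fin N) ℂ) (x y : Fin n → Fin N) (a b : Fin N) :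
    tensorPow C (n + 1) (cat x a) (cat y b) = tensorPow C n x y * C a b :=
  prod_cat (fun a b => C a b) x y a b

theorem tensorPow_commute_ext (C : Matrix (Fin N) (Fin N) ℂ)
    {Z : Matrix (Fin n → Fin N) (Fin n → Fin N) ℂ} (h : Commute (tensorPow C n) Z) :
    Commute (tensorPow C (n + 1)) (ext Z) := by
  refine matrix_ext_cat fun x a y b => ?_
  rw [ext_mul_apply, mul_ext_apply]
  have h' := congrFun (congrFun h.eq x) y
  simp only [Matrix.mul_apply] at h'
  simp only [tensorPow_cat, ← mul_assoc, ← Finset.sum_mul, ← h']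
  simp only [Finset.sum_mul]
  exact Finset.sum_congr rfl fun _ _ => by ring

theorem tensorPow_commute_site2 (hR : IsHeckeSymmetry q R) (hΨ : IsSkewInverse R Ψ) (n k : ℕ) :
    Commute (tensorPow (cMat Ψ) n) (site2 n R k) := by
  induction n with
  | zero => simp [site2]
  | succ n ih =>
    rcases lt_trichotomy (k + 1) n with h | h | h
    · rw [← ext_site2 R h]
      exact tensorPow_commute_ext _ ih
    · subst h
      refine matrix_ext_cat fun u b v r => ?_
      obtain ⟨x, i, rfl⟩ := exists_cat u
      obtain ⟨y, p, rfl⟩ := exists_cat v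
      rw [mul_site2_apply, site2_mul_apply]
      have h' := congrFun (congrFun (kronecker_cMat_commute hR hΨ).eq (i, b)) (p, r)
      simp only [Matrix.mul_apply, Matrix.kroneckerMap_apply, Fintype.sum_prod_type] at h'
      simp only [tensorPow_cat]
      calc _ = tensorPow (cMat Ψ) k x y *
            ∑ j, ∑ c, cMat Ψ i j * cMat Ψ b c * R (j, c) (p, r) := by
            simp only [Finset.mul_sum, mul_assoc]
        _ = _ := by
            rw [h']
            simp only [Finset.mul_sum]
            exact Finset.sum_congr rfl fun _ _ => Finset.sum_congr rfl fun _ _ => by ring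
    · rw [site2, dif_neg (by omega)]
      exact Commute.one_right _

/-- The multiple `R`-trace is cyclic for matrices that commute with `C₁ C₂ ⋯ C_n`. -/
theorem rTrace_mul_comm {U : Type*} [Ring U] [Algebra ℂ U] (C : Matrix (Fin N) (Fin N) ℂ)
    {Z : Matrix (Fin n → Fin N) (Fin n → Fin N) ℂ} (h : Commute (tensorPow C n) Z)
    (M : Matrix (Fin n → Fin N) (Fin n → Fin N) U) :
    rTrace C n (Z.map (algebraMap ℂ U) * M) = rTrace C n (M * Z.map (algebraMap ℂ U)) := by
  change ((tensorPow C n).map (algebraMap ℂ U) * _).trace =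
    ((tensorPow C n).map (algebraMap ℂ U) * _).trace
  rw [← mul_assoc, ← mul_assoc, ← Matrix.map_mul, h.eq, Matrix.map_mul, mul_assoc]
  generalize (tensorPow C n).map (algebraMap ℂ U) * M = M'
  -- `U` need not be commutative; the trace is cyclic here because one of the two factors has scalar
  -- entries.
  simp only [Matrix.trace, Matrix.diag, Matrix.mul_apply]
  rw [Finset.sum_comm]
  exact Finset.sum_congr rfl fun _ _ => Finset.sum_congr rfl fun _ _ => Algebra.commutes _ _

end CMatrix

/-! ### Shifting tensor factors -/

section Shift

variable {N n : ℕ} {q : ℂ} {R Ψ : Matrix (Fin N × Fin N) (Fin N × Fin N) ℂ}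
  {U : Type*} [Ring U] [Algebra ℂ U]

/-- A complex matrix with its entries regarded as elements of the algebra `U`. -/
def up (U : Type*) [Ring U] [Algebra ℂ U] {ι : Type*} (Z : Matrix ι ι ℂ) : Matrix ι ι U :=
  Z.map (algebraMap ℂ U)

section Up

variable {ι : Type*}

theorem up_mul [Fintype ι] (A B : Matrix ι ι ℂ) : up U (A * B) = up U A * up U B := Matrix.map_mul

theorem up_one [DecidableEq ι] : up U (1 : Matrix ι ι ℂ) = 1 := one_map _

theorem up_add (A B : Matrix ι ι ℂ) : up U (A + B) = up U A + up U B :=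
  Matrix.map_add _ (map_add _) A B

theorem up_smul (c : ℂ) (A : Matrix ι ι ℂ) : up U (c • A) = c • up U A := by
  ext i j
  simp [up, Algebra.smul_def]

theorem up_commute [Fintype ι] {A B : Matrix ι ι ℂ} (h : Commute A B) :
    Commute (up U A) (up U B) := by
  change _ = _
  rw [← up_mul, ← up_mul, h.eq]

theorem up_commute_smul_one [Fintype ι] [DecidableEq ι] (A : Matrix ι ι ℂ) (s : U) :
    Commute (up U A) (s • 1) := by
  change _ = _
  ext i j
  simp only [up, Matrix.mul_apply, Matrix.map_apply, Matrix.smul_apply, Matrix.one_apply,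
    smul_eq_mul, mul_ite, mul_one, mul_zero, ite_mul, zero_mul, Finset.sum_ite_eq,
    Finset.sum_ite_eq', Finset.mem_univ, if_true]
  exact Algebra.commutes _ _

end Up

theorem up_site2 (A : Matrix (Fin N × Fin N) (Fin N × Fin N) ℂ) (n k : ℕ) :
    up U (site2 n A k) = site2 n (up U A) k := site2_map _ A k

theorem up_ext (A : Matrix (Fin n → Fin N) (Fin n → Fin N) ℂ) : up U (ext A) = ext (up U A) :=
  ext_map _ A

theorem ext_smul_one {U : Type*} [Ring U] (s : U) :
    ext (s • (1 : Matrix (Fin n → Fin N) (Fin n → Fin N) U)) = s • 1 :=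
  (place_smul _ _ _).trans (by rw [place_one])

variable (R) in
/-- The product `R₁ R₂ ⋯ R_n` on `n + 1` tensor factors. -/
def fwd : (n : ℕ) → Matrix (Fin (n + 1) → Fin N) (Fin (n + 1) → Fin N) ℂ
  | 0 => 1
  | n + 1 => ext (fwd n) * site2 (n + 2) R n

variable (R) in
/-- The inverse of the product `R₁ R₂ ⋯ R_n` on `n + 1` tensor factors. -/
def bwd : (n : ℕ) → Matrix (Fin (n + 1) → Fin N) (Fin (n + 1) → Fin N) ℂ
  | 0 => 1
  | n + 1 => site2 (n + 2) R⁻¹ n * ext (bwd n)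

theorem fwd_mul_bwd (hR : IsHeckeSymmetry q R) : ∀ n, fwd R n * bwd R n = 1
  | 0 => by simp [fwd, bwd]
  | n + 1 => by
    rw [fwd, bwd, mul_assoc, ← mul_assoc (site2 _ _ _), site2_mul_inv hR, one_mul, ← ext_mul,
      fwd_mul_bwd hR n, ext_one]

theorem bwd_mul_fwd (hR : IsHeckeSymmetry q R) (n : ℕ) : bwd R n * fwd R n = 1 :=
  mul_eq_one_comm.1 (fwd_mul_bwd hR n)

theorem ext_ext_commute (A : Matrix (Fin n → Fin N) (Fin n → Fin N) ℂ) :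
    Commute (ext (ext A)) (site2 (n + 2) R n) := by
  rw [ext, ext, place_place _ (Fin.castSucc_injective _), site2, dif_pos (by omega)]
  refine place_comm _ _ (fun i j e => ?_) _ _
  have := congrArg Fin.val e
  simp at this
  omega

/-- If the right-hand generator is far from the last factor of the product, it commutes past that
factor and induction applies. If it is adjacent, one braid relation at the end of the product
suffices. -/
theorem fwd_mul_site2 (hR : IsHeckeSymmetry q R) : ∀ (n : ℕ) {k : ℕ}, k + 1 < n →
    fwd R n * site2 (n + 1) R k = site2 (n + 1) R (k + 1) * fwd R n
  | 0, _, h => by omega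
  | 1, _, h => by omega
  | n + 2, k, h => by
    rcases Nat.lt_or_ge (k + 1) (n + 1) with h' | h'
    · have ih := congrArg ext (fwd_mul_site2 hR (n + 1) h')
      rw [ext_mul, ext_mul, ext_site2 R (by omega), ext_site2 R (by omega)] at ih
      rw [fwd, mul_assoc, ← site2_comm R _ k (n + 1) (by omega), ← mul_assoc, ih, mul_assoc]
    · obtain rfl : k = n := by omega
      have hb := site2_braid hR (k + 3) k (by omega)
      have hc : Commute (ext (ext (fwd R k))) (site2 (k + 3) R (k + 1)) := ext_ext_commute _
      rw [fwd, fwd, ext_mul, ext_site2 R (by omega)]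
      calc ext (ext (fwd R k)) * site2 (k + 3) R k * site2 (k + 3) R (k + 1) * site2 (k + 3) R k
          = ext (ext (fwd R k)) *
              (site2 (k + 3) R k * site2 (k + 3) R (k + 1) * site2 (k + 3) R k) := by
            simp only [mul_assoc]
        _ = ext (ext (fwd R k)) * site2 (k + 3) R (k + 1) *
              (site2 (k + 3) R k * site2 (k + 3) R (k + 1)) := by
            rw [hb]; simp only [mul_assoc]
        _ = _ := by rw [hc.eq]; simp only [mul_assoc]

variable (R) in
/-- `M` acting in the tensor factors `2, …, n + 1`, where the passage from the factors `1, …, n`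
is made with the braiding `R`. -/
def shift (M : Matrix (Fin n → Fin N) (Fin n → Fin N) U) :
    Matrix (Fin (n + 1) → Fin N) (Fin (n + 1) → Fin N) U :=
  up U (fwd R n) * ext M * up U (bwd R n)

theorem shift_mul (hR : IsHeckeSymmetry q R) (A B : Matrix (Fin n → Fin N) (Fin n → Fin N) U) :
    shift R (A * B) = shift R A * shift R B := by
  have h : up U (bwd R n) * up U (fwd R n) = 1 := by rw [← up_mul, bwd_mul_fwd hR, up_one]
  calc shift R (A * B) = up U (fwd R n) * ext A * 1 * ext B * up U (bwd R n) := by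
        rw [shift, ext_mul, mul_one]; simp only [mul_assoc]
    _ = _ := by rw [← h]; simp only [shift, mul_assoc]

theorem shift_smul_one (hR : IsHeckeSymmetry q R) (s : U) :
    shift R (s • (1 : Matrix (Fin n → Fin N) (Fin n → Fin N) U)) = s • 1 := by
  rw [shift, ext_smul_one, (up_commute_smul_one _ s).eq, mul_assoc, ← up_mul, fwd_mul_bwd hR,
    up_one, mul_one]

theorem shift_one (hR : IsHeckeSymmetry q R) :
    shift R (1 : Matrix (Fin n → Fin N) (Fin n → Fin N) U) = 1 := by
  simpa using shift_smul_one (n := n) hR (1 : U)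

theorem shift_add (A B : Matrix (Fin n → Fin N) (Fin n → Fin N) U) :
    shift R (A + B) = shift R A + shift R B := by
  rw [shift, ext, place_add, mul_add, add_mul]; rfl

/-- Only the innermost $R$ of the conjugation touches the traced factor. The others come out of the
partial trace, and `ptr_conj` disposes of the innermost one. -/
theorem ptr_shift (hR : IsHeckeSymmetry q R) (hΨ : IsSkewInverse R Ψ)
    (Y : Matrix (Fin (n + 1) → Fin N) (Fin (n + 1) → Fin N) U) :
    ptr (cMat Ψ) (shift R Y) = shift R (ptr (cMat Ψ) Y) := by
  have h : shift R Y = ext (up U (fwd R n)) * ((site2 (n + 2) (up U R) n * ext Y *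
      site2 (n + 2) (up U R⁻¹) n) * ext (up U (bwd R n))) := by
    rw [shift, fwd, bwd, up_mul, up_mul, up_ext, up_ext, up_site2, up_site2]
    simp only [mul_assoc]
  rw [h, ptr_ext_mul, ptr_mul_ext]
  erw [ptr_conj hR hΨ]
  rw [shift, mul_assoc]

theorem shift_site2 (hR : IsHeckeSymmetry q R) {k : ℕ} (h : k + 1 < n) :
    shift R (up U (site2 n R k)) = up U (site2 (n + 1) R (k + 1)) := by
  rw [shift, ← up_ext, ext_site2 R h, ← up_mul, fwd_mul_site2 hR n h, ← up_mul, mul_assoc,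
    fwd_mul_bwd hR, mul_one]

theorem shift_site2_inv (hR : IsHeckeSymmetry q R) {k : ℕ} (h : k + 1 < n) :
    shift R (up U (site2 n R⁻¹ k)) = up U (site2 (n + 1) R⁻¹ (k + 1)) := by
  have h1 : shift R (up U (site2 n R⁻¹ k)) * shift R (up U (site2 n R k)) = 1 := by
    rw [← shift_mul hR, ← up_mul, site2_inv_mul hR, up_one, shift_one hR]
  have h2 : up U (site2 (n + 1) R (k + 1)) * up U (site2 (n + 1) R⁻¹ (k + 1)) = 1 := by
    rw [← up_mul, site2_mul_inv hR, up_one]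
  rw [shift_site2 hR h] at h1
  calc _ = shift R (up U (site2 n R⁻¹ k)) * (up U (site2 (n + 1) R (k + 1)) *
        up U (site2 (n + 1) R⁻¹ (k + 1))) := by rw [h2, mul_one]
    _ = _ := by rw [← mul_assoc, h1, one_mul]

theorem up_mul_up_inv (hR : IsHeckeSymmetry q R) (n k : ℕ) :
    up U (site2 n R k) * up U (site2 n R⁻¹ k) = 1 := by
  rw [← up_mul, site2_mul_inv hR, up_one]

theorem up_inv_mul_up (hR : IsHeckeSymmetry q R) (n k : ℕ) :
    up U (site2 n R⁻¹ k) * up U (site2 n R k) = 1 := by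
  rw [← up_mul, site2_inv_mul hR, up_one]

/-- All factors of the conjugating product except the first commute with a matrix acting in the
first tensor factor, so they cancel against their inverses. -/
theorem fwd_conj_site1 (hR : IsHeckeSymmetry q R) (M : Matrix (Fin N) (Fin N) U) : ∀ n,
    up U (fwd R (n + 1)) * site1 (n + 2) M * up U (bwd R (n + 1)) =
      up U (site2 (n + 2) R 0) * site1 (n + 2) M * up U (site2 (n + 2) R⁻¹ 0)
  | 0 => by simp only [fwd, bwd, ext_one, one_mul, mul_one]
  | n + 1 => by
    have hc : Commute (site1 (n + 3) M) (up U (site2 (n + 3) R (n + 1))) := by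
      rw [up_site2]; exact site1_commute_site2 M R (n + 3) n
    have ih := congrArg ext (fwd_conj_site1 hR M n)
    simp only [ext_mul, ← up_ext] at ih
    rw [ext_site1 M (by omega), ext_site2 R (by omega), ext_site2 R⁻¹ (by omega)] at ih
    rw [← ih, fwd, bwd, up_mul, up_mul]
    calc _ = up U (ext (fwd R (n + 1))) * (up U (site2 (n + 3) R (n + 1)) * site1 (n + 3) M) *
          up U (site2 (n + 3) R⁻¹ (n + 1)) * up U (ext (bwd R (n + 1))) := by
          simp only [mul_assoc]
      _ = up U (ext (fwd R (n + 1))) * site1 (n + 3) M * (up U (site2 (n + 3) R (n + 1)) *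
          up U (site2 (n + 3) R⁻¹ (n + 1))) * up U (ext (bwd R (n + 1))) := by
          rw [← hc.eq]; simp only [mul_assoc]
      _ = _ := by rw [up_mul_up_inv hR, mul_one]

theorem shift_site1 (hR : IsHeckeSymmetry q R) (M : Matrix (Fin N) (Fin N) U) (hn : 0 < n) :
    shift R (site1 n M) =
      up U (site2 (n + 1) R 0) * site1 (n + 1) M * up U (site2 (n + 1) R⁻¹ 0) := by
  obtain ⟨n, rfl⟩ : ∃ k, n = k + 1 := ⟨n - 1, by omega⟩
  rw [shift, ext_site1 M hn, fwd_conj_site1 hR]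

/-! ### Iterated shifts and multiplicativity of the $R$-trace. -/

variable (R) in
/-- The `j`-fold iteration of `shift`. -/
def shiftN : (j : ℕ) → Matrix (Fin n → Fin N) (Fin n → Fin N) U →
    Matrix (Fin (n + j) → Fin N) (Fin (n + j) → Fin N) U
  | 0, M => M
  | j + 1, M => shift R (shiftN j M)

theorem shiftN_mul (hR : IsHeckeSymmetry q R) (A B : Matrix (Fin n → Fin N) (Fin n → Fin N) U) :
    ∀ j, shiftN R j (A * B) = shiftN R j A * shiftN R j B
  | 0 => rfl
  | j + 1 => by rw [shiftN, shiftN_mul hR A B j, shift_mul hR]; rfl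

theorem shiftN_add (A B : Matrix (Fin n → Fin N) (Fin n → Fin N) U) :
    ∀ j, shiftN R j (A + B) = shiftN R j A + shiftN R j B
  | 0 => rfl
  | j + 1 => by rw [shiftN, shiftN_add A B j, shift_add]; rfl

theorem shiftN_smul_one (hR : IsHeckeSymmetry q R) (s : U) :
    ∀ j, shiftN R j (s • (1 : Matrix (Fin n → Fin N) (Fin n → Fin N) U)) = s • 1
  | 0 => rfl
  | j + 1 => by rw [shiftN, shiftN_smul_one hR s j, shift_smul_one hR]

theorem shiftN_one (hR : IsHeckeSymmetry q R) (j : ℕ) :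
    shiftN R j (1 : Matrix (Fin n → Fin N) (Fin n → Fin N) U) = 1 := by
  simpa using shiftN_smul_one (n := n) hR (1 : U) j

theorem shiftN_site2 (hR : IsHeckeSymmetry q R) {k : ℕ} (h : k + 1 < n) :
    ∀ j, shiftN R j (up U (site2 n R k)) = up U (site2 (n + j) R (k + j))
  | 0 => rfl
  | j + 1 => by
    rw [shiftN, shiftN_site2 hR h j]
    exact shift_site2 hR (show k + j + 1 < n + j by omega)

/-- `TracesTo C j s n M`: the partial trace of `M` over the factors `j + 1, …, n` is `s • I`. -/
inductive TracesTo (C : Matrix (Fin N) (Fin N) ℂ) (j : ℕ) (s : U) :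
    (n : ℕ) → Matrix (Fin n → Fin N) (Fin n → Fin N) U → Prop
  | base : TracesTo C j s j (s • 1)
  | step (n : ℕ) (M : Matrix (Fin (n + 1) → Fin N) (Fin (n + 1) → Fin N) U) :
      TracesTo C j s n (ptr C M) → TracesTo C j s (n + 1) M

theorem TracesTo.shift (hR : IsHeckeSymmetry q R) (hΨ : IsSkewInverse R Ψ) {j : ℕ} {s : U}
    {M : Matrix (Fin n → Fin N) (Fin n → Fin N) U} (h : TracesTo (cMat Ψ) j s n M) :
    TracesTo (cMat Ψ) (j + 1) s (n + 1) (shift R M) := by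
  induction h with
  | base => rw [shift_smul_one hR]; exact .base
  | step n M _ ih => exact .step _ _ (by rw [ptr_shift hR hΨ]; exact ih)

theorem tracesTo_zero (C : Matrix (Fin N) (Fin N) ℂ) :
    ∀ (n : ℕ) (M : Matrix (Fin n → Fin N) (Fin n → Fin N) U), TracesTo C 0 (rTrace C n M) n M
  | 0, M => by
    conv => arg 5; rw [eq_rTrace_smul_one C M]
    exact .base
  | n + 1, M => .step _ _ (by rw [rTrace_succ]; exact tracesTo_zero C n _)

/-- For `j = 0` the full trace is a scalar. Each shift preserves that scalar and frees one more
factor at the left, because partial traces commute with `shift`. -/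
theorem tracesTo_shiftN (hR : IsHeckeSymmetry q R) (hΨ : IsSkewInverse R Ψ)
    (M : Matrix (Fin n → Fin N) (Fin n → Fin N) U) :
    ∀ j, TracesTo (cMat Ψ) j (rTrace (cMat Ψ) n M) (n + j) (shiftN R j M)
  | 0 => tracesTo_zero _ n M
  | j + 1 => (tracesTo_shiftN hR hΨ M j).shift hR hΨ

theorem rTrace_mul_smul_one (C : Matrix (Fin N) (Fin N) ℂ)
    (A : Matrix (Fin n → Fin N) (Fin n → Fin N) U) (s : U) :
    rTrace C n (A * s • 1) = rTrace C n A * s := by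
  simp only [rTrace_eq_sum, Finset.sum_mul, smul_mul_assoc]
  refine Finset.sum_congr rfl fun x _ => Finset.sum_congr rfl fun y _ => ?_
  congr 1
  simp [Matrix.mul_apply, Matrix.one_apply]

theorem TracesTo.le {C : Matrix (Fin N) (Fin N) ℂ} {j : ℕ} {s : U}
    {M : Matrix (Fin n → Fin N) (Fin n → Fin N) U} (h : TracesTo C j s n M) : j ≤ n := by
  induction h with
  | base => exact le_rfl
  | step n M _ ih => omega

theorem TracesTo.rTrace_mul {C : Matrix (Fin N) (Fin N) ℂ} {j : ℕ} {s : U}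
    {M : Matrix (Fin n → Fin N) (Fin n → Fin N) U} (h : TracesTo C j s n M) (hj : j ≤ n)
    (A : Matrix (Fin j → Fin N) (Fin j → Fin N) U) :
    rTrace C n (place (Fin.castLE hj) A * M) = rTrace C j A * s := by
  induction h with
  | base =>
    have : place (Fin.castLE hj) A = A := by
      ext x y
      rw [place_apply_pos]
      · rfl
      · exact fun k hk => absurd ⟨k, rfl⟩ hk
    rw [this, rTrace_mul_smul_one]
  | step n M h' ih =>
    have hj' := h'.le
    have : place (Fin.castLE hj) A = ext (place (Fin.castLE hj') A) := by
      rw [ext, place_place _ (Fin.castSucc_injective _)]; rfl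
    rw [this, rTrace_succ, ptr_ext_mul, ih hj']

/-- The multiple `R`-trace is multiplicative on products of matrices acting in the first `j` and
the last `n` tensor factors. -/
theorem rTrace_place_mul_shiftN (hR : IsHeckeSymmetry q R) (hΨ : IsSkewInverse R Ψ) (j : ℕ)
    (A : Matrix (Fin j → Fin N) (Fin j → Fin N) U)
    (M : Matrix (Fin n → Fin N) (Fin n → Fin N) U) :
    rTrace (cMat Ψ) (n + j) (place (Fin.castLE (Nat.le_add_left j n)) A * shiftN R j M) =
      rTrace (cMat Ψ) j A * rTrace (cMat Ψ) n M :=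
  (tracesTo_shiftN hR hΨ M j).rTrace_mul _ A

end Shift

/-! ### Copies of the generating matrix -/

section Copies

variable {N n : ℕ} {q : ℂ} {R Ψ : Matrix (Fin N × Fin N) (Fin N × Fin N) ℂ}

theorem copyL_succ (k : ℕ) :
    copyL R n (k + 1) = up _ (site2 n R k) * copyL R n k * up _ (site2 n R⁻¹ k) := rfl

theorem shift_copyL (hR : IsHeckeSymmetry q R) : ∀ (k : ℕ), k < n →
    shift R (copyL R n k) = copyL R (n + 1) (k + 1)
  | 0, h => shift_site1 hR _ h
  | k + 1, h => by
    rw [copyL_succ, shift_mul hR, shift_mul hR, shift_site2 hR h, shift_site2_inv hR h,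
      shift_copyL hR k (by omega)]
    rfl

theorem shiftN_copyL (hR : IsHeckeSymmetry q R) {k : ℕ} (h : k < n) : ∀ j,
    shiftN R j (copyL R n k) = copyL R (n + j) (k + j)
  | 0 => rfl
  | j + 1 => by
    rw [shiftN, shiftN_copyL hR h j]
    exact shift_copyL hR (k + j) (show k + j < n + j by omega)

theorem place_castLE_site2 {S : Type*} [Semiring S]
    (A : Matrix (Fin N × Fin N) (Fin N × Fin N) S) {j : ℕ} (hj : j ≤ n) {k : ℕ} (h : k + 1 < j) :
    place (Fin.castLE hj) (site2 j A k) = site2 n A k := by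
  rw [site2, site2, dif_pos h, dif_pos (by omega), place_place _ (Fin.castLE_injective hj)]
  rfl

theorem place_castLE_copyL {j : ℕ} (hj : j ≤ n) : ∀ (k : ℕ), k < j →
    place (Fin.castLE hj) (copyL R j k) = copyL R n k
  | 0, h => by
    rw [copyL, copyL, site1, site1, dif_pos h, dif_pos (by omega),
      place_place _ (Fin.castLE_injective hj)]
    rfl
  | k + 1, h => by
    rw [copyL_succ, copyL_succ, place_mul _ (Fin.castLE_injective hj),
      place_mul _ (Fin.castLE_injective hj), place_castLE_copyL hj k (by omega), up_site2, up_site2,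
      place_castLE_site2 _ hj h, place_castLE_site2 _ hj h, up_site2, up_site2]

/-- The product `L_{\overline{1}} ⋯ L_{\overline{j}}` on `n` tensor factors. -/
def partialL (R : Matrix (Fin N × Fin N) (Fin N × Fin N) ℂ) (n j : ℕ) :
    Matrix (Fin n → Fin N) (Fin n → Fin N) (REAlgebra R) :=
  ((List.range j).map (copyL R n)).prod

theorem partialL_succ (j : ℕ) : partialL R n (j + 1) = partialL R n j * copyL R n j := by
  simp [partialL, List.range_succ]

theorem prodL_eq_partialL (n : ℕ) : prodL R n = partialL R n n := rfl

theorem place_castLE_partialL {m : ℕ} (hm : m ≤ n) : ∀ (k : ℕ), k ≤ m →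
    place (Fin.castLE hm) (partialL R m k) = partialL R n k
  | 0, _ => place_one _
  | k + 1, h => by
    rw [partialL_succ, partialL_succ, place_mul _ (Fin.castLE_injective hm),
      place_castLE_partialL hm k (by omega), place_castLE_copyL hm k h]

theorem partialL_mul_shiftN (hR : IsHeckeSymmetry q R) (j : ℕ) : ∀ (k : ℕ), k ≤ n →
    partialL R (n + j) j * shiftN R j (partialL R n k) = partialL R (n + j) (k + j)
  | 0, _ => by
    rw [Nat.zero_add]
    simp only [partialL, List.range_zero, List.map_nil, List.prod_nil, shiftN_one hR, mul_one]
  | k + 1, h => by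
    rw [partialL_succ, shiftN_mul hR, ← mul_assoc, partialL_mul_shiftN hR j k (by omega),
      shiftN_copyL hR h, show k + 1 + j = k + j + 1 by omega, partialL_succ]

theorem prodL_add (hR : IsHeckeSymmetry q R) (j : ℕ) :
    prodL R (n + j) = place (Fin.castLE (Nat.le_add_left j n)) (prodL R j) *
      shiftN R j (prodL R n) := by
  rw [prodL_eq_partialL, prodL_eq_partialL, prodL_eq_partialL, place_castLE_partialL _ _ le_rfl,
    partialL_mul_shiftN hR j n le_rfl]

/-! ### Commutation of the copies of $L$ with the braiding. -/

theorem copyL_commute_of_lt (hR : IsHeckeSymmetry q R) : ∀ (k : ℕ) {i : ℕ}, k < i →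
    Commute (copyL R n k) (up _ (site2 n R i))
  | 0, i, h => by
    obtain ⟨i, rfl⟩ : ∃ l, i = l + 1 := ⟨i - 1, by omega⟩
    rw [up_site2]
    exact site1_commute_site2 _ R n i
  | k + 1, i, h => by
    have h1 : Commute (site2 n R k) (site2 n R i) := site2_comm R n k i (by omega)
    have h2 : Commute (site2 n R⁻¹ k) (site2 n R i) := by
      change _ = _
      calc _ = site2 n R⁻¹ k * (site2 n R i * site2 n R k) * site2 n R⁻¹ k := by
            rw [mul_assoc, mul_assoc, site2_mul_inv hR, mul_one]
        _ = (site2 n R⁻¹ k * site2 n R k) * site2 n R i * site2 n R⁻¹ k := by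
            rw [← h1.eq]; simp only [mul_assoc]
        _ = _ := by rw [site2_inv_mul hR, one_mul]
    exact ((up_commute h1).mul_left (copyL_commute_of_lt hR k (by omega))).mul_left (up_commute h2)

/-- The critical case is the copy number `i + 2`, which is the copy number `i` conjugated by
$R_{i+1}R_i$. Braid relations turn $R_i$ into $R_{i+1}$ inside the conjugation, and $R_{i+1}$
commutes with the copy number `i`. -/
theorem copyL_commute_of_gt (hR : IsHeckeSymmetry q R) {i : ℕ} : ∀ (k : ℕ), i + 2 ≤ k → k < n →
    Commute (copyL R n k) (up _ (site2 n R i))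
  | 0, h, _ => by omega
  | k + 1, h, hn => by
    rcases Nat.lt_or_ge i (k - 1) with h' | h'
    · have h1 : Commute (site2 n R k) (site2 n R i) := (site2_comm R n i k (by omega)).symm
      have h2 : Commute (site2 n R⁻¹ k) (site2 n R i) := by
        change _ = _
        calc _ = site2 n R⁻¹ k * (site2 n R i * site2 n R k) * site2 n R⁻¹ k := by
              rw [mul_assoc, mul_assoc, site2_mul_inv hR, mul_one]
          _ = (site2 n R⁻¹ k * site2 n R k) * site2 n R i * site2 n R⁻¹ k := by
              rw [← h1.eq]; simp only [mul_assoc]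
          _ = _ := by rw [site2_inv_mul hR, one_mul]
      exact ((up_commute h1).mul_left (copyL_commute_of_gt hR k (by omega) (by omega))).mul_left
        (up_commute h2)
    · obtain rfl : k = i + 1 := by omega
      have hb := congrArg (up (REAlgebra R)) (site2_braid hR n i (by omega))
      simp only [up_mul] at hb
      have hb' : up (REAlgebra R) (site2 n R⁻¹ i) * up _ (site2 n R⁻¹ (i + 1)) *
          up _ (site2 n R i) =
          up _ (site2 n R (i + 1)) * up _ (site2 n R⁻¹ i) * up _ (site2 n R⁻¹ (i + 1)) := by
        have e0 := up_mul_up_inv (U := REAlgebra R) hR n i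
        have e1 := up_mul_up_inv (U := REAlgebra R) hR n (i + 1)
        have f0 := up_inv_mul_up (U := REAlgebra R) hR n i
        have f1 := up_inv_mul_up (U := REAlgebra R) hR n (i + 1)
        generalize up (REAlgebra R) (site2 n R i) = a at *
        generalize up (REAlgebra R) (site2 n R⁻¹ i) = a' at *
        generalize up (REAlgebra R) (site2 n R (i + 1)) = b at *
        generalize up (REAlgebra R) (site2 n R⁻¹ (i + 1)) = b' at *
        calc a' * b' * a = a' * b' * (a * b * a) * (a' * b') := by
              have : a * b * a * (a' * b') = a := by
                rw [mul_assoc, ← mul_assoc a a' b', e0, one_mul, mul_assoc, e1, mul_one]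
              rw [mul_assoc _ (a * b * a), this]
          _ = b * (a' * b') := by
              rw [hb]
              have : a' * b' * (b * a * b) = b := by
                rw [mul_assoc, mul_assoc b a b, ← mul_assoc b' b, f1, one_mul, ← mul_assoc, f0,
                  one_mul]
              rw [this]
          _ = _ := by rw [mul_assoc]
      have hc := copyL_commute_of_lt (n := n) hR i (Nat.lt_succ_self i)
      change _ * _ = _ * _
      rw [copyL_succ, copyL_succ]
      generalize up (REAlgebra R) (site2 n R i) = a at *
      generalize up (REAlgebra R) (site2 n R⁻¹ i) = a' at *
      generalize up (REAlgebra R) (site2 n R (i + 1)) = b at *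
      generalize up (REAlgebra R) (site2 n R⁻¹ (i + 1)) = b' at *
      generalize copyL R n i = l at *
      have hc' : l * b = b * l := hc
      calc b * (a * l * a') * b' * a = b * a * l * (a' * b' * a) := by simp only [mul_assoc]
        _ = b * a * (l * b) * (a' * b') := by rw [hb']; simp only [mul_assoc]
        _ = (b * a * b) * l * (a' * b') := by rw [hc']; simp only [mul_assoc]
        _ = _ := by rw [← hb]; simp only [mul_assoc]

/-- The reflection equation in the first two tensor factors. -/
theorem reflection_zero (hn : 1 < n) :
    up _ (site2 n R 0) * copyL R n 0 * up _ (site2 n R 0) * copyL R n 0 =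
      copyL R n 0 * up _ (site2 n R 0) * copyL R n 0 * up _ (site2 n R 0) := by
  have hf : Function.Injective (fun i : Fin 2 => (⟨0 + i, by omega⟩ : Fin n)) := by
    intro i j e
    simp only [Fin.mk.injEq] at e
    exact Fin.ext (by omega)
  have hL : copyL R n 0 = site2 n (genL R ⊗ₖ 1) 0 := by
    have : pairMat (genL R ⊗ₖ (1 : Matrix (Fin N) (Fin N) (REAlgebra R))) =
        place (fun _ : Fin 1 => (0 : Fin 2)) (Matrix.of fun u v => genL R (u 0) (v 0)) := by
      ext u v
      by_cases h : u 1 = v 1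
      · rw [place_apply_pos]
        · simp [pairMat, Matrix.one_apply, h]
        · intro j hj
          fin_cases j
          · exact absurd ⟨0, rfl⟩ hj
          · exact h
      · rw [place_apply_neg]
        · simp [pairMat, h]
        · intro h'
          exact h (h' 1 (by rintro ⟨_, hi⟩; exact zero_ne_one hi))
    rw [copyL, site1, site2, dif_pos (by omega), dif_pos hn, this, place_place _ hf]
    rfl
  rw [hL, up_site2, ← site2_mul _ _ hn, ← site2_mul _ _ hn, ← site2_mul _ _ hn, ← site2_mul _ _ hn,
    ← site2_mul _ _ hn, ← site2_mul _ _ hn]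
  congr 1
  have h1 : (freeR R).map (REAlgebra.mk R) = up _ R := by
    ext u v
    simp [freeR, up]
  have h2 : (freeL1 N).map (REAlgebra.mk R) = genL R ⊗ₖ 1 := by
    ext u v
    simp [freeL1, genL, Matrix.kroneckerMap_apply, Matrix.one_apply, apply_ite (REAlgebra.mk R)]
  have h3 : ∀ A B : Matrix (Fin N × Fin N) (Fin N × Fin N) (FreeAlgebra ℂ (Fin N × Fin N)),
      (A * B).map (REAlgebra.mk R) = A.map (REAlgebra.mk R) * B.map (REAlgebra.mk R) :=
    fun A B => Matrix.map_mul (f := (REAlgebra.mk R).toRingHom)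
  rw [← h1, ← h2, ← h3, ← h3, ← h3, ← h3, ← h3, ← h3]
  ext u v
  exact RingQuot.mkAlgHom_rel ℂ (RERel.rel u v)

/-- The relation in the first two factors is transported by `shiftN`, which is multiplicative and
moves both $R$ and the copies of $L$ along. -/
theorem reflection (hR : IsHeckeSymmetry q R) {i : ℕ} (hi : i + 1 < n) :
    up _ (site2 n R i) * copyL R n i * up _ (site2 n R i) * copyL R n i =
      copyL R n i * up _ (site2 n R i) * copyL R n i * up _ (site2 n R i) := by
  obtain ⟨k, rfl⟩ : ∃ k, n = k + i := ⟨n - i, by omega⟩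
  have h := congrArg (shiftN R i) (reflection_zero (R := R) (n := k) (by omega))
  simp only [shiftN_mul hR] at h
  rw [shiftN_site2 hR (by omega), shiftN_copyL hR (by omega), Nat.zero_add] at h
  exact h

/-- With the second copy written as $RLR^{-1}$, this is the reflection equation multiplied by
$R^{-1}$. -/
theorem copyL_mul_copyL_commute (hR : IsHeckeSymmetry q R) {i : ℕ} (hi : i + 1 < n) :
    Commute (copyL R n i * copyL R n (i + 1)) (up _ (site2 n R i)) := by
  have h := reflection hR hi
  have e0 := up_mul_up_inv (U := REAlgebra R) hR n i
  have f0 := up_inv_mul_up (U := REAlgebra R) hR n i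
  change _ * _ = _ * _
  rw [copyL_succ]
  generalize up (REAlgebra R) (site2 n R i) = a at *
  generalize up (REAlgebra R) (site2 n R⁻¹ i) = a' at *
  generalize copyL R n i = l at *
  calc l * (a * l * a') * a = l * a * l * (a' * a) := by simp only [mul_assoc]
    _ = l * a * l * (a * a') := by rw [f0, e0]
    _ = (l * a * l * a) * a' := by simp only [mul_assoc]
    _ = _ := by rw [← h]; simp only [mul_assoc]

theorem partialL_commute (hR : IsHeckeSymmetry q R) {i : ℕ} : ∀ k, k ≤ i →
    Commute (partialL R n k) (up _ (site2 n R i))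
  | 0, _ => Commute.one_left _
  | k + 1, h => by
    rw [partialL_succ]
    exact (partialL_commute hR k (by omega)).mul_left (copyL_commute_of_lt hR k h)

/-- The product splits into earlier copies, the pair with numbers `i` and `i + 1`, and later copies.
The first commute with $R_i$ by locality, the pair by the reflection equation, the last by the braid
relation. -/
theorem partialL_commute_of_ge (hR : IsHeckeSymmetry q R) {i : ℕ} : ∀ k, i + 2 ≤ k → k ≤ n →
    Commute (partialL R n k) (up _ (site2 n R i))
  | 0, h, _ => by omega
  | 1, h, _ => by omega
  | k + 2, h, hn => by
    rcases Nat.lt_or_ge i k with h' | h'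
    · rw [partialL_succ]
      exact (partialL_commute_of_ge hR (k + 1) (by omega) (by omega)).mul_left
        (copyL_commute_of_gt hR (k + 1) (by omega) (by omega))
    · obtain rfl : k = i := by omega
      rw [partialL_succ, partialL_succ, mul_assoc]
      exact (partialL_commute hR k le_rfl).mul_left (copyL_mul_copyL_commute hR (by omega))

theorem prodL_commute (hR : IsHeckeSymmetry q R) (n i : ℕ) :
    Commute (prodL R n) (up _ (site2 n R i)) := by
  by_cases h : i + 1 < n
  · exact partialL_commute_of_ge hR n (by omega) le_rfl
  · rw [site2, dif_neg h, up_one]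
    exact Commute.one_right _

end Copies

/-! ### The characteristic map on matrices -/

section CharMap

variable {N n : ℕ} {q : ℂ} {R Ψ : Matrix (Fin N × Fin N) (Fin N × Fin N) ℂ}

/-- The algebra generated by the matrices `R_k` acting in the tensor factors `a + 1, …, b`. -/
def heckeRange (R : Matrix (Fin N × Fin N) (Fin N × Fin N) ℂ) (n a b : ℕ) :
    Subalgebra ℂ (Matrix (Fin n → Fin N) (Fin n → Fin N) ℂ) :=
  Algebra.adjoin ℂ {Z | ∃ i, a ≤ i ∧ i + 1 < b ∧ Z = site2 n R i}

theorem site2_mem_heckeRange {a b i : ℕ} (ha : a ≤ i) (hb : i + 1 < b) :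
    site2 n R i ∈ heckeRange R n a b := Algebra.subset_adjoin ⟨i, ha, hb, rfl⟩

theorem heckeRange_mono {a b a' b' : ℕ} (ha : a' ≤ a) (hb : b ≤ b') :
    heckeRange R n a b ≤ heckeRange R n a' b' :=
  Algebra.adjoin_mono fun _ ⟨i, h1, h2, h3⟩ => ⟨i, ha.trans h1, h2.trans_le hb, h3⟩

theorem commute_of_mem_heckeRange {a b : ℕ} {Y : Matrix (Fin n → Fin N) (Fin n → Fin N) ℂ}
    (hY : Y ∈ heckeRange R n a b) {M : Matrix (Fin n → Fin N) (Fin n → Fin N) (REAlgebra R)}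
    (h : ∀ i, a ≤ i → i + 1 < b → Commute M (up _ (site2 n R i))) : Commute M (up _ Y) := by
  induction hY using Algebra.adjoin_induction with
  | mem x hx => obtain ⟨i, h1, h2, rfl⟩ := hx; exact h i h1 h2
  | algebraMap r =>
    rw [Algebra.algebraMap_eq_smul_one, up_smul, up_one]
    exact (Commute.one_right M).smul_right r
  | add x y _ _ hx hy => rw [up_add]; exact hx.add_right hy
  | mul x y _ _ hx hy => rw [up_mul]; exact hx.mul_right hy

theorem commute_heckeRange {a b c d : ℕ} (h : b ≤ c)
    {X Y : Matrix (Fin n → Fin N) (Fin n → Fin N) ℂ}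
    (hX : X ∈ heckeRange R n a b) (hY : Y ∈ heckeRange R n c d) : Commute X Y := by
  refine Algebra.commute_of_mem_adjoin_of_forall_mem_commute hY ?_
  rintro _ ⟨j, h3, h4, rfl⟩
  refine (Algebra.commute_of_mem_adjoin_of_forall_mem_commute hX ?_).symm
  rintro _ ⟨i, h1, h2, rfl⟩
  exact (site2_comm R n i j (by omega)).symm

/-- The map `ch` on matrices. -/
def chLin (R Ψ : Matrix (Fin N × Fin N) (Fin N × Fin N) ℂ) (n : ℕ) :
    Matrix (Fin n → Fin N) (Fin n → Fin N) ℂ →ₗ[ℂ] REAlgebra R where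
  toFun Z := rTrace (cMat Ψ) n (up _ Z * prodL R n)
  map_add' X Y := by
    simp only [rTrace, up_add, add_mul, mul_add, Matrix.trace_add]
  map_smul' c X := by
    simp only [rTrace, up_smul, smul_mul_assoc, mul_smul_comm, Matrix.trace_smul,
      RingHom.id_apply]

theorem ch_eq_chLin (hR : IsHeckeSymmetry q R) (z : HeckeAlgebra q n) :
    ch hR Ψ n z = chLin R Ψ n (rho hR n z) := rfl

theorem chLin_apply (X : Matrix (Fin n → Fin N) (Fin n → Fin N) ℂ) :
    chLin R Ψ n X = rTrace (cMat Ψ) n (up _ X * prodL R n) := rfl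

/-- The characteristic map is cyclic. -/
theorem chLin_mul_comm (hR : IsHeckeSymmetry q R) (hΨ : IsSkewInverse R Ψ) {b : ℕ}
    (X : Matrix (Fin n → Fin N) (Fin n → Fin N) ℂ) {Y : Matrix (Fin n → Fin N) (Fin n → Fin N) ℂ}
    (hY : Y ∈ heckeRange R n 0 b) : chLin R Ψ n (X * Y) = chLin R Ψ n (Y * X) := by
  have h1 : Commute (prodL R n) (up _ Y) :=
    commute_of_mem_heckeRange hY fun i _ _ => prodL_commute hR n i
  have h2 : Commute (tensorPow (cMat Ψ) n) Y := by
    refine (Algebra.commute_of_mem_adjoin_of_forall_mem_commute hY ?_)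
    rintro _ ⟨i, _, _, rfl⟩
    exact tensorPow_commute_site2 hR hΨ n i
  rw [chLin_apply, chLin_apply, up_mul, up_mul, mul_assoc, ← h1.eq, ← mul_assoc, mul_assoc (up _ Y)]
  exact (rTrace_mul_comm _ h2 _).symm

/-- Shifting keeps matrices from the Hecke algebra scalar and moves them to the generators of index
at least `j`, which commute with the first `j` copies of $L$. -/
theorem exists_shiftN_eq (hR : IsHeckeSymmetry q R) (j : ℕ)
    {Y : Matrix (Fin n → Fin N) (Fin n → Fin N) ℂ} (hY : Y ∈ heckeRange R n 0 n) :
    ∃ Y' ∈ heckeRange R (n + j) j (n + j),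
      shiftN R j (up (REAlgebra R) Y) = up (REAlgebra R) Y' := by
  induction hY using Algebra.adjoin_induction with
  | mem x hx =>
    obtain ⟨i, h1, h2, rfl⟩ := hx
    exact ⟨_, site2_mem_heckeRange (by omega) (by omega), shiftN_site2 hR h2 j⟩
  | algebraMap r =>
    refine ⟨algebraMap ℂ _ r, Subalgebra.algebraMap_mem _ r, ?_⟩
    rw [Algebra.algebraMap_eq_smul_one, Algebra.algebraMap_eq_smul_one, up_smul, up_smul, up_one,
      up_one, ← algebraMap_smul (REAlgebra R) r, shiftN_smul_one hR, algebraMap_smul]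
  | add x y _ _ hx hy =>
    obtain ⟨x', hx', ex⟩ := hx
    obtain ⟨y', hy', ey⟩ := hy
    exact ⟨x' + y', add_mem hx' hy', by rw [up_add, up_add, shiftN_add, ex, ey]⟩
  | mul x y _ _ hx hy =>
    obtain ⟨x', hx', ex⟩ := hx
    obtain ⟨y', hy', ey⟩ := hy
    exact ⟨x' * y', mul_mem hx' hy', by rw [up_mul, up_mul, shiftN_mul hR, ex, ey]⟩

/-- The characteristic map is multiplicative. -/
theorem chLin_place_mul (hR : IsHeckeSymmetry q R) (hΨ : IsSkewInverse R Ψ) (j : ℕ)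
    (X : Matrix (Fin j → Fin N) (Fin j → Fin N) ℂ)
    {Y : Matrix (Fin n → Fin N) (Fin n → Fin N) ℂ}
    {Y' : Matrix (Fin (n + j) → Fin N) (Fin (n + j) → Fin N) ℂ}
    (hY' : Y' ∈ heckeRange R (n + j) j (n + j))
    (h : shiftN R j (up (REAlgebra R) Y) = up (REAlgebra R) Y') :
    chLin R Ψ (n + j) (place (Fin.castLE (Nat.le_add_left j n)) X * Y') =
      chLin R Ψ j X * chLin R Ψ n Y := by
  have hc : Commute (partialL R (n + j) j) (up _ Y') :=
    commute_of_mem_heckeRange hY' fun i hi _ => partialL_commute hR j hi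
  have e : up (REAlgebra R) (place (Fin.castLE (Nat.le_add_left j n)) X) =
      place (Fin.castLE (Nat.le_add_left j n)) (up _ X) := place_map _ _ X
  rw [chLin_apply, prodL_add hR, up_mul, e]
  rw [← place_castLE_partialL (Nat.le_add_left j n) j le_rfl, ← prodL_eq_partialL] at hc
  -- `Y'` passes the first `j` copies, so that `X` stands beside its own copies of $L$ and `Y'`
  -- beside the shifted ones.
  rw [mul_assoc, ← mul_assoc (up _ Y'), ← hc.eq, mul_assoc, ← h, ← shiftN_mul hR, ← mul_assoc,
    ← place_mul _ (Fin.castLE_injective _), rTrace_place_mul_shiftN hR hΨ]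
  rfl

end CharMap

/-! ### `q`-numbers -/

section QNum

variable {q : ℂ}

theorem IsGeneric.sub_inv_ne_zero (hq : IsGeneric q) : q - q⁻¹ ≠ 0 := by
  intro h
  refine hq.2 2 (by norm_num) ?_
  have h0 := hq.1
  field_simp at h
  linear_combination h

theorem qNum_ne_zero (hq : IsGeneric q) {k : ℕ} (hk : 1 ≤ k) : qNum q k ≠ 0 := by
  refine div_ne_zero (fun h => ?_) hq.sub_inv_ne_zero
  refine hq.2 (2 * k) (by omega) ?_
  have h0 : q ^ k ≠ 0 := pow_ne_zero _ hq.1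
  rw [inv_pow, sub_eq_zero] at h
  rw [two_mul, pow_add]
  nth_rewrite 1 [h]
  exact inv_mul_cancel₀ h0

theorem qNum_one (hq : IsGeneric q) : qNum q 1 = 1 := by
  rw [qNum, pow_one, pow_one, div_self hq.sub_inv_ne_zero]

theorem qNum_succ (hq : IsGeneric q) (k : ℕ) :
    qNum q (k + 1) = q ^ k + q⁻¹ * qNum q k := by
  have h := hq.sub_inv_ne_zero
  have e : q ^ (k + 1) - q⁻¹ ^ (k + 1) = q ^ k * (q - q⁻¹) + q⁻¹ * (q ^ k - q⁻¹ ^ k) := by ring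
  rw [qNum, qNum, e, add_div, mul_div_cancel_right₀ _ h, mul_div_assoc]

/-- Together with $\tau=\tau^{-1}+(q-q^{-1})$ this makes the recursion for the antisymmetrizers
invariant under $q\mapsto q^{-1}$, $\tau\mapsto\tau^{-1}$. -/
theorem sub_mul_qNum (hq : IsGeneric q) (k : ℕ) :
    q ^ k - qNum q k * (q - q⁻¹) = q⁻¹ ^ k := by
  rw [qNum, div_mul_cancel₀ _ hq.sub_inv_ne_zero]; ring

end QNum

/-! ### Antisymmetrizers of families of generators -/

section Family

variable {A : Type*} [Ring A] [Algebra ℂ A] {q : ℂ} {n : ℕ} {t : ℕ → A}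

/-- The elements `t 0, …, t (n - 2)` satisfy the relations of the Hecke algebra `H_n(q)`. -/
structure IsHeckeFamily (q : ℂ) (n : ℕ) (t : ℕ → A) : Prop where
  hecke : ∀ i, i + 1 < n → (q • 1 - t i) * (q⁻¹ • 1 + t i) = 0
  braid : ∀ i, i + 2 < n → t i * t (i + 1) * t i = t (i + 1) * t i * t (i + 1)
  comm : ∀ i j, i + 2 ≤ j → j + 1 < n → Commute (t i) (t j)

/-- The antisymmetrizer of `t 0, …, t (k - 2)`. -/
def asym (q : ℂ) (t : ℕ → A) : ℕ → A
  | 0 => 1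
  | 1 => 1
  | k + 2 => (qNum q (k + 2))⁻¹ • (asym q t (k + 1) *
      (q ^ (k + 1) • 1 - qNum q (k + 1) • t k) * asym q t (k + 1))

theorem asym_succ (hq : IsGeneric q) (k : ℕ) :
    qNum q (k + 2) • asym q t (k + 2) =
      asym q t (k + 1) * (q ^ (k + 1) • 1 - qNum q (k + 1) • t k) * asym q t (k + 1) := by
  rw [asym, smul_smul, mul_inv_cancel₀ (qNum_ne_zero hq (by omega)), one_smul]

theorem map_asym {B : Type*} [Ring B] [Algebra ℂ B] (φ : A →ₐ[ℂ] B) {t' : ℕ → B} :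
    ∀ (k : ℕ), (∀ i, i + 1 < k → φ (t i) = t' i) → φ (asym q t k) = asym q t' k
  | 0, _ => map_one φ
  | 1, _ => map_one φ
  | k + 2, h => by
    simp only [asym, map_smul, map_mul, map_sub, map_one,
      map_asym φ (k + 1) fun i hi => h i (by omega), h k (by omega)]

theorem asym_mem (S : Subalgebra ℂ A) : ∀ (k : ℕ), (∀ i, i + 1 < k → t i ∈ S) → asym q t k ∈ S
  | 0, _ => one_mem S
  | 1, _ => one_mem S
  | k + 2, h => by
    have ih := asym_mem S (k + 1) fun i hi => h i (by omega)
    exact S.smul_mem (mul_mem (mul_mem ih (sub_mem (S.smul_mem (one_mem S) _)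
      (S.smul_mem (h k (by omega)) _))) ih) _

theorem asym_commute {x : A} : ∀ (k : ℕ), (∀ i, i + 1 < k → Commute (t i) x) →
    Commute (asym q t k) x
  | 0, _ => Commute.one_left x
  | 1, _ => Commute.one_left x
  | k + 2, h => by
    have ih := asym_commute (k + 1) fun i hi => h i (by omega)
    exact ((ih.mul_left (((Commute.one_left x).smul_left _).sub_left
      ((h k (by omega)).smul_left _))).mul_left ih).smul_left _

/-- The alternating sum `∑ (-1) ^ i q ^ (k - i) t (k - 1) ⋯ t (k - i)`. -/
def stairs (q : ℂ) (t : ℕ → A) : ℕ → A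
  | 0 => 1
  | k + 1 => q ^ (k + 1) • 1 - t k * stairs q t k

theorem stairs_commute {x : A} : ∀ (k : ℕ), (∀ i, i < k → Commute (t i) x) →
    Commute (stairs q t k) x
  | 0, _ => Commute.one_left x
  | k + 1, h => ((Commute.one_left x).smul_left _).sub_left
      ((h k (by omega)).mul_left (stairs_commute k fun i hi => h i (by omega)))

/-- The eigenvalue $-q^{-1}$ cancels the alternating signs and leaves
$q^k+q^{k-2}+\dots+q^{-k}=(k+1)_q$. -/
theorem mul_stairs (hq : IsGeneric q) {a : A} : ∀ (k : ℕ),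
    (∀ i, i < k → a * t i = -q⁻¹ • a) → a * stairs q t k = qNum q (k + 1) • a
  | 0, _ => by rw [stairs, mul_one, qNum_one hq, one_smul]
  | k + 1, h => by
    rw [stairs, mul_sub, ← mul_assoc, h k (by omega), smul_mul_assoc,
      mul_stairs hq k fun i hi => h i (by omega), qNum_succ hq (k + 1), mul_smul_comm, mul_one,
      smul_smul, ← sub_smul]
    congr 1
    ring

/-- For `k > 0` the staircase is $q^k(q-t_k)$ plus a multiple of $t_kt_{k-1}$. The Hecke relation
kills the first part. Across $t_kt_{k-1}$ the factor $q^{-1}+t_k$ becomes $q^{-1}+t_{k-1}$, which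
`a` annihilates. -/
theorem IsHeckeFamily.mul_add_eq_zero (ht : IsHeckeFamily q n t) {k : ℕ} (hk : k + 1 < n) {a : A}
    (ha : ∀ i, i < k → a * t i = -q⁻¹ • a) :
    a * stairs q t (k + 1) * (q⁻¹ • 1 + t k) = 0 := by
  match k, hk, ha with
  | 0, hk, _ =>
    have : stairs q t 1 = q • 1 - t 0 := by simp [stairs]
    rw [this, mul_assoc, ht.hecke 0 hk, mul_zero]
  | k + 1, hk, ha =>
    have hc : Commute (stairs q t k) (q⁻¹ • 1 + t (k + 1)) :=
      ((Commute.one_right _).smul_right _).add_right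
        (stairs_commute k fun i hi => ht.comm i (k + 1) (by omega) hk)
    have e : stairs q t (k + 2) = q ^ (k + 1) • (q • 1 - t (k + 1)) +
        t (k + 1) * t k * stairs q t k := by
      rw [stairs, stairs, mul_sub, mul_smul_comm, mul_one, smul_sub, smul_smul, ← pow_succ]
      simp only [mul_assoc]
      abel
    have e2 : t (k + 1) * t k * (q⁻¹ • 1 + t (k + 1)) =
        (q⁻¹ • 1 + t k) * (t (k + 1) * t k) := by
      rw [mul_add, add_mul, mul_smul_comm, mul_one, smul_mul_assoc, one_mul,
        ← ht.braid k hk, mul_assoc (t k)]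
    rw [mul_assoc, e, add_mul, mul_add, smul_mul_assoc, ht.hecke _ hk, smul_zero, mul_zero,
      zero_add, mul_assoc (t (k + 1) * t k), hc.eq, ← mul_assoc (t (k + 1) * t k), e2,
      ← mul_assoc, ← mul_assoc, mul_add, ha k (by omega), mul_smul_comm, mul_one, neg_smul,
      add_neg_cancel, zero_mul, zero_mul]

theorem smul_right_cancel_qNum (hq : IsGeneric q) {k : ℕ} (hk : 1 ≤ k) {x y : A}
    (h : qNum q k • x = qNum q k • y) : x = y := by
  have h' := congrArg (fun z => (qNum q k)⁻¹ • z) h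
  simpa only [smul_smul, inv_mul_cancel₀ (qNum_ne_zero hq hk), one_smul] using h'

/-- The four properties need each other: the factorization through the staircase yields the
eigenvalue $-q^{-1}$ of the last generator, and evaluating the staircase on that eigenvector yields
idempotency, which the next factorization uses. -/
theorem IsHeckeFamily.asym_spec (hq : IsGeneric q) (ht : IsHeckeFamily q n t) :
    ∀ (k : ℕ), k + 1 ≤ n →
      qNum q (k + 1) • asym q t (k + 1) = asym q t k * stairs q t k ∧
      asym q t (k + 1) * asym q t k = asym q t (k + 1) ∧
      asym q t (k + 1) * asym q t (k + 1) = asym q t (k + 1) ∧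
      ∀ i, i < k → asym q t (k + 1) * t i = -q⁻¹ • asym q t (k + 1)
  | 0, _ => by
    refine ⟨?_, ?_, ?_, fun i hi => by omega⟩ <;> simp [asym, stairs, qNum_one hq]
  | k + 1, hk => by
    obtain ⟨h1, h2, h3, h4⟩ := ht.asym_spec hq k (by omega)
    have hs := asym_succ (t := t) hq k
    have hc : Commute (asym q t k) (t k) :=
      asym_commute k fun i hi => ht.comm i k (by omega) (by omega)
    have g1 : qNum q (k + 2) • asym q t (k + 2) = asym q t (k + 1) * stairs q t (k + 1) := by
      -- The right-hand projector is factored through the staircase; the smaller projector this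
      -- exposes commutes with `t k` and is absorbed on the left.
      have : asym q t (k + 1) * (qNum q (k + 1) • t k) * asym q t (k + 1) =
          asym q t (k + 1) * t k * stairs q t k := by
        rw [mul_smul_comm, smul_mul_assoc, ← mul_smul_comm, h1, mul_assoc, ← mul_assoc (t k),
          ← hc.eq, ← mul_assoc, ← mul_assoc, h2]
      rw [hs, mul_sub, sub_mul, this, mul_smul_comm, mul_one, smul_mul_assoc, h3, stairs, mul_sub,
        mul_smul_comm, mul_one, mul_assoc]
    have g2 : asym q t (k + 2) * asym q t (k + 1) = asym q t (k + 2) := by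
      rw [asym, smul_mul_assoc, mul_assoc, h3]
    have g4 : ∀ i, i < k + 1 → asym q t (k + 2) * t i = -q⁻¹ • asym q t (k + 2) := by
      intro i hi
      rcases Nat.lt_or_ge i k with h | h
      · rw [← g2, mul_assoc, h4 i h, mul_smul_comm]
      · obtain rfl : i = k := by omega
        have := ht.mul_add_eq_zero (k := i) (by omega) h4
        rw [← g1, smul_mul_assoc] at this
        have h0 := smul_right_cancel_qNum hq (by omega) (this.trans (smul_zero _).symm)
        rw [mul_add, mul_smul_comm, mul_one, add_comm] at h0
        rw [eq_neg_of_add_eq_zero_left h0, neg_smul]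
    refine ⟨g1, g2, ?_, g4⟩
    refine smul_right_cancel_qNum hq (k := k + 2) (by omega) ?_
    rw [← mul_smul_comm, g1, ← mul_assoc, g2, mul_stairs hq _ g4]
    exact g1

theorem IsHeckeFamily.asym_mul_self (hq : IsGeneric q) (ht : IsHeckeFamily q n t) :
    ∀ {k : ℕ}, k ≤ n → asym q t k * asym q t k = asym q t k
  | 0, _ => one_mul 1
  | k + 1, hk => (ht.asym_spec hq k hk).2.2.1

theorem IsHeckeFamily.asym_mul (hq : IsGeneric q) (ht : IsHeckeFamily q n t) {k i : ℕ}
    (hk : k ≤ n) (hi : i + 1 < k) : asym q t k * t i = -q⁻¹ • asym q t k := by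
  obtain ⟨k, rfl⟩ : ∃ l, k = l + 1 := ⟨k - 1, by omega⟩
  exact (ht.asym_spec hq k hk).2.2.2 i (by omega)

/-! ### Descending products and the Newton recursion. -/

/-- The descending product `t (j + m - 1) ⋯ t j`. -/
def desc {A : Type*} [Ring A] (t : ℕ → A) (j : ℕ) : ℕ → A
  | 0 => 1
  | m + 1 => t (j + m) * desc t j m

theorem desc_succ' {A : Type*} [Ring A] {t : ℕ → A} (j : ℕ) :
    ∀ m, desc t j (m + 1) = desc t (j + 1) m * t j
  | 0 => by simp [desc]
  | m + 1 => by
    rw [desc, desc_succ' j m, desc, ← mul_assoc]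
    congr 3
    omega

theorem desc_eq_prod {A : Type*} [Ring A] {t : ℕ → A} :
    ∀ m, ((List.range m).reverse.map t).prod = desc t 0 m
  | 0 => rfl
  | m + 1 => by
    rw [List.range_succ, List.reverse_append, List.map_append, List.prod_append, desc_eq_prod m,
      desc]
    simp

theorem desc_mem (S : Subalgebra ℂ A) (j : ℕ) : ∀ m, (∀ i, j ≤ i → i < j + m → t i ∈ S) →
    desc t j m ∈ S
  | 0, _ => one_mem S
  | m + 1, h => mul_mem (h _ (by omega) (by omega))
      (desc_mem S j m fun i h1 h2 => h i h1 (by omega))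

theorem map_desc {B : Type*} [Ring B] [Algebra ℂ B] (φ : A →ₐ[ℂ] B) {t' : ℕ → B} (j : ℕ) :
    ∀ m, (∀ i, j ≤ i → i < j + m → φ (t i) = t' i) → φ (desc t j m) = desc t' j m
  | 0, _ => map_one φ
  | m + 1, h => by
    rw [desc, map_mul, h _ (by omega) (by omega), map_desc φ j m fun i h1 h2 => h i h1 (by omega),
      desc]

theorem desc_commute {A : Type*} [Ring A] {t : ℕ → A} {x : A} (j : ℕ) :
    ∀ m, (∀ i, j ≤ i → i < j + m → Commute (t i) x) →
    Commute (desc t j m) x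
  | 0, _ => Commute.one_left x
  | m + 1, h => (h _ (by omega) (by omega)).mul_left
      (desc_commute j m fun i h1 h2 => h i h1 (by omega))

/-- The Newton recursion for cyclic functionals. -/
theorem newton_recursion {V : Type*} [AddCommGroup V] [Module ℂ V] (φ : A →ₗ[ℂ] V)
    (hq : IsGeneric q) (ht : IsHeckeFamily q n t)
    (hφ : ∀ k x, k ≤ n → φ (x * asym q t k) = φ (asym q t k * x)) {r : ℂ} {s : ℕ → A}
    (hs : ∀ k i, k ≤ i → i + 1 < n → Commute (asym q t k) (s i))
    (hr : ∀ k, k + 2 ≤ n → qNum q (k + 2) • asym q t (k + 2) =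
      asym q t (k + 1) * (r ^ (k + 1) • 1 - qNum q (k + 1) • s k) * asym q t (k + 1)) :
    ∀ j m, j + m + 1 = n → qNum q (j + 1) • φ (desc s j m * asym q t (j + 1)) =
      ∑ i ∈ Finset.range (j + 1), ((-1) ^ (j - i) * r ^ i) •
        φ (asym q t i * desc s i (n - 1 - i))
  | 0, m, hj => by
    have : n - 1 = m := by omega
    simp [qNum_one hq, asym, this]
  | j + 1, m, hj => by
    have ih := newton_recursion φ hq ht hφ hs hr j (m + 1) (by omega)
    have hc : Commute (desc s (j + 1) m) (asym q t (j + 1)) :=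
      desc_commute _ _ fun i h1 h2 => (hs _ _ h1 (by omega)).symm
    have hi := ht.asym_mul_self hq (k := j + 1) (by omega)
    -- The tail commutes with the projector, so cyclicity merges the two projectors and `s j` joins
    -- the tail: this is the quantity of the previous stage.
    have e1 : φ (desc s (j + 1) m * (asym q t (j + 1) * s j * asym q t (j + 1))) =
        φ (desc s j (m + 1) * asym q t (j + 1)) := by
      rw [desc_succ', ← mul_assoc, ← mul_assoc, hc.eq, hφ _ _ (by omega), mul_assoc,
        ← mul_assoc (asym q t (j + 1)), hi, mul_assoc,
        ← hφ _ _ (by omega), mul_assoc]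
    -- Without `s j`, projector and tail share no tensor factor in the application, and this term
    -- becomes $a_{j+1}$ times a power sum.
    have e2 : φ (desc s (j + 1) m * (asym q t (j + 1) * asym q t (j + 1))) =
        φ (asym q t (j + 1) * desc s (j + 1) (n - 1 - (j + 1))) := by
      rw [hi, hc.eq, show n - 1 - (j + 1) = m by omega]
    rw [Finset.sum_range_succ, ← map_smul, ← mul_smul_comm, hr j (by omega), mul_sub, sub_mul,
      mul_sub, map_sub, mul_smul_comm, mul_one, smul_mul_assoc, mul_smul_comm, map_smul, e2,
      mul_smul_comm (qNum q (j + 1)), smul_mul_assoc, mul_smul_comm, map_smul, e1, ih, Nat.sub_self,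
      pow_zero, one_mul, sub_eq_neg_add, ← Finset.sum_neg_distrib]
    congr 1
    refine Finset.sum_congr rfl fun i hi => ?_
    rw [← neg_smul, Nat.succ_sub (by have := Finset.mem_range.1 hi; omega), pow_succ]
    congr 1
    ring

/-- Replacing the generators in a descending product one by one. -/
theorem desc_telescope {s : ℕ → A} {c : ℂ} : ∀ (m : ℕ),
    (∀ i, i < m → t i = s i + c • 1) →
    desc t 0 m = desc s 0 m + c • ∑ i ∈ Finset.range m, desc s (i + 1) (m - 1 - i) * desc t 0 i
  | 0, _ => by simp [desc]
  | m + 1, h => by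
    have ih := desc_telescope m fun i hi => h i (by omega)
    have e : ∀ i ∈ Finset.range m, desc s (i + 1) (m - i) * desc t 0 i =
        s m * (desc s (i + 1) (m - 1 - i) * desc t 0 i) := by
      intro i hi
      have hi := Finset.mem_range.1 hi
      rw [show m - i = (m - 1 - i) + 1 by omega, desc, mul_assoc,
        show i + 1 + (m - 1 - i) = m by omega]
    rw [Finset.sum_range_succ, Nat.add_sub_cancel, Finset.sum_congr rfl e, ← Finset.mul_sum,
      Nat.sub_self]
    have e1 : desc t 0 (m + 1) = s m * desc t 0 m + c • desc t 0 m := by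
      rw [desc, Nat.zero_add, h m (by omega), add_mul, smul_mul_assoc, one_mul]
    have e2 : desc s (m + 1) 0 = 1 := rfl
    have e0 : desc s 0 (m + 1) = s m * desc s 0 m := by rw [desc, Nat.zero_add]
    rw [e1, e2, smul_add, ← add_assoc, e0, one_mul, ← mul_smul_comm, ← mul_add, ← ih]

end Family

/-! ### The algebra generated by a family of generators -/

section GenAlg

variable {A : Type*} [Ring A] [Algebra ℂ A] {q : ℂ} {n : ℕ} {t : ℕ → A}

/-- The subalgebra generated by `t 0, …, t (j - 2)`. -/
def genAlg (t : ℕ → A) (j : ℕ) : Subalgebra ℂ A :=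
  Algebra.adjoin ℂ {x | ∃ i, i + 1 < j ∧ x = t i}

theorem mem_genAlg {i j : ℕ} (h : i + 1 < j) : t i ∈ genAlg t j :=
  Algebra.subset_adjoin ⟨i, h, rfl⟩

theorem genAlg_mono {j k : ℕ} (h : j ≤ k) : genAlg t j ≤ genAlg t k :=
  Algebra.adjoin_mono fun _ ⟨i, hi, hx⟩ => ⟨i, hi.trans_le h, hx⟩

theorem exists_smul_one_of_mem_genAlg_one {x : A} (hx : x ∈ genAlg t 1) : ∃ c : ℂ, x = c • 1 := by
  have : {x : A | ∃ i, i + 1 < 1 ∧ x = t i} = ∅ := by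
    ext x
    simp
  rw [genAlg, this, Algebra.adjoin_empty, Algebra.mem_bot] at hx
  obtain ⟨c, rfl⟩ := hx
  exact ⟨c, Algebra.algebraMap_eq_smul_one c⟩

/-- The products `u * t k * v` with `u` and `v` in the algebra generated by `t 0, …, t (k - 1)`. -/
def bimod (t : ℕ → A) (k : ℕ) : Set A :=
  {x | ∃ u ∈ genAlg t (k + 1), ∃ v ∈ genAlg t (k + 1), x = u * t k * v}

theorem IsHeckeFamily.mul_self (hq : IsGeneric q) (ht : IsHeckeFamily q n t) {k : ℕ}
    (hk : k + 1 < n) : t k * t k = (q - q⁻¹) • t k + 1 := by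
  have h := mul_sub_eq_one_of_hecke hq.1 (t k) (ht.hecke k hk)
  rw [mul_sub, mul_smul_comm, mul_one, sub_eq_iff_eq_add] at h
  rw [h, add_comm]

theorem IsHeckeFamily.genAlg_commute (ht : IsHeckeFamily q n t) {k : ℕ} (hk : k + 1 < n) {x : A}
    (hx : x ∈ genAlg t k) : Commute x (t k) := by
  refine (Algebra.commute_of_mem_adjoin_of_forall_mem_commute hx ?_).symm
  rintro _ ⟨i, hi, rfl⟩
  exact (ht.comm i k (by omega) hk).symm

/-- Every element of the algebra generated by `t 0, …, t k` is a combination of elements that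
contain the last generator `t k` at most once. -/
theorem IsHeckeFamily.genAlg_le (hq : IsGeneric q) (ht : IsHeckeFamily q n t) : ∀ (k : ℕ),
    k + 2 ≤ n → Subalgebra.toSubmodule (genAlg t (k + 2)) ≤
      Subalgebra.toSubmodule (genAlg t (k + 1)) ⊔ Submodule.span ℂ (bimod t k) := by
  intro k hk
  set M := Subalgebra.toSubmodule (genAlg t (k + 1)) ⊔ Submodule.span ℂ (bimod t k) with hM
  have hS : ∀ {x}, x ∈ genAlg t (k + 1) → x ∈ M := fun hx => Submodule.mem_sup_left hx
  have hB : ∀ {u v}, u ∈ genAlg t (k + 1) → v ∈ genAlg t (k + 1) → u * t k * v ∈ M :=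
    fun hu hv => Submodule.mem_sup_right (Submodule.subset_span ⟨_, hu, _, hv, rfl⟩)
  have hsq : ∀ {u v}, u ∈ genAlg t (k + 1) → v ∈ genAlg t (k + 1) → u * (t k * t k) * v ∈ M := by
    intro u v hu hv
    rw [ht.mul_self hq (by omega), mul_add, add_mul, mul_smul_comm, smul_mul_assoc, mul_one]
    exact add_mem (M.smul_mem _ (hB hu hv)) (hS (mul_mem hu hv))
  -- By induction the middle element contains the previous generator at most once. If not at all, it
  -- commutes with `t k` and the quadratic relation applies; if once, the braid relation leaves a
  -- single `t k`.
  have hmid : ∀ {u v}, u ∈ genAlg t (k + 1) → v ∈ genAlg t (k + 1) → u * t k * v * t k ∈ M := by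
    intro u v hu hv
    match k, hk with
    | 0, hk =>
      obtain ⟨c, rfl⟩ := exists_smul_one_of_mem_genAlg_one hv
      have := hsq hu (one_mem _)
      rw [mul_smul_comm, mul_one, smul_mul_assoc, mul_assoc]
      rw [mul_one] at this
      exact M.smul_mem _ this
    | k + 1, hk =>
      have hv' := ht.genAlg_le hq k (by omega) hv
      obtain ⟨s, hs, w, hw, rfl⟩ := Submodule.mem_sup.1 hv'
      have hs' : s ∈ genAlg t (k + 1) := hs
      rw [mul_add, add_mul]
      refine add_mem ?_ ?_
      · have := hsq (mul_mem hu (genAlg_mono (by omega) hs')) (one_mem _)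
        have hc := ht.genAlg_commute (by omega) hs'
        rw [mul_one, mul_assoc u, ← mul_assoc s, hc.eq] at this
        simpa only [mul_assoc, hc.eq] using this
      · clear hv hv'
        induction hw using Submodule.span_induction with
        | mem x hx =>
          obtain ⟨a, ha, b, hb, rfl⟩ := hx
          have ca : a * t (k + 1) = t (k + 1) * a := (ht.genAlg_commute (by omega) ha).eq
          have cb : b * t (k + 1) = t (k + 1) * b := (ht.genAlg_commute (by omega) hb).eq
          have hbr := ht.braid k (by omega)
          have e : u * t (k + 1) * (a * t k * b) * t (k + 1) =
              u * a * t k * t (k + 1) * (t k * b) := by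
            calc _ = u * (t (k + 1) * a) * t k * (b * t (k + 1)) := by simp only [mul_assoc]
              _ = u * a * (t (k + 1) * t k * t (k + 1)) * b := by
                rw [← ca, cb]; simp only [mul_assoc]
              _ = _ := by rw [← hbr]; simp only [mul_assoc]
          rw [e]
          exact hB (mul_mem (mul_mem hu (genAlg_mono (by omega) ha)) (mem_genAlg (by omega)))
            (mul_mem (mem_genAlg (by omega)) (genAlg_mono (by omega) hb))
        | zero => simp
        | add x y hx hy ihx ihy =>
          rw [mul_add, add_mul]
          exact add_mem ihx ihy
        | smul c x hx ih =>
          rw [mul_smul_comm, smul_mul_assoc]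
          exact M.smul_mem c ih
  -- `M` contains 1, so stability under right multiplication by the generators forces it to contain
  -- the whole algebra.
  have hgen : ∀ i, i + 1 < k + 2 → ∀ x ∈ M, x * t i ∈ M := by
    intro i hi x hx
    obtain ⟨s, hs, w, hw, rfl⟩ := Submodule.mem_sup.1 hx
    clear hx
    have hs' : s ∈ genAlg t (k + 1) := hs
    rw [add_mul]
    refine add_mem ?_ ?_
    · rcases Nat.lt_or_ge i k with h | h
      · exact hS (mul_mem hs' (mem_genAlg (by omega)))
      · obtain rfl : i = k := by omega
        simpa using hB hs' (one_mem _)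
    · induction hw using Submodule.span_induction with
      | mem x hx =>
        obtain ⟨u, hu, v, hv, rfl⟩ := hx
        rcases Nat.lt_or_ge i k with h | h
        · rw [mul_assoc]
          exact hB hu (mul_mem hv (mem_genAlg (by omega)))
        · obtain rfl : i = k := by omega
          exact hmid hu hv
      | zero => simp
      | add x y _ _ ihx ihy =>
        rw [add_mul]
        exact add_mem ihx ihy
      | smul c x _ ih =>
        rw [smul_mul_assoc]
        exact M.smul_mem c ih
  have hall : ∀ y ∈ genAlg t (k + 2), ∀ x ∈ M, x * y ∈ M := by
    intro y hy
    induction hy using Algebra.adjoin_induction with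
    | mem y hy =>
      obtain ⟨i, hi, rfl⟩ := hy
      exact hgen i hi
    | algebraMap c =>
      intro x hx
      rw [Algebra.algebraMap_eq_smul_one, mul_smul_comm, mul_one]
      exact M.smul_mem c hx
    | add y z _ _ hy hz =>
      intro x hx
      rw [mul_add]
      exact add_mem (hy x hx) (hz x hx)
    | mul y z _ _ hy hz =>
      intro x hx
      rw [← mul_assoc]
      exact hz _ (hy x hx)
  intro y hy
  have := hall y hy 1 (hS (one_mem _))
  rwa [one_mul] at this

end GenAlg

/-! ### The Newton identities -/

section Newton

variable {N n : ℕ} {q : ℂ} {R Ψ A : Matrix (Fin N × Fin N) (Fin N × Fin N) ℂ}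

theorem site2_isHeckeFamily (hR : IsHeckeSymmetry q R) (n : ℕ) :
    IsHeckeFamily q n (site2 n R) where
  hecke i h := site2_hecke hR n i h
  braid i h := site2_braid hR n i h
  comm i j h _ := site2_comm R n i j h

theorem site2_inv_eq (hR : IsHeckeSymmetry q R) {i : ℕ} (h : i + 1 < n) :
    site2 n R⁻¹ i = site2 n R i - (q - q⁻¹) • 1 := by
  have e := mul_sub_eq_one_of_hecke hR.ne_zero _ (site2_hecke hR n i h)
  calc site2 n R⁻¹ i = site2 n R⁻¹ i * (site2 n R i * (site2 n R i - (q - q⁻¹) • 1)) := by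
        rw [e, mul_one]
    _ = _ := by rw [← mul_assoc, site2_inv_mul hR, one_mul]

theorem heckeRange_eq_genAlg (n j : ℕ) : heckeRange R n 0 j = genAlg (site2 n R) j := by
  simp [heckeRange, genAlg]

theorem rho_tau (hR : IsHeckeSymmetry q R) (n i : ℕ) :
    rho hR n (tau q n i) = site2 n R i := by
  by_cases h : i < n - 1
  · rw [tau, dif_pos h]
    exact (RingQuot.liftAlgHom_mkAlgHom_apply ..).trans (FreeAlgebra.lift_ι_apply _ _)
  · rw [tau, dif_neg h, map_one, site2, dif_neg (by omega)]

theorem rho_tauInv (hR : IsHeckeSymmetry q R) (n i : ℕ) :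
    rho hR n (tauInv q n i) = site2 n R⁻¹ i := by
  by_cases h : i < n - 1
  · rw [tauInv, if_pos h, map_sub, map_smul, map_one, rho_tau, site2_inv_eq hR (by omega)]
  · rw [tauInv, if_neg h, map_one, site2, dif_neg (by omega)]

theorem antisymmetrizer_eq_asym (q : ℂ) (n : ℕ) :
    ∀ k, antisymmetrizer q n k = asym q (tau q n) k
  | 0 => rfl
  | 1 => rfl
  | k + 2 => by rw [antisymmetrizer, asym, antisymmetrizer_eq_asym q n (k + 1)]

theorem elemSymm_eq (hR : IsHeckeSymmetry q R) (n : ℕ) :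
    elemSymm hR Ψ n = chLin R Ψ n (asym q (site2 n R) n) := by
  rw [elemSymm, ch_eq_chLin, antisymmetrizer_eq_asym,
    map_asym (rho hR n) n fun i _ => rho_tau hR n i]

variable (R Ψ) in
/-- The power sum of the descending product of the matrices `A`. -/
def power (A : Matrix (Fin N × Fin N) (Fin N × Fin N) ℂ) (n : ℕ) : REAlgebra R :=
  chLin R Ψ n (desc (site2 n A) 0 (n - 1))

theorem powerSum_eq (hR : IsHeckeSymmetry q R) (n : ℕ) :
    powerSum hR Ψ n = power R Ψ R n := by
  rw [powerSum, ch_eq_chLin, desc_eq_prod, map_desc (rho hR n) 0 _ fun i _ _ => rho_tau hR n i,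
    power]

theorem powerSum'_eq (hR : IsHeckeSymmetry q R) (n : ℕ) :
    powerSum' hR Ψ n = power R Ψ R⁻¹ n := by
  rw [powerSum', ch_eq_chLin, desc_eq_prod,
    map_desc (rho hR n) 0 _ fun i _ _ => rho_tauInv hR n i, power]

/-- Placing a matrix at the first `j` of `n` tensor factors, as a homomorphism of algebras. -/
def placeHom (N : ℕ) {j n : ℕ} (h : j ≤ n) :
    Matrix (Fin j → Fin N) (Fin j → Fin N) ℂ →ₐ[ℂ] Matrix (Fin n → Fin N) (Fin n → Fin N) ℂ where
  toFun := place (Fin.castLE h)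
  map_one' := place_one _
  map_mul' := place_mul _ (Fin.castLE_injective h)
  map_zero' := by simpa using place_smul (Fin.castLE h) (0 : ℂ) (0 : Matrix _ (Fin j → Fin N) ℂ)
  map_add' := place_add _
  commutes' c := by
    rw [Algebra.algebraMap_eq_smul_one, Algebra.algebraMap_eq_smul_one, place_smul, place_one]

theorem placeHom_site2 {j n : ℕ} (h : j ≤ n) (A : Matrix (Fin N × Fin N) (Fin N × Fin N) ℂ) {i : ℕ}
    (hi : i + 1 < j) : placeHom N h (site2 j A i) = site2 n A i :=
  place_castLE_site2 A h hi

theorem map_genAlg_placeHom {j n : ℕ} (h : j ≤ n) :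
    (genAlg (site2 j R) j).map (placeHom N h) = genAlg (site2 n R) j := by
  rw [genAlg, AlgHom.map_adjoin, genAlg]
  congr 1
  ext x
  constructor
  · rintro ⟨_, ⟨i, hi, rfl⟩, rfl⟩
    exact ⟨i, hi, placeHom_site2 h R hi⟩
  · rintro ⟨i, hi, rfl⟩
    exact ⟨_, ⟨i, hi, rfl⟩, placeHom_site2 h R hi⟩

/-- The matrix `A`, which is `R` or its inverse in the applications, is compatible with `shift`. -/
structure IsShiftable (R A : Matrix (Fin N × Fin N) (Fin N × Fin N) ℂ) : Prop where
  mem : ∀ n i, i + 1 < n → site2 n A i ∈ heckeRange R n i (i + 2)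
  shift : ∀ n i, i + 1 < n →
    shift R (up (REAlgebra R) (site2 n A i)) = up (REAlgebra R) (site2 (n + 1) A (i + 1))

theorem isShiftable_self (hR : IsHeckeSymmetry q R) : IsShiftable R R where
  mem _ _ _ := site2_mem_heckeRange le_rfl (by omega)
  shift _ _ h := shift_site2 hR h

theorem isShiftable_inv (hR : IsHeckeSymmetry q R) : IsShiftable R R⁻¹ where
  mem n i h := by
    rw [site2_inv_eq hR h]
    exact sub_mem (site2_mem_heckeRange le_rfl (by omega)) (Subalgebra.smul_mem _ (one_mem _) _)
  shift _ _ h := shift_site2_inv hR h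

theorem IsShiftable.shiftN_site2 (hA : IsShiftable R A) {i : ℕ} (h : i + 1 < n) :
    ∀ j, shiftN R j (up (REAlgebra R) (site2 n A i)) = up (REAlgebra R) (site2 (n + j) A (i + j))
  | 0 => rfl
  | j + 1 => by
    rw [shiftN, hA.shiftN_site2 h j]
    exact hA.shift (n + j) (i + j) (by omega)

theorem IsShiftable.shiftN_desc (hR : IsHeckeSymmetry q R) (hA : IsShiftable R A) (j : ℕ) :
    ∀ m, m + 1 ≤ n → shiftN R j (up (REAlgebra R) (desc (site2 n A) 0 m)) =
      up (REAlgebra R) (desc (site2 (n + j) A) j m)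
  | 0, _ => by rw [desc, desc, up_one, up_one, shiftN_one hR]
  | m + 1, h => by
    rw [desc, desc, up_mul, up_mul, shiftN_mul hR, hA.shiftN_desc hR j m (by omega),
      hA.shiftN_site2 (by omega), Nat.zero_add, Nat.add_comm m j]

theorem IsShiftable.desc_mem (hA : IsShiftable R A) {j m : ℕ} (h : j + m + 1 ≤ n) :
    desc (site2 n A) j m ∈ heckeRange R n j n :=
  RE.desc_mem _ j m fun i h1 h2 =>
    heckeRange_mono h1 (by omega) (hA.mem n i (by omega))

theorem IsShiftable.chLin_place_mul_desc (hR : IsHeckeSymmetry q R) (hΨ : IsSkewInverse R Ψ)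
    (hA : IsShiftable R A) {j n : ℕ} (h : j < n) (X : Matrix (Fin j → Fin N) (Fin j → Fin N) ℂ) :
    chLin R Ψ n (placeHom N h.le X * desc (site2 n A) j (n - 1 - j)) =
      chLin R Ψ j X * power R Ψ A (n - j) := by
  obtain ⟨k, rfl⟩ : ∃ k, n = k + j := ⟨n - j, by omega⟩
  rw [show k + j - j = k by omega, show k + j - 1 - j = k - 1 by omega]
  exact chLin_place_mul hR hΨ j X (hA.desc_mem (by omega)) (hA.shiftN_desc hR j (k - 1) (by omega))

/-- The projector lives in the first `j` tensor factors and the descending product in the remaining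
ones, so multiplicativity applies. -/
theorem elemSymm_mul_power (hR : IsHeckeSymmetry q R) (hΨ : IsSkewInverse R Ψ)
    (hA : IsShiftable R A) {j n : ℕ} (h : j < n) :
    chLin R Ψ n (asym q (site2 n R) j * desc (site2 n A) j (n - 1 - j)) =
      elemSymm hR Ψ j * power R Ψ A (n - j) := by
  rw [elemSymm_eq, ← hA.chLin_place_mul_desc hR hΨ h,
    map_asym (placeHom N h.le) j fun i hi => placeHom_site2 h.le R hi]

theorem elemSymm_zero (hR : IsHeckeSymmetry q R) : elemSymm hR Ψ 0 = 1 := by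
  rw [elemSymm_eq, chLin_apply, asym, up_one, one_mul]
  have : prodL R 0 = 1 := rfl
  rw [this, rTrace_eq_sum]
  simp

/-- A common form of both identities: the pair `A`, `r` is specialized to $R$, $q$ and to $R^{-1}$,
$q^{-1}$. -/
theorem newton_identity (hq : IsGeneric q) (hR : IsHeckeSymmetry q R) (hΨ : IsSkewInverse R Ψ)
    (hA : IsShiftable R A) {r : ℂ}
    (hr : ∀ n k, k + 2 ≤ n → qNum q (k + 2) • asym q (site2 n R) (k + 2) =
      asym q (site2 n R) (k + 1) * (r ^ (k + 1) • 1 - qNum q (k + 1) • site2 n A k) *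
        asym q (site2 n R) (k + 1)) {n : ℕ} (hn : 1 ≤ n) :
    qNum q n • elemSymm hR Ψ n = ∑ i ∈ Finset.range n, ((-1) ^ (n - 1 - i) * r ^ i) •
      (elemSymm hR Ψ i * power R Ψ A (n - i)) := by
  have ht := site2_isHeckeFamily hR n
  have hmem : ∀ k, asym q (site2 n R) k ∈ heckeRange R n 0 k := fun k =>
    asym_mem _ k fun i hi => site2_mem_heckeRange (Nat.zero_le i) hi
  -- At the last stage of the recursion the tail is empty, and the left side is $n_qa_n$.
  have h := newton_recursion (chLin R Ψ n) hq ht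
    (fun k x _ => chLin_mul_comm hR hΨ x (hmem k))
    (fun k i hk hi => commute_heckeRange hk (hmem k) (hA.mem n i hi)) (hr n) (n - 1) 0 (by omega)
  rw [desc, one_mul, Nat.sub_add_cancel hn, ← elemSymm_eq hR] at h
  rw [h]
  refine Finset.sum_congr rfl fun i hi => ?_
  rw [elemSymm_mul_power hR hΨ hA (Finset.mem_range.1 hi)]

theorem newton_first (hq : IsGeneric q) (hR : IsHeckeSymmetry q R) (hΨ : IsSkewInverse R Ψ)
    {n : ℕ} (hn : 1 ≤ n) :
    qNum q n • elemSymm hR Ψ n = ∑ i ∈ Finset.range n, ((-1) ^ (n - 1 - i) * q ^ i) •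
      (elemSymm hR Ψ i * powerSum hR Ψ (n - i)) := by
  simp only [powerSum_eq]
  exact newton_identity hq hR hΨ (isShiftable_self hR) (fun n k _ => asym_succ hq k) hn

theorem newton_second (hq : IsGeneric q) (hR : IsHeckeSymmetry q R) (hΨ : IsSkewInverse R Ψ)
    {n : ℕ} (hn : 1 ≤ n) :
    qNum q n • elemSymm hR Ψ n = ∑ i ∈ Finset.range n, ((-1) ^ (n - 1 - i) * q⁻¹ ^ i) •
      (elemSymm hR Ψ i * powerSum' hR Ψ (n - i)) := by
  simp only [powerSum'_eq]
  refine newton_identity hq hR hΨ (isShiftable_inv hR) (fun n k hk => ?_) hn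
  rw [asym_succ hq k, site2_inv_eq hR (by omega), ← sub_mul_qNum hq (k + 1), smul_sub, smul_smul,
    sub_smul]
  congr 2
  abel

theorem add_sum_Icc_eq_zero {V : Type*} [AddCommGroup V] [Module ℂ V] {r : ℂ} {n : ℕ}
    (f : ℕ → ℕ → V) {x : V}
    (h : x = ∑ i ∈ Finset.range n, ((-1 : ℂ) ^ (n - 1 - i) * r ^ i) • f i (n - i)) :
    x + ∑ k ∈ Finset.Icc 1 n, ((-1 : ℂ) ^ k * r ^ ((n : ℤ) - (k : ℤ))) • f (n - k) k = 0 := by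
  rw [h, add_eq_zero_iff_eq_neg, ← Finset.sum_neg_distrib]
  refine Finset.sum_bij' (fun i _ => n - i) (fun k _ => n - k) ?_ ?_ ?_ ?_ ?_
  · intro i hi
    have := Finset.mem_range.1 hi
    exact Finset.mem_Icc.2 (by omega)
  · intro k hk
    have := Finset.mem_Icc.1 hk
    exact Finset.mem_range.2 (by omega)
  · intro i hi
    have := Finset.mem_range.1 hi
    omega
  · intro k hk
    have := Finset.mem_Icc.1 hk
    omega
  · intro i hi
    have hi := Finset.mem_range.1 hi
    have e1 : (n : ℤ) - ((n - i : ℕ) : ℤ) = (i : ℕ) := by omega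
    have e2 : n - i = (n - 1 - i) + 1 := by omega
    rw [e1, zpow_natCast, ← neg_smul, show n - (n - i) = i by omega]
    congr 1
    rw [e2, pow_succ]
    ring

/-- The relation of the two kinds of power sums. -/
theorem powerSum_eq_add_sum (hR : IsHeckeSymmetry q R) (hΨ : IsSkewInverse R Ψ)
    {n : ℕ} (hn : 1 ≤ n) :
    powerSum hR Ψ n = powerSum' hR Ψ n + (q - q⁻¹) • ∑ k ∈ Finset.Icc 1 (n - 1),
      powerSum hR Ψ (n - k) * powerSum' hR Ψ k := by
  have hA := isShiftable_inv hR
  have h := congrArg (chLin R Ψ n) (desc_telescope (t := site2 n R) (s := site2 n R⁻¹)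
    (c := q - q⁻¹) (n - 1) fun i hi => by rw [site2_inv_eq hR (by omega), sub_add_cancel])
  rw [map_add, map_smul, map_sum] at h
  simp only [powerSum_eq, powerSum'_eq]
  rw [power, h, power]
  congr 2
  refine Finset.sum_bij' (fun i _ => n - 1 - i) (fun k _ => n - 1 - k) ?_ ?_ ?_ ?_ ?_
  · intro i hi
    have := Finset.mem_range.1 hi
    exact Finset.mem_Icc.2 (by omega)
  · intro k hk
    have := Finset.mem_Icc.1 hk
    exact Finset.mem_range.2 (by omega)
  · intro i hi
    have := Finset.mem_range.1 hi
    omega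
  · intro k hk
    have := Finset.mem_Icc.1 hk
    omega
  · intro i hi
    have hi := Finset.mem_range.1 hi
    have hX : placeHom N (show i + 1 ≤ n by omega) (desc (site2 (i + 1) R) 0 i) =
        desc (site2 n R) 0 i :=
      map_desc _ 0 i fun l _ hl => placeHom_site2 _ R (by omega)
    -- Telescoping omits the generator of index `i`, so the two blocks act in disjoint factors;
    -- exchanging them puts $p_{i+1}$ to the left of $t_{n-1-i}$.
    have hc : Commute (desc (site2 n R) 0 i) (desc (site2 n R⁻¹) (i + 1) (n - 1 - 1 - i)) :=
      commute_heckeRange (b := i + 1) le_rfl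
        (RE.desc_mem _ 0 i fun l _ hl => site2_mem_heckeRange (Nat.zero_le l) (by omega))
        (hA.desc_mem (by omega))
    have := hA.chLin_place_mul_desc hR hΨ (show i + 1 < n by omega) (desc (site2 (i + 1) R) 0 i)
    rw [hX, show n - 1 - (i + 1) = n - 1 - 1 - i by omega, hc.eq] at this
    rw [this, show n - (n - 1 - i) = i + 1 by omega, show n - (i + 1) = n - 1 - i by omega]
    rfl

end Newton

/-! ### The characteristic subalgebra -/

section Span

variable {N n : ℕ} {q : ℂ} {R Ψ : Matrix (Fin N × Fin N) (Fin N × Fin N) ℂ}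

/-- The image of the characteristic map is contained in the algebra generated by the power sums. -/
theorem chLin_mem_adjoin (hq : IsGeneric q) (hR : IsHeckeSymmetry q R) (hΨ : IsSkewInverse R Ψ) :
    ∀ (n : ℕ), 1 ≤ n → ∀ Z ∈ genAlg (site2 n R) n,
      chLin R Ψ n Z ∈ NonUnitalAlgebra.adjoin ℂ (powerSum hR Ψ '' Set.Ici 1) := by
  intro n
  induction n using Nat.strong_induction_on with
  | _ n IH =>
  intro hn
  set B := NonUnitalAlgebra.adjoin ℂ (powerSum hR Ψ '' Set.Ici 1) with hB
  have hp : ∀ k, 1 ≤ k → powerSum hR Ψ k ∈ B := fun k hk =>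
    NonUnitalAlgebra.subset_adjoin ℂ ⟨k, hk, rfl⟩
  have hA := isShiftable_self hR
  have ht := site2_isHeckeFamily hR n
  -- The tail starts at the generator of index `i`, just beyond those allowed in `x`. If `x` lacks
  -- its last possible generator, the value factors and the outer induction applies. If it contains
  -- it once, cyclicity moves the left cofactor around and that generator lengthens the tail. The
  -- full tail at `i = 0` gives $p_n$, the empty one at `i = n - 1` the claim.
  have key : ∀ i, i + 1 ≤ n → ∀ x ∈ genAlg (site2 n R) (i + 1),
      chLin R Ψ n (desc (site2 n R) i (n - 1 - i) * x) ∈ B := by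
    intro i
    induction i with
    | zero =>
      intro _ x hx
      obtain ⟨c, rfl⟩ := exists_smul_one_of_mem_genAlg_one hx
      rw [mul_smul_comm, mul_one, map_smul]
      refine B.smul_mem c ?_
      have := hp n hn
      rwa [powerSum_eq] at this
    | succ i ih =>
      intro hi x hx
      have ih := ih (by omega)
      obtain ⟨s, hs, w, hw, rfl⟩ := Submodule.mem_sup.1 (ht.genAlg_le hq i hi hx)
      clear hx
      rw [mul_add, map_add]
      refine add_mem ?_ ?_
      · have hs' : s ∈ (genAlg (site2 (i + 1) R) (i + 1)).map
            (placeHom N (show i + 1 ≤ n by omega)) := by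
          rw [map_genAlg_placeHom]; exact hs
        obtain ⟨s', hs2, rfl⟩ := Subalgebra.mem_map.1 hs'
        have hs : placeHom N (show i + 1 ≤ n by omega) s' ∈ genAlg (site2 n R) (i + 1) := hs
        rw [← heckeRange_eq_genAlg] at hs
        rw [chLin_mul_comm hR hΨ _ hs, hA.chLin_place_mul_desc hR hΨ (by omega)]
        refine mul_mem (IH (i + 1) (by omega) (by omega) s' hs2) ?_
        have := hp (n - (i + 1)) (by omega)
        rwa [powerSum_eq] at this
      · induction hw using Submodule.span_induction with
        | mem x hx =>
          obtain ⟨u, hu, v, hv, rfl⟩ := hx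
          have hu' := hu
          rw [← heckeRange_eq_genAlg] at hu'
          have hc : Commute u (desc (site2 n R) (i + 1) (n - 1 - (i + 1))) :=
            commute_heckeRange le_rfl hu' (hA.desc_mem (by omega))
          have e : desc (site2 n R) (i + 1) (n - 1 - (i + 1)) * (u * site2 n R i * v) =
              u * (desc (site2 n R) i (n - 1 - i) * v) := by
            rw [show n - 1 - i = (n - 1 - (i + 1)) + 1 by omega, desc_succ', ← mul_assoc,
              ← mul_assoc, ← hc.eq]
            simp only [mul_assoc]
          rw [e, ← chLin_mul_comm hR hΨ _ hu', mul_assoc]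
          exact ih _ (mul_mem hv hu)
        | zero => simp
        | add x y _ _ ihx ihy =>
          rw [mul_add, map_add]
          exact add_mem ihx ihy
        | smul c x _ ih' =>
          rw [mul_smul_comm, map_smul]
          exact B.smul_mem c ih'
  intro Z hZ
  have := key (n - 1) (by omega) Z (by rwa [Nat.sub_add_cancel hn])
  rwa [Nat.sub_self, desc, one_mul] at this

theorem rho_mem_genAlg (hR : IsHeckeSymmetry q R) (n : ℕ) (z : HeckeAlgebra q n) :
    rho hR n z ∈ genAlg (site2 n R) n := by
  obtain ⟨f, rfl⟩ := RingQuot.mkAlgHom_surjective ℂ (HeckeRel q n) z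
  have e : rho hR n (RingQuot.mkAlgHom ℂ (HeckeRel q n) f) =
      FreeAlgebra.lift ℂ (fun i : Fin (n - 1) => site2 n R i) f :=
    RingQuot.liftAlgHom_mkAlgHom_apply ..
  rw [e]
  clear e
  induction f using FreeAlgebra.induction with
  | grade0 c => rw [AlgHom.commutes]; exact Subalgebra.algebraMap_mem _ c
  | grade1 i =>
    rw [FreeAlgebra.lift_ι_apply]
    exact mem_genAlg (by omega)
  | mul a b ha hb =>
    rw [map_mul]
    exact mul_mem ha hb
  | add a b ha hb =>
    rw [map_add]
    exact add_mem ha hb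

theorem exists_rho_eq (hR : IsHeckeSymmetry q R) {Z : Matrix (Fin n → Fin N) (Fin n → Fin N) ℂ}
    (hZ : Z ∈ genAlg (site2 n R) n) : ∃ z, rho hR n z = Z := by
  have : genAlg (site2 n R) n ≤ (rho hR n).range := by
    refine Algebra.adjoin_le ?_
    rintro _ ⟨i, _, rfl⟩
    exact ⟨_, rho_tau hR n i⟩
  exact this hZ

/-- Besides the reduction to power sums, the point is that the span is closed under products: a
product of two values of `ch` is the value at one argument concatenated with the shift of the other.
-/
theorem characteristicSpace_eq_adjoin (hq : IsGeneric q) (hR : IsHeckeSymmetry q R)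
    (hΨ : IsSkewInverse R Ψ) :
    characteristicSpace hR Ψ =
      (NonUnitalAlgebra.adjoin ℂ (powerSum hR Ψ '' Set.Ici 1)).toSubmodule := by
  apply le_antisymm
  · refine Submodule.span_le.2 ?_
    rintro _ ⟨n, hn, z, rfl⟩
    exact chLin_mem_adjoin hq hR hΨ n hn _ (rho_mem_genAlg hR n z)
  · have hmul : ∀ x ∈ characteristicSpace hR Ψ, ∀ y ∈ characteristicSpace hR Ψ,
        x * y ∈ characteristicSpace hR Ψ := by
      intro x hx y hy
      have := Submodule.mul_mem_mul hx hy
      rw [characteristicSpace, Submodule.span_mul_span] at this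
      refine Submodule.span_le.2 ?_ this
      rintro _ ⟨_, ⟨j, hj, x, rfl⟩, _, ⟨n, hn, y, rfl⟩, rfl⟩
      have hy := rho_mem_genAlg hR n y
      have hx := rho_mem_genAlg hR j x
      rw [← heckeRange_eq_genAlg] at hy
      obtain ⟨Y, hY, hY'⟩ := exists_shiftN_eq hR j hy
      have e := chLin_place_mul hR hΨ j (rho hR j x) hY hY'
      have hX : placeHom N (Nat.le_add_left j n) (rho hR j x) ∈
          genAlg (site2 (n + j) R) (n + j) := by
        refine genAlg_mono (Nat.le_add_left j n) ?_
        rw [← map_genAlg_placeHom (Nat.le_add_left j n)]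
        exact ⟨_, hx, rfl⟩
      have hY2 := heckeRange_mono (Nat.zero_le j) le_rfl hY
      rw [heckeRange_eq_genAlg] at hY2
      obtain ⟨z, hz⟩ := exists_rho_eq hR (mul_mem hX hY2)
      refine Submodule.subset_span ⟨n + j, by omega, z, ?_⟩
      rw [ch_eq_chLin hR z, hz]
      exact e.symm
    intro x hx
    replace hx : x ∈ NonUnitalAlgebra.adjoin ℂ (powerSum hR Ψ '' Set.Ici 1) := hx
    induction hx using NonUnitalAlgebra.adjoin_induction with
    | mem x hx =>
      obtain ⟨n, hn, rfl⟩ := hx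
      exact Submodule.subset_span ⟨n, hn, _, rfl⟩
    | add x y _ _ hx hy => exact add_mem hx hy
    | zero => exact zero_mem _
    | mul x y _ _ hx hy => exact hmul x hx y hy
    | smul c x _ hx => exact Submodule.smul_mem _ c hx

end Span

/-! ### Vanishing of the antisymmetrizers -/

section Vanishing

variable {N n : ℕ} {q : ℂ} {R Ψ : Matrix (Fin N × Fin N) (Fin N × Fin N) ℂ}

/-- The tensor `v ⊗ x_i`. -/
def append (i : Fin N) : ((Fin n → Fin N) → ℂ) →ₗ[ℂ] ((Fin (n + 1) → Fin N) → ℂ) where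
  toFun v z := if z (Fin.last n) = i then v (z ∘ Fin.castSucc) else 0
  map_add' v w := by
    funext z
    by_cases h : z (Fin.last n) = i <;> simp [h]
  map_smul' c v := by
    funext z
    by_cases h : z (Fin.last n) = i <;> simp [h]

theorem append_cat (i : Fin N) (v : (Fin n → Fin N) → ℂ) (x : Fin n → Fin N) (a : Fin N) :
    append i v (cat x a) = if a = i then v x else 0 := by
  simp [append, cat_comp_castSucc]

theorem append_mulVec (i : Fin N) (M : Matrix (Fin n → Fin N) (Fin n → Fin N) ℂ)
    (v : (Fin n → Fin N) → ℂ) :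
    append i (M.mulVec v) = (ext M).mulVec (append i v) := by
  funext z
  obtain ⟨x, a, rfl⟩ := exists_cat z
  simp only [append_cat, Matrix.mulVec, dotProduct, sum_cat, ext_cat, mul_ite, mul_zero,
    Finset.sum_ite_eq', Finset.mem_univ, if_true, ite_mul, zero_mul]
  by_cases h : a = i <;> simp [h]

theorem sum_smul_append_append (M : Matrix (Fin N × Fin N) (Fin N × Fin N) ℂ)
    (v : Fin N × Fin N) (w : (Fin n → Fin N) → ℂ) :
    ∑ u : Fin N × Fin N, M u v • append u.2 (append u.1 w) =
      (site2 (n + 2) M n).mulVec (append v.2 (append v.1 w)) := by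
  funext z
  obtain ⟨y, b, rfl⟩ := exists_cat z
  obtain ⟨x, a, rfl⟩ := exists_cat y
  simp only [Finset.sum_apply, Pi.smul_apply, append_cat, Matrix.mulVec, dotProduct, sum_cat,
    site2_cat, smul_eq_mul, mul_ite, mul_zero, ite_mul, zero_mul, Finset.sum_ite_eq',
    Finset.mem_univ, if_true, Fintype.sum_prod_type]
  simp

theorem site2_add_smul (c : ℂ) (R : Matrix (Fin N × Fin N) (Fin N × Fin N) ℂ) {n k : ℕ}
    (h : k + 1 < n) : site2 n (c • 1 + R) k = c • 1 + site2 n R k := by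
  simp only [site2, dif_pos h, pairMat_add, pairMat_smul, pairMat_one, place_add, place_smul,
    place_one]

/-- `M ⊗ I`, as a homomorphism of algebras. -/
def extHom (N n : ℕ) : Matrix (Fin n → Fin N) (Fin n → Fin N) ℂ →ₐ[ℂ]
    Matrix (Fin (n + 1) → Fin N) (Fin (n + 1) → Fin N) ℂ := placeHom N (Nat.le_succ n)

/-- Because of this absorption, projecting after each appended factor is the same as projecting once
at the end. -/
theorem asym_mul_ext (hq : IsGeneric q) (hR : IsHeckeSymmetry q R) (n : ℕ) :
    asym q (site2 (n + 1) R) (n + 1) * ext (asym q (site2 n R) n) =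
      asym q (site2 (n + 1) R) (n + 1) := by
  have h : ext (asym q (site2 n R) n) = asym q (site2 (n + 1) R) n :=
    map_asym (extHom N n) n fun i hi => placeHom_site2 _ R hi
  rw [h]
  exact ((site2_isHeckeFamily hR (n + 1)).asym_spec hq n le_rfl).2.1

/-- The right action of the generator `x_i` of the skew-symmetric algebra on sequences of
tensors. -/
def skewAct (q : ℂ) (R : Matrix (Fin N × Fin N) (Fin N × Fin N) ℂ) (i : Fin N) :
    Module.End ℂ (∀ n : ℕ, (Fin n → Fin N) → ℂ) where
  toFun v
    | 0 => 0
    | n + 1 => (asym q (site2 (n + 1) R) (n + 1)).mulVec (append i (v n))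
  map_add' v w := by
    funext n
    cases n with
    | zero => simp
    | succ n => simp only [Pi.add_apply, map_add, Matrix.mulVec_add]
  map_smul' c v := by
    funext n
    cases n with
    | zero => simp
    | succ n => simp only [Pi.smul_apply, map_smul, Matrix.mulVec_smul, RingHom.id_apply]

theorem skewAct_succ (i : Fin N) (v : ∀ n : ℕ, (Fin n → Fin N) → ℂ) (n : ℕ) :
    skewAct q R i v (n + 1) = (asym q (site2 (n + 1) R) (n + 1)).mulVec (append i (v n)) := rfl

theorem skewAct_skewAct (hq : IsGeneric q) (hR : IsHeckeSymmetry q R) (i j : Fin N)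
    (v : ∀ n : ℕ, (Fin n → Fin N) → ℂ) (n : ℕ) :
    skewAct q R j (skewAct q R i v) (n + 2) =
      (asym q (site2 (n + 2) R) (n + 2)).mulVec (append j (append i (v n))) := by
  rw [skewAct_succ, skewAct_succ, append_mulVec, Matrix.mulVec_mulVec, asym_mul_ext hq hR]

/-- The antisymmetrizer has eigenvalue $-q^{-1}$ on the last generator, so it kills $q^{-1}I+R$
placed in the last two factors. The order of the two operators is reversed because the action is a
right action. -/
theorem skewAct_rel (hq : IsGeneric q) (hR : IsHeckeSymmetry q R) (v : Fin N × Fin N) :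
    ∑ u : Fin N × Fin N, (q⁻¹ • 1 + R : Matrix (Fin N × Fin N) (Fin N × Fin N) ℂ) u v •
      (skewAct q R u.2 * skewAct q R u.1) = 0 := by
  refine LinearMap.ext fun w => funext fun n => ?_
  simp only [LinearMap.sum_apply, LinearMap.smul_apply, Module.End.mul_apply, Finset.sum_apply,
    Pi.smul_apply, LinearMap.zero_apply, Pi.zero_apply]
  match n with
  | 0 => exact Finset.sum_eq_zero fun u _ => smul_zero _
  | 1 =>
    refine Finset.sum_eq_zero fun u _ => ?_
    rw [skewAct_succ]
    have : skewAct q R u.1 w 0 = 0 := rfl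
    rw [this, map_zero, Matrix.mulVec_zero, smul_zero]
  | n + 2 =>
    have ht := site2_isHeckeFamily hR (n + 2)
    have h := ht.asym_mul hq (k := n + 2) (i := n) le_rfl (by omega)
    simp only [skewAct_skewAct hq hR, ← Matrix.mulVec_smul]
    rw [← Matrix.mulVec_sum, sum_smul_append_append, Matrix.mulVec_mulVec,
      site2_add_smul _ _ (by omega), mul_add, h, mul_smul_comm, mul_one, neg_smul, add_neg_cancel,
      Matrix.zero_mulVec]

/-- The right action of the skew-symmetric algebra on sequences of tensors. -/
def skewRep (hq : IsGeneric q) (hR : IsHeckeSymmetry q R) :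
    SkewAlgebra q R →ₐ[ℂ] (Module.End ℂ (∀ n : ℕ, (Fin n → Fin N) → ℂ))ᵐᵒᵖ :=
  RingQuot.liftAlgHom ℂ ⟨FreeAlgebra.lift ℂ fun i => MulOpposite.op (skewAct q R i), by
    intro x y hxy
    cases hxy with
    | rel v =>
      simp only [map_sum, map_smul, map_mul, map_zero, FreeAlgebra.lift_ι_apply,
        ← MulOpposite.op_mul, ← MulOpposite.op_smul]
      have h := congrArg MulOpposite.op (skewAct_rel hq hR v)
      rw [MulOpposite.op_zero] at h
      rw [← h]
      exact (Finset.op_sum _ _).symm⟩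

theorem skewRep_mk (hq : IsGeneric q) (hR : IsHeckeSymmetry q R) (f : FreeAlgebra ℂ (Fin N)) :
    skewRep hq hR (SkewAlgebra.mk q R f) =
      FreeAlgebra.lift ℂ (fun i => MulOpposite.op (skewAct q R i)) f :=
  RingQuot.liftAlgHom_mkAlgHom_apply ..

/-- The vacuum is 1 in degree 0. Its image under a word of degree `n` is a column of the
antisymmetrizer, so a vanishing component of the algebra forces the matrix to vanish. -/
theorem skewRep_word (hq : IsGeneric q) (hR : IsHeckeSymmetry q R) : ∀ (n : ℕ)
    (w : Fin n → Fin N),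
    (MulOpposite.unop (skewRep hq hR (SkewAlgebra.mk q R
      (List.ofFn fun i => FreeAlgebra.ι ℂ (w i)).prod))) (fun n _ => if n = 0 then 1 else 0) n =
      (asym q (site2 n R) n).mulVec (Pi.single w 1)
  | 0, w => by
    funext x
    have : x = w := Subsingleton.elim _ _
    simp [asym, this]
  | n + 1, w => by
    obtain ⟨x, a, rfl⟩ := exists_cat w
    have ih := skewRep_word hq hR n x
    have e : (List.ofFn fun i => FreeAlgebra.ι ℂ (cat x a i)).prod =
        (List.ofFn fun i => FreeAlgebra.ι ℂ (x i)).prod * FreeAlgebra.ι ℂ a := by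
      rw [List.ofFn_succ']
      simp
    have ea : append a (Pi.single x (1 : ℂ)) = Pi.single (cat x a) 1 := by
      funext z
      obtain ⟨y, b, rfl⟩ := exists_cat z
      rw [append_cat, Pi.single_apply, Pi.single_apply]
      by_cases hb : b = a <;> simp [hb, cat_inj]
    rw [e, map_mul, map_mul, MulOpposite.unop_mul, Module.End.mul_apply, skewRep_mk hq hR
      (FreeAlgebra.ι ℂ a), FreeAlgebra.lift_ι_apply, MulOpposite.unop_op, skewAct_succ, ih,
      append_mulVec, Matrix.mulVec_mulVec, asym_mul_ext hq hR, ea]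

theorem asym_eq_zero (hq : IsGeneric q) (hR : IsHeckeSymmetry q R) (h : skewComponent q R n = ⊥) :
    asym q (site2 n R) n = 0 := by
  ext x w
  have hw : SkewAlgebra.mk q R (List.ofFn fun i => FreeAlgebra.ι ℂ (w i)).prod = 0 := by
    have : SkewAlgebra.mk q R (List.ofFn fun i => FreeAlgebra.ι ℂ (w i)).prod ∈
        skewComponent q R n := Submodule.subset_span ⟨w, rfl⟩
    rwa [h, Submodule.mem_bot] at this
  have hv := congrFun (skewRep_word hq hR n w) x
  rw [hw, map_zero, MulOpposite.unop_zero] at hv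
  rw [Matrix.mulVec_single_one] at hv
  exact hv.symm

theorem skewComponent_eq_bot {m : ℕ} (hm : IsEvenOfBirank q R m) (h : m < n) :
    skewComponent q R n = ⊥ := by
  obtain ⟨P, hP, hdeg⟩ := hm.2
  have h1 := congrArg (PowerSeries.coeff n) hP
  rw [skewHilbertSeries, PowerSeries.coeff_mk, Polynomial.coeff_coe,
    Polynomial.coeff_eq_zero_of_natDegree_lt (hdeg.trans_lt h)] at h1
  -- `finrank` is 0 for infinite-dimensional spaces too; finitely many words span the component,
  -- which excludes this.
  have hf : Module.Finite ℂ (skewComponent q R n) :=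
    Module.Finite.span_of_finite ℂ (Set.finite_range _)
  exact Submodule.finrank_eq_zero.1 h1.symm

theorem elemSymm_eq_zero (hq : IsGeneric q) (hR : IsHeckeSymmetry q R) {m : ℕ}
    (hm : IsEvenOfBirank q R m) (h : m < n) : elemSymm hR Ψ n = 0 := by
  rw [elemSymm_eq, asym_eq_zero hq hR (skewComponent_eq_bot hm h), map_zero]

end Vanishing

/-! ### Generators of the characteristic subalgebra -/

section Generators

variable {U : Type*} [Ring U] [Algebra ℂ U]

/-- Newton identities relate the generators triangularly. -/
theorem adjoin_eq_adjoin_of_newton {a p : ℕ → U} {c : ℕ → ℂ} {d : ℕ → ℕ → ℂ} (ha : a 0 = 1)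
    (hc : ∀ n, 1 ≤ n → c n ≠ 0) (hd : ∀ n, 1 ≤ n → d n 0 ≠ 0)
    (h : ∀ n, 1 ≤ n → c n • a n = ∑ i ∈ Finset.range n, d n i • (a i * p (n - i))) (n : ℕ) :
    NonUnitalAlgebra.adjoin ℂ (p '' Set.Icc 1 n) =
      NonUnitalAlgebra.adjoin ℂ (a '' Set.Icc 1 n) := by
  have mono : ∀ (f : ℕ → U) {k l : ℕ}, k ≤ l → NonUnitalAlgebra.adjoin ℂ (f '' Set.Icc 1 k) ≤
      NonUnitalAlgebra.adjoin ℂ (f '' Set.Icc 1 l) := fun f k l hkl =>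
    NonUnitalAlgebra.adjoin_mono (Set.image_mono (Set.Icc_subset_Icc_right hkl))
  have self : ∀ (f : ℕ → U) {k l : ℕ}, 1 ≤ k → k ≤ l →
      f k ∈ NonUnitalAlgebra.adjoin ℂ (f '' Set.Icc 1 l) := fun f k l h1 h2 =>
    NonUnitalAlgebra.subset_adjoin ℂ ⟨k, ⟨h1, h2⟩, rfl⟩
  have cancel : ∀ (S : NonUnitalSubalgebra ℂ U) {r : ℂ} {x : U}, r ≠ 0 → r • x ∈ S → x ∈ S := by
    intro S r x hr hx
    have := S.smul_mem r⁻¹ hx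
    rwa [smul_smul, inv_mul_cancel₀ hr, one_smul] at this
  -- Since `a 0 = 1`, the term `i = 0` is a nonzero multiple of the top `p`. All other terms are
  -- products of elements of smaller index, so the relation can be solved for either top element.
  have h' : ∀ n, c (n + 1) • a (n + 1) = ∑ i ∈ Finset.range n,
      d (n + 1) (i + 1) • (a (i + 1) * p (n - i)) + d (n + 1) 0 • p (n + 1) := by
    intro n
    rw [h (n + 1) (by omega), Finset.sum_range_succ', ha, one_mul]
    simp
  have hpa : ∀ n, 1 ≤ n → p n ∈ NonUnitalAlgebra.adjoin ℂ (a '' Set.Icc 1 n) := by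
    intro n
    induction n using Nat.strong_induction_on with
    | _ n IH =>
      intro hn
      obtain ⟨n, rfl⟩ : ∃ k, n = k + 1 := ⟨n - 1, by omega⟩
      refine cancel _ (hd (n + 1) hn) ?_
      rw [eq_sub_of_add_eq' (h' n).symm]
      refine sub_mem (SMulMemClass.smul_mem _ (self a hn le_rfl)) (sum_mem fun i hi => ?_)
      have hi := Finset.mem_range.1 hi
      exact SMulMemClass.smul_mem _ (mul_mem (self a (by omega) (by omega))
        (mono a (by omega) (IH (n - i) (by omega) (by omega))))
  have hap : ∀ n, 1 ≤ n → a n ∈ NonUnitalAlgebra.adjoin ℂ (p '' Set.Icc 1 n) := by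
    intro n
    induction n using Nat.strong_induction_on with
    | _ n IH =>
      intro hn
      obtain ⟨n, rfl⟩ : ∃ k, n = k + 1 := ⟨n - 1, by omega⟩
      refine cancel _ (hc (n + 1) hn) ?_
      rw [h' n]
      refine add_mem (sum_mem fun i hi => ?_) (SMulMemClass.smul_mem _ (self p hn le_rfl))
      have hi := Finset.mem_range.1 hi
      exact SMulMemClass.smul_mem _ (mul_mem
        (mono p (by omega) (IH (i + 1) (by omega) (by omega))) (self p (by omega) (by omega)))
  apply le_antisymm
  · refine NonUnitalAlgebra.adjoin_le ?_
    rintro _ ⟨k, hk, rfl⟩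
    exact mono a hk.2 (hpa k hk.1)
  · refine NonUnitalAlgebra.adjoin_le ?_
    rintro _ ⟨k, hk, rfl⟩
    exact mono p hk.2 (hap k hk.1)

variable {N : ℕ} {q : ℂ} {R Ψ : Matrix (Fin N × Fin N) (Fin N × Fin N) ℂ}

theorem adjoin_powerSum_eq (hq : IsGeneric q) (hR : IsHeckeSymmetry q R) (hΨ : IsSkewInverse R Ψ)
    (n : ℕ) : NonUnitalAlgebra.adjoin ℂ (powerSum hR Ψ '' Set.Icc 1 n) =
      NonUnitalAlgebra.adjoin ℂ (elemSymm hR Ψ '' Set.Icc 1 n) :=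
  adjoin_eq_adjoin_of_newton (elemSymm_zero hR) (fun _ hn => qNum_ne_zero hq hn)
    (fun _ _ => mul_ne_zero (pow_ne_zero _ (by norm_num)) (pow_ne_zero _ hq.1))
    (fun _ hn => newton_first hq hR hΨ hn) n

theorem adjoin_powerSum'_eq (hq : IsGeneric q) (hR : IsHeckeSymmetry q R) (hΨ : IsSkewInverse R Ψ)
    (n : ℕ) : NonUnitalAlgebra.adjoin ℂ (powerSum' hR Ψ '' Set.Icc 1 n) =
      NonUnitalAlgebra.adjoin ℂ (elemSymm hR Ψ '' Set.Icc 1 n) :=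
  adjoin_eq_adjoin_of_newton (elemSymm_zero hR) (fun _ hn => qNum_ne_zero hq hn)
    (fun _ _ => mul_ne_zero (pow_ne_zero _ (by norm_num))
      (pow_ne_zero _ (inv_ne_zero hq.1)))
    (fun _ hn => newton_second hq hR hΨ hn) n

/-- Each $p_n$ lies in the algebra generated by $a_1,\dots,a_n$, and those $a_k$ with $k>m$ are
zero. -/
theorem adjoin_elemSymm_eq_characteristicSpace (hq : IsGeneric q) (hR : IsHeckeSymmetry q R)
    (hΨ : IsSkewInverse R Ψ) {m : ℕ} (hm : IsEvenOfBirank q R m) :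
    (NonUnitalAlgebra.adjoin ℂ (elemSymm hR Ψ '' Set.Icc 1 m)).toSubmodule =
      characteristicSpace hR Ψ := by
  rw [characteristicSpace_eq_adjoin hq hR hΨ]
  congr 1
  apply le_antisymm
  · rw [← adjoin_powerSum_eq hq hR hΨ]
    exact NonUnitalAlgebra.adjoin_mono (Set.image_mono fun _ h => h.1)
  · refine NonUnitalAlgebra.adjoin_le ?_
    rintro _ ⟨n, hn, rfl⟩
    have h : powerSum hR Ψ n ∈ NonUnitalAlgebra.adjoin ℂ (powerSum hR Ψ '' Set.Icc 1 n) :=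
      NonUnitalAlgebra.subset_adjoin ℂ ⟨n, ⟨hn, le_rfl⟩, rfl⟩
    rw [adjoin_powerSum_eq hq hR hΨ] at h
    refine NonUnitalAlgebra.adjoin_le ?_ h
    rintro _ ⟨k, hk, rfl⟩
    rcases Nat.lt_or_ge m k with hmk | hmk
    · rw [elemSymm_eq_zero hq hR hm hmk]
      exact zero_mem _
    · exact NonUnitalAlgebra.subset_adjoin ℂ ⟨k, ⟨hk.1, hmk⟩, rfl⟩

end Generators

end RE

end

theorem proposition2 (N m : ℕ) (q : ℂ) (hq : RE.IsGeneric q)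
    (R : Matrix (Fin N × Fin N) (Fin N × Fin N) ℂ) (hR : RE.IsHeckeSymmetry q R)
    (Ψ : Matrix (Fin N × Fin N) (Fin N × Fin N) ℂ) (hΨ : RE.IsSkewInverse R Ψ)
    (hm : RE.IsEvenOfBirank q R m) :
    -- the quantum Newton identities of both kinds, and the relation of the two kinds of power sums
    (∀ n : ℕ, 1 ≤ n →
      RE.qNum q n • RE.elemSymm hR Ψ n + ∑ k ∈ Finset.Icc 1 n,
        ((-1 : ℂ) ^ k * q ^ ((n : ℤ) - (k : ℤ))) •
          (RE.elemSymm hR Ψ (n - k) * RE.powerSum hR Ψ k) = 0) ∧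
    (∀ n : ℕ, 1 ≤ n →
      RE.qNum q n • RE.elemSymm hR Ψ n + ∑ k ∈ Finset.Icc 1 n,
        ((-1 : ℂ) ^ k * q ^ ((k : ℤ) - (n : ℤ))) •
          (RE.elemSymm hR Ψ (n - k) * RE.powerSum' hR Ψ k) = 0) ∧
    (∀ n : ℕ, 1 ≤ n →
      RE.powerSum hR Ψ n = RE.powerSum' hR Ψ n + (q - q⁻¹) • ∑ k ∈ Finset.Icc 1 (n - 1),
        RE.powerSum hR Ψ (n - k) * RE.powerSum' hR Ψ k) ∧
    -- the first members, and the vanishing of the higher elementary symmetric polynomials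
    RE.elemSymm hR Ψ 0 = 1 ∧
    (∀ n : ℕ, m < n → RE.elemSymm hR Ψ n = 0) ∧
    -- the three families are related triangularly
    (∀ n : ℕ,
      NonUnitalAlgebra.adjoin ℂ (RE.powerSum hR Ψ '' Set.Icc 1 n) =
        NonUnitalAlgebra.adjoin ℂ (RE.elemSymm hR Ψ '' Set.Icc 1 n) ∧
      NonUnitalAlgebra.adjoin ℂ (RE.powerSum' hR Ψ '' Set.Icc 1 n) =
        NonUnitalAlgebra.adjoin ℂ (RE.elemSymm hR Ψ '' Set.Icc 1 n)) ∧
    -- each of them generates the characteristic subalgebra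
    (NonUnitalAlgebra.adjoin ℂ (RE.elemSymm hR Ψ '' Set.Icc 1 m)).toSubmodule =
      RE.characteristicSpace hR Ψ ∧
    (NonUnitalAlgebra.adjoin ℂ (RE.powerSum hR Ψ '' Set.Icc 1 m)).toSubmodule =
      RE.characteristicSpace hR Ψ ∧
    (NonUnitalAlgebra.adjoin ℂ (RE.powerSum' hR Ψ '' Set.Icc 1 m)).toSubmodule =
      RE.characteristicSpace hR Ψ := by
  refine ⟨fun n hn => ?_, fun n hn => ?_, fun n hn => RE.powerSum_eq_add_sum hR hΨ hn,
    RE.elemSymm_zero hR, fun n hn => RE.elemSymm_eq_zero hq hR hm hn,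
    fun n => ⟨RE.adjoin_powerSum_eq hq hR hΨ n, RE.adjoin_powerSum'_eq hq hR hΨ n⟩,
    RE.adjoin_elemSymm_eq_characteristicSpace hq hR hΨ hm, ?_, ?_⟩
  · exact RE.add_sum_Icc_eq_zero (fun i k => RE.elemSymm hR Ψ i * RE.powerSum hR Ψ k)
      (RE.newton_first hq hR hΨ hn)
  · have h := RE.add_sum_Icc_eq_zero (fun i k => RE.elemSymm hR Ψ i * RE.powerSum' hR Ψ k)
      (RE.newton_second hq hR hΨ hn)
    simpa only [inv_zpow', neg_sub] using h
  · rw [RE.adjoin_powerSum_eq hq hR hΨ, RE.adjoin_elemSymm_eq_characteristicSpace hq hR hΨ hm]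
  · rw [RE.adjoin_powerSum'_eq hq hR hΨ, RE.adjoin_elemSymm_eq_characteristicSpace hq hR hΨ hm]
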